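/- Let $M$ be a smooth manifold of dimension $m$ and let $\Omega^k(M;TM)$ be the space of smooth $TM$-valued $k$-forms. For $K\in\Omega^k(M;TM)$ let $i_K$ be the insertion operator on differential forms ($i_{\varphi\otimes X}\omega=\varphi\wedge i_X\omega$) and $\Theta(K)=i_K d-(-1)^{k-1}d\,i_K$ the Lie derivative along $K$. The Frölicher–Nijenhuis bracket $[K,L]\in\Omega^{k+\ell}(M;TM)$ of $K\in\Omega^k(M;TM)$ and $L\in\Omega^\ell(M;TM)$ satisfies $\Theta([K,L])=\Theta(K)\Theta(L)-(-1)^{k\ell}\Theta(L)\Theta(K)$ on differential forms; in local coordinates it is given by $[K,L]^b=\Theta(K)L^b-(-1)^{k\ell}\Theta(L)K^b$, where $K=\sum_b K^b\otimes\partial_b$ and $L=\sum_b L^b\otimes\partial_b$. It makes $\Omega(M;TM)=\bigoplus_k\Omega^k(M;TM)$ a graded Lie algebra. Let $c:\Omega^k(M;TM)\to\Omega^{k-1}(M)$, $c(\varphi\otimes X)=i_X\varphi$, be the trace ($c=0$ for $k=0$), let $\mathcal C^k(M)=\{K\in\Omega^k(M;TM): c(K)=0\}$ be the space of traceless vector-valued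 $k$-forms, and put $\mathcal C(M)=\bigoplus_k\mathcal C^k(M)$. Let $S:\Omega^k(M;TM)\times\Omega^\ell(M;TM)\to\Omega^{k+\ell-2}(M)$ be the $C^\infty(M)$-bilinear map with $S(\varphi\otimes X,\psi\otimes Y)=i_Y\varphi\wedge i_X\psi$ (zero if $k=0$ or $\ell=0$), and let $\mathbf I=\mathrm{Id}_{TM}\in\Omega^1(M;TM)$. For $K\in\mathcal C^k(M)$ and $L\in\mathcal C^\ell(M)$ define $$[K,L]^c=[K,L]-\frac{(-1)^\ell}{m-k-\ell+1}\,dS(K,L)\wedge\mathbf I,$$ where the last term is read as $0$ if $k+\ell>m$ (it is then a form of degree greater than $m$). Then: 1. $[K,L]^c\in\mathcal C^{k+\ell}(M)$, and $(\mathcal C(M),[\;,\;]^c)$ is a graded Lie algebra: the bracket is bilinear, $[K,L]^c=-(-1)^{k\ell}[L,K]^c$, and $[K,[L,P]^c]^c=[[K,L]^c,P]^c+(-1)^{k\ell}[L,[K,P]^c]^c$ for $K,L,P$ traceless of degrees $k,\ell,p$. 2. $(\mathcal C(M),[\;,\;]^c)$ is a quotient of a graded Lie subalgebra of $(\Omega(M;TM),[\;,\;])$: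 there is a surjective homomorphism of graded Lie algebras from such a subalgebra onto $\mathcal C(M)$. 3. $[\;,\;]^c$ is a bilinear differential operator of order (at most) $1$: in every chart, $[K,L]^c$ is a bilinear expression, with smooth coefficients, in the values and first derivatives of $K$ and of $L$. 4. $[\;,\;]^c$ is natural: if $N$ is another smooth manifold of dimension $m$ and $f:M\to N$ is a local diffeomorphism, then for $K\in\mathcal C^k(N)$ and $L\in\mathcal C^\ell(N)$ the pullbacks $f^*K$, $f^*L$, where $(f^*K)_x(v_1,\dots,v_k)=(T_xf)^{-1}K_{f(x)}(T_xf\,v_1,\dots,T_xf\,v_k)$, are traceless and $f^*([K,L]^c)=[f^*K,f^*L]^c$. -/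

import Mathlib

open scoped Manifold ContDiff

namespace VVForm

noncomputable section

/-! ### Multilinear algebra -/

/-- Transport along an equality of degrees. -/
def degCast (V : ℕ → Type*) {k l : ℕ} (h : k = l) (v : V k) : V l :=
  cast (congrArg V h) v

section Wedge

variable {E F : Type*} [NormedAddCommGroup E] [NormedSpace ℝ E]
  [NormedAddCommGroup F] [NormedSpace ℝ F]

/-- The multilinear map `v ↦ φ (v₁, …, v_k) • ψ (v_{k+1}, …, v_{k+l})`. -/
def tensor {k l : ℕ} (φ : E [⋀^Fin k]→L[ℝ] ℝ) (ψ : E [⋀^Fin l]→L[ℝ] F) :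
    ContinuousMultilinearMap ℝ (fun _ : Fin (k + l) => E) F where
  toMultilinearMap :=
    ((TensorProduct.lid ℝ F).toLinearMap.compMultilinearMap
      (MultilinearMap.domCoprod φ.toMultilinearMap ψ.toMultilinearMap)).domDomCongr
        finSumFinEquiv
  cont := by
    change Continuous fun v : Fin (k + l) → E =>
      φ (fun i => v (finSumFinEquiv (Sum.inl i))) • ψ (fun i => v (finSumFinEquiv (Sum.inr i)))
    exact (φ.cont.comp (by fun_prop)).smul (ψ.cont.comp (by fun_prop))

/-- The exterior product of a scalar form with an `F`-valued form,
`(φ ∧ ψ)(v) = 1/(k! l!) ∑_σ sign σ • φ (v_{σ1}, …, v_{σk}) • ψ (v_{σ(k+1)}, …, v_{σ(k+l)})`. -/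
def wedge {k l : ℕ} (φ : E [⋀^Fin k]→L[ℝ] ℝ) (ψ : E [⋀^Fin l]→L[ℝ] F) :
    E [⋀^Fin (k + l)]→L[ℝ] F :=
  ((k.factorial : ℝ) * (l.factorial : ℝ))⁻¹ •
    ContinuousMultilinearMap.alternatization (tensor φ ψ)

end Wedge

section Pointwise

variable {E F : Type*} [NormedAddCommGroup E] [NormedSpace ℝ E] [FiniteDimensional ℝ E]
  [NormedAddCommGroup F] [NormedSpace ℝ F]

/-- The coefficient `K^a` in `K = ∑_a K^a ⊗ ∂_a`. -/
def coeff {k : ℕ} (K : E [⋀^Fin k]→L[ℝ] E) (a : Fin (Module.finrank ℝ E)) :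
    E [⋀^Fin k]→L[ℝ] ℝ :=
  (LinearMap.toContinuousLinearMap ((Module.finBasis ℝ E).coord a)).compContinuousAlternatingMap K

/-- The insertion `i_{∂_a} η = η (∂_a, …)`. -/
def ins {l : ℕ} (a : Fin (Module.finrank ℝ E)) (η : E [⋀^Fin (l + 1)]→L[ℝ] F) :
    E [⋀^Fin l]→L[ℝ] F :=
  η.curryLeft (Module.finBasis ℝ E a)

/-- The insertion `i_K η` of a vector valued form, `i_{φ ⊗ X} η = φ ∧ i_X η`. -/
def insV {k l : ℕ} (K : E [⋀^Fin k]→L[ℝ] E)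
    (η : E [⋀^Fin (l + 1)]→L[ℝ] F) : E [⋀^Fin (k + l)]→L[ℝ] F :=
  ∑ a : Fin (Module.finrank ℝ E), wedge (coeff K a) (ins a η)

/-- The contraction (trace), `c (φ ⊗ X) = i_X φ`; it vanishes in degree `0`. -/
def contr : ∀ {k : ℕ}, (E [⋀^Fin k]→L[ℝ] E) → E [⋀^Fin (k - 1)]→L[ℝ] ℝ
  | 0, _ => 0
  | _ + 1, K => ∑ a : Fin (Module.finrank ℝ E), ins a (coeff K a)

/-- `S (φ ⊗ X, ψ ⊗ Y) = i_Y φ ∧ i_X ψ`, in positive degrees. -/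
def algS {k l : ℕ} (K : E [⋀^Fin (k + 1)]→L[ℝ] E)
    (L : E [⋀^Fin (l + 1)]→L[ℝ] E) : E [⋀^Fin (k + l)]→L[ℝ] ℝ :=
  ∑ a : Fin (Module.finrank ℝ E), ∑ b : Fin (Module.finrank ℝ E),
    wedge (ins b (coeff K a)) (ins a (coeff L b))

/-- The identity as a vector valued `1`-form. -/
def idForm (E : Type*) [NormedAddCommGroup E] [NormedSpace ℝ E] : E [⋀^Fin 1]→L[ℝ] E :=
  ContinuousAlternatingMap.ofSubsingleton ℝ E E (0 : Fin 1)
    (ContinuousLinearMap.id ℝ E)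

/-! ### The Frölicher–Nijenhuis bracket in a vector space -/

/-- The Lie derivative `Θ(K) = i_K d - (-1)^(k-1) d i_K` on (`F`-valued) forms on `E`. -/
def thetaFlat {k : ℕ} (K : E → E [⋀^Fin k]→L[ℝ] E) :
    ∀ {l : ℕ}, (E → E [⋀^Fin l]→L[ℝ] F) →
      E → E [⋀^Fin (k + l)]→L[ℝ] F
  | 0, η => fun y => insV (K y) (extDeriv η y)
  | _ + 1, η => fun y =>
      insV (K y) (extDeriv η y) + (-1 : ℝ) ^ k • extDeriv (fun z => insV (K z) (η z)) y

/-- The Frölicher–Nijenhuis bracket of vector valued forms on `E`. Its components are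
`[K, L]^b = Θ(K) L^b - (-1)^(kl) Θ(L) K^b`; this is the identity
`Θ([K, L]) = Θ(K) Θ(L) - (-1)^(kl) Θ(L) Θ(K)` applied to the coordinate functions `x^b`. -/
def fnFlat {k l : ℕ} (K : E → E [⋀^Fin k]→L[ℝ] E)
    (L : E → E [⋀^Fin l]→L[ℝ] E) :
    E → E [⋀^Fin (k + l)]→L[ℝ] E := fun y =>
  thetaFlat K L y - (-1 : ℝ) ^ (k * l) •
    degCast (fun n => E [⋀^Fin n]→L[ℝ] E) (Nat.add_comm l k) (thetaFlat L K y)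

end Pointwise

/-! ### Forms on manifolds -/

/-- Fields of scalar alternating `k`-forms on a manifold `M` modelled on the finite-dimensional
space `E`, so that `dim M = finrank ℝ E`. The values are alternating maps on the tangent spaces:
`TangentSpace 𝓘(ℝ, E) x` is by definition `E`. -/
abbrev SField (E : Type*) [NormedAddCommGroup E] [NormedSpace ℝ E]
    (M : Type*) (k : ℕ) := M → E [⋀^Fin k]→L[ℝ] ℝ

/-- Fields of tangent-space-valued alternating `k`-forms `Λ^k T_x M → T_x M`. -/
abbrev VField (E : Type*) [NormedAddCommGroup E] [NormedSpace ℝ E]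
    (M : Type*) (k : ℕ) := M → E [⋀^Fin k]→L[ℝ] E

section Manifold

variable {E : Type*} [NormedAddCommGroup E] [NormedSpace ℝ E]
  {M : Type*} [TopologicalSpace M] [ChartedSpace E M]
  {N : Type*} [TopologicalSpace N] [ChartedSpace E N]

/-- The tangent map `T_x f : T_x M → T_{f x} N`. -/
def tmap (f : M → N) (x : M) : E →L[ℝ] E :=
  mfderiv 𝓘(ℝ, E) 𝓘(ℝ, E) f x

/-- Pullback of scalar forms. -/
def pullS (f : M → N) {k : ℕ} (η : SField E N k) : SField E M k := fun x =>
  (η (f x)).compContinuousLinearMap (tmap f x)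

/-- Pullback of vector valued forms,
`(f^* K)_x (v₁, …, v_k) = (T_x f)⁻¹ (K_{f x} (T_x f v₁, …, T_x f v_k))`. -/
def pullV (f : M → N) {k : ℕ} (K : VField E N k) : VField E M k := fun x =>
  (tmap f x).inverse.compContinuousAlternatingMap
    ((K (f x)).compContinuousLinearMap (tmap f x))

theorem pullS_add (f : M → N) {k : ℕ} (η η' : SField E N k) :
    pullS f (η + η') = pullS f η + pullS f η' := rfl

theorem pullS_smul (f : M → N) {k : ℕ} (r : ℝ) (η : SField E N k) :
    pullS f (r • η) = r • pullS f η := rfl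

theorem pullV_add (f : M → N) {k : ℕ} (K L : VField E N k) :
    pullV f (K + L) = pullV f K + pullV f L := by
  funext x; ext1 v; simp [pullV]

theorem pullV_smul (f : M → N) {k : ℕ} (r : ℝ) (K : VField E N k) :
    pullV f (r • K) = r • pullV f K := by
  funext x; ext1 v; simp [pullV]

variable (E M) in
/-- `Ω^k(M)`: the smooth scalar `k`-forms, i.e. those whose expression in every chart is smooth. -/
def ScalarForms (k : ℕ) : Submodule ℝ (SField E M k) where
  carrier := {η | ∀ e ∈ atlas E M, ContDiffOn ℝ ∞ (pullS e.symm η) e.target}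
  zero_mem' := fun _ _ => contDiffOn_const (c := 0)
  add_mem' := fun {a b} ha hb e he => by
    rw [pullS_add]; exact (ha e he).add (hb e he)
  smul_mem' := fun r a ha e he => by
    rw [pullS_smul]; exact (ha e he).const_smul r

variable (E M) in
/-- `Ω^k(M; TM)`: the smooth vector valued `k`-forms. -/
def VectorForms (k : ℕ) : Submodule ℝ (VField E M k) where
  carrier := {K | ∀ e ∈ atlas E M, ContDiffOn ℝ ∞ (pullV e.symm K) e.target}
  zero_mem' := fun e _ => by
    have h : pullV e.symm (0 : VField E M k) = 0 := by
      have h0 := pullV_smul e.symm (0 : ℝ) (0 : VField E M k)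
      rwa [zero_smul, zero_smul] at h0
    rw [h]; exact contDiffOn_const (c := 0)
  add_mem' := fun {a b} ha hb e he => by
    rw [pullV_add]; exact (ha e he).add (hb e he)
  smul_mem' := fun r a ha e he => by
    rw [pullV_smul]; exact (ha e he).const_smul r

variable [FiniteDimensional ℝ E]

theorem contr_add {k : ℕ} (K L : E [⋀^Fin k]→L[ℝ] E) :
    contr (K + L) = contr K + contr L := by
  cases k with
  | zero => simp [contr]
  | succ k =>
    simp only [contr, ← Finset.sum_add_distrib]
    refine Finset.sum_congr rfl fun a _ => ?_
    ext1 v; simp [ins, coeff]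

theorem contr_smul {k : ℕ} (r : ℝ) (K : E [⋀^Fin k]→L[ℝ] E) :
    contr (r • K) = r • contr K := by
  cases k with
  | zero => simp [contr]
  | succ k =>
    simp only [contr, Finset.smul_sum]
    refine Finset.sum_congr rfl fun a _ => ?_
    ext1 v; simp [ins, coeff]

variable (E M) in
/-- `C^k(M)`: the traceless smooth vector valued `k`-forms. -/
def Traceless (k : ℕ) : Submodule ℝ (VField E M k) where
  carrier := {K | K ∈ VectorForms E M k ∧ ∀ x, contr (K x) = 0}
  zero_mem' := ⟨zero_mem _, fun x => by
    have h0 := contr_smul (0 : ℝ) (0 : E [⋀^Fin k]→L[ℝ] E)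
    rwa [zero_smul, zero_smul] at h0⟩
  add_mem' := fun {a b} ha hb => ⟨add_mem ha.1 hb.1, fun x => by
    rw [Pi.add_apply, contr_add, ha.2 x, hb.2 x, add_zero]⟩
  smul_mem' := fun r a ha => ⟨Submodule.smul_mem _ r ha.1, fun x => by
    rw [Pi.smul_apply, contr_smul, ha.2 x, smul_zero]⟩

/-- The exterior derivative on `M`, computed at `x` in the preferred chart at `x`. -/
def extd {k : ℕ} (η : SField E M k) : SField E M (k + 1) := fun x =>
  pullS (chartAt E x) (extDeriv (pullS (chartAt E x).symm η)) x

/-- The Lie derivative `Θ(K) = i_K d - (-1)^(k-1) d i_K` on scalar forms on `M`. -/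
def theta {k : ℕ} (K : VField E M k) : ∀ {l : ℕ}, SField E M l → SField E M (k + l)
  | 0, η => fun x => insV (K x) (extd η x)
  | _ + 1, η => fun x =>
      insV (K x) (extd η x) + (-1 : ℝ) ^ k • extd (fun z => insV (K z) (η z)) x

/-- The Frölicher–Nijenhuis bracket on `M`, computed at `x` in the preferred chart at `x`. -/
def fnBracket {k l : ℕ} (K : VField E M k) (L : VField E M l) : VField E M (k + l) := fun x =>
  pullV (chartAt E x)
    (fnFlat (pullV (chartAt E x).symm K) (pullV (chartAt E x).symm L)) x

/-- `dS(K, L) ∧ I`; since `S` has degree `k + l - 2` and contracts both arguments, it is zero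
if `k = 0` or `l = 0`. -/
def dSWedgeId : ∀ {k l : ℕ}, VField E M k → VField E M l → VField E M (k + l)
  | 0, _, _, _ => 0
  | _ + 1, 0, _, _ => 0
  | k + 1, l + 1, K, L =>
      degCast (VField E M) (by omega : k + l + 1 + 1 = k + 1 + (l + 1))
        (fun x => wedge (extd (fun z => algS (K z) (L z)) x) (idForm E))

/-- `[K, L]^c = [K, L] - (-1)^l / (m - k - l + 1) dS(K, L) ∧ I`, where `m = dim M`. For
`k + l = m + 1` the denominator vanishes, but then `dS(K, L) ∧ I` is a form of degree `m + 1`, hence zero. -/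
def cBracket {k l : ℕ} (K : VField E M k) (L : VField E M l) : VField E M (k + l) :=
  fnBracket K L - ((-1 : ℝ) ^ l / ((Module.finrank ℝ E : ℝ) - k - l + 1)) • dSWedgeId K L

end Manifold

section DiffOp

variable {E : Type*} [NormedAddCommGroup E] [NormedSpace ℝ E]

/-- The `1`-jets at a point of vector valued `k`-forms on `E`: values and first derivatives. -/
abbrev Jet (E : Type*) [NormedAddCommGroup E] [NormedSpace ℝ E] (k : ℕ) :=
  (E [⋀^Fin k]→L[ℝ] E) × (E →L[ℝ] (E [⋀^Fin k]→L[ℝ] E))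

/-- The `1`-jet at `y`. -/
def jet {k : ℕ} (K : E → E [⋀^Fin k]→L[ℝ] E) (y : E) : Jet E k :=
  (K y, fderiv ℝ K y)

/-- `B`, defined on sections `K ∈ A`, `L ∈ A'`, is a bilinear differential operator of order (at
most) one: in each chart `B (K, L)` is a bilinear expression in the `1`-jets of `K` and `L`, with
smooth coefficients. -/
def IsBilinearDiffOpOrderOne {M : Type*} [TopologicalSpace M] [ChartedSpace E M] {k l n : ℕ}
    (A : Submodule ℝ (VField E M k)) (A' : Submodule ℝ (VField E M l))
    (B : VField E M k → VField E M l → VField E M n) : Prop :=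
  ∀ e ∈ atlas E M,
    ∃ β : E → Jet E k →ₗ[ℝ] Jet E l →ₗ[ℝ] (E [⋀^Fin n]→L[ℝ] E),
      (∀ j j', ContDiffOn ℝ ∞ (fun y => β y j j') e.target) ∧
      ∀ K ∈ A, ∀ L ∈ A', ∀ y ∈ e.target,
        pullV e.symm (B K L) y = β y (jet (pullV e.symm K) y) (jet (pullV e.symm L) y)

end DiffOp

/-! ### Graded Lie algebras -/

/-- A graded Lie algebra structure on the graded real vector space `⨁_k V k`. -/
structure GradedLieStructure (V : ℕ → Type*) [∀ k, AddCommGroup (V k)]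
    [∀ k, Module ℝ (V k)] where
  bracket : ∀ {k l : ℕ}, V k →ₗ[ℝ] V l →ₗ[ℝ] V (k + l)
  antisymm : ∀ {k l : ℕ} (a : V k) (b : V l),
    bracket a b = -((-1 : ℝ) ^ (k * l) • degCast V (Nat.add_comm l k) (bracket b a))
  jacobi : ∀ {k l p : ℕ} (a : V k) (b : V l) (c : V p),
    bracket a (bracket b c) =
      degCast V (Nat.add_assoc k l p) (bracket (bracket a b) c) +
        (-1 : ℝ) ^ (k * l) • degCast V (Nat.add_left_comm l k p) (bracket b (bracket a c))

/-- A graded Lie subalgebra. -/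
structure GradedLieSubalgebra {V : ℕ → Type*} [∀ k, AddCommGroup (V k)]
    [∀ k, Module ℝ (V k)] (g : GradedLieStructure V) where
  carrier : ∀ k, Submodule ℝ (V k)
  bracket_mem : ∀ {k l : ℕ} {a : V k} {b : V l}, a ∈ carrier k → b ∈ carrier l →
    g.bracket a b ∈ carrier (k + l)

/-- `h` is a quotient of the subalgebra `A` of `g`: there is a surjective homomorphism of graded
Lie algebras from `A` onto `h`. -/
def IsQuotientOf {V W : ℕ → Type*} [∀ k, AddCommGroup (V k)] [∀ k, Module ℝ (V k)]
    [∀ k, AddCommGroup (W k)] [∀ k, Module ℝ (W k)]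
    (h : GradedLieStructure W) {g : GradedLieStructure V} (A : GradedLieSubalgebra g) : Prop :=
  ∃ π : ∀ k, A.carrier k →ₗ[ℝ] W k, (∀ k, Function.Surjective (π k)) ∧
    ∀ {k l : ℕ} (a : A.carrier k) (b : A.carrier l),
      π (k + l) ⟨g.bracket (a : V k) (b : V l), A.bracket_mem a.2 b.2⟩ =
        h.bracket (π k a) (π l b)

end

end VVForm

open VVForm

set_option linter.unusedSectionVars false

/-! In a chart `Θ(K) η = ∑ K^a ∧ ∂_a η + (-1)^k dK^a ∧ i_a η` is a graded derivation that commutes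
with `d` up to sign. In the graded commutator of `Θ(K)` and `Θ(L)` the second order parts cancel,
because partial derivatives commute and insertions anticommute; what remains is `Θ([K, L])`
(`Shuffle.lie_fn`). Applied to the components of a third field this gives the graded Jacobi identity
for the Frölicher–Nijenhuis bracket (`Shuffle.fn_jacobi`).

The corrected bracket comes from the trace formula `c[K, L] = (-1)^k Θ(K) c(L) - (-1)^(kl + l) Θ(L)
c(K) - (-1)^k dS(K, L)` (`Shuffle.tr_fn`). It shows that the fields with closed trace form a
subalgebra. Inside it the fields `φ ∧ I` with `φ` closed are an ideal, since `[K, φ ∧ I] = Θ(K)φ ∧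
I` (`Shuffle.fn_wedgeI`). In degree `n ≤ m` one has `c(φ ∧ I) = (-1)^(n+1) (m - n + 1) φ` with a
nonzero factor, so `K ↦ K + (-1)^n / (m - n + 1) c(K) ∧ I` is a projection onto the traceless fields
which kills this ideal. Dividing by the ideal therefore puts on the traceless fields the bracket
"project `[K, L]`", and for `c(K) = c(L) = 0` the trace formula turns this into `[K, L]^c`
(`Shuffle.cb_eq_pr`, `Shuffle.pr_fn`). Antisymmetry and Jacobi are inherited. In degrees above `m`
all forms vanish, so the zero denominator never matters.

For naturality, `d`, insertion, trace, `S` and `I` are natural, and `[K, L]` is determined by the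
operator `Θ([K, L])` on functions, which is a commutator of natural operators
(`IsEtale.fnFlat_pull`). The order is one because `Θ(K) L^b` and `dS(K, L)` contain only first
derivatives.

The identities are proved for components indexed by lists of directions, where every operation is
determined by its constant term and its behaviour under insertion. `evalL_wedge`, `Rep.extDeriv` and
`RepV.cBracket` carry them over to alternating maps, and `IsParam` carries those to manifolds. -/

namespace VVForm

noncomputable section

/-! ### The graded shuffle algebra

A family of coefficients `φ (a₁, …, a_k)`, indexed by lists of coordinate directions, stands for
an inhomogeneous differential form. Since all the operations of the exterior calculus are
determined by what they do under insertion of a coordinate vector field, they are defined here by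
recursion on the list; no transport between degrees is needed. -/

/-- Inhomogeneous forms with coefficients in `R`, given by their components. -/
def Shuffle (ι R : Type*) := List ι → R

namespace Shuffle

variable {ι R : Type*} [CommRing R] [Algebra ℝ R]

instance : AddCommGroup (Shuffle ι R) := inferInstanceAs (AddCommGroup (List ι → R))
instance : Module ℝ (Shuffle ι R) := inferInstanceAs (Module ℝ (List ι → R))

@[ext] theorem ext {φ ψ : Shuffle ι R} (h : ∀ l, φ l = ψ l) : φ = ψ := funext h

@[simp] theorem add_apply (φ ψ : Shuffle ι R) (l : List ι) : (φ + ψ) l = φ l + ψ l := rfl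
@[simp] theorem sub_apply (φ ψ : Shuffle ι R) (l : List ι) : (φ - ψ) l = φ l - ψ l := rfl
@[simp] theorem neg_apply (φ : Shuffle ι R) (l : List ι) : (-φ) l = -φ l := rfl
@[simp] theorem zero_apply (l : List ι) : (0 : Shuffle ι R) l = 0 := rfl
@[simp] theorem smul_apply (r : ℝ) (φ : Shuffle ι R) (l : List ι) : (r • φ) l = r • φ l := rfl

/-- Evaluation of the coefficient at a list, as a linear map. -/
def applyₗ (l : List ι) : Shuffle ι R →ₗ[ℝ] R where
  toFun φ := φ l
  map_add' _ _ := rfl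
  map_smul' _ _ := rfl

@[simp] theorem sum_apply {α : Type*} (s : Finset α) (f : α → Shuffle ι R) (l : List ι) :
    (∑ a ∈ s, f a) l = ∑ a ∈ s, f a l := map_sum (applyₗ l) f s

/-- Insertion of the coordinate vector field `∂_a`. -/
def cut (a : ι) : Shuffle ι R →ₗ[ℝ] Shuffle ι R where
  toFun φ := fun l => φ (a :: l)
  map_add' _ _ := rfl
  map_smul' _ _ := rfl

@[simp] theorem cut_apply (a : ι) (φ : Shuffle ι R) (l : List ι) : cut a φ l = φ (a :: l) := rfl

/-- The grading automorphism. -/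
def par : Shuffle ι R →ₗ[ℝ] Shuffle ι R where
  toFun φ := fun l => (-1 : ℝ) ^ l.length • φ l
  map_add' _ _ := funext fun _ => smul_add _ _ _
  map_smul' _ _ := funext fun _ => smul_comm _ _ _

@[simp] theorem par_apply (φ : Shuffle ι R) (l : List ι) :
    par φ l = (-1 : ℝ) ^ l.length • φ l := rfl

theorem cut_par (a : ι) (φ : Shuffle ι R) : cut a (par φ) = -par (cut a φ) := by
  ext l; simp [pow_succ]

theorem par_cut (a : ι) (φ : Shuffle ι R) : par (cut a φ) = -cut a (par φ) := by
  rw [cut_par, neg_neg]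

@[simp] theorem par_par (φ : Shuffle ι R) : par (par φ) = φ := by
  ext l; simp [smul_smul, ← mul_pow]

/-- The exterior product of components. -/
def mulAux : List ι → Shuffle ι R → Shuffle ι R → R
  | [], φ, ψ => φ [] * ψ []
  | a :: l, φ, ψ => mulAux l (cut a φ) ψ + mulAux l (par φ) (cut a ψ)

theorem mulAux_add (l : List ι) (φ ψ ψ' : Shuffle ι R) :
    mulAux l φ (ψ + ψ') = mulAux l φ ψ + mulAux l φ ψ' := by
  induction l generalizing φ ψ ψ' with
  | nil => simp [mulAux, mul_add]
  | cons a l ih => simp only [mulAux, map_add, ih]; abel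

theorem add_mulAux (l : List ι) (φ φ' ψ : Shuffle ι R) :
    mulAux l (φ + φ') ψ = mulAux l φ ψ + mulAux l φ' ψ := by
  induction l generalizing φ φ' ψ with
  | nil => simp [mulAux, add_mul]
  | cons a l ih => simp only [mulAux, map_add, ih]; abel

theorem smul_mulAux (r : ℝ) (l : List ι) (φ ψ : Shuffle ι R) :
    mulAux l (r • φ) ψ = r • mulAux l φ ψ := by
  induction l generalizing φ ψ with
  | nil => simp [mulAux]
  | cons a l ih => simp only [mulAux, map_smul, ih, smul_add]

theorem mulAux_smul (r : ℝ) (l : List ι) (φ ψ : Shuffle ι R) :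
    mulAux l φ (r • ψ) = r • mulAux l φ ψ := by
  induction l generalizing φ ψ with
  | nil => simp [mulAux]
  | cons a l ih => simp only [mulAux, map_smul, ih, smul_add]

instance : Mul (Shuffle ι R) := ⟨fun φ ψ l => mulAux l φ ψ⟩
instance : One (Shuffle ι R) := ⟨fun l => if l = [] then 1 else 0⟩

theorem mul_nil (φ ψ : Shuffle ι R) : (φ * ψ) [] = φ [] * ψ [] := rfl

theorem cut_mul (a : ι) (φ ψ : Shuffle ι R) :
    cut a (φ * ψ) = cut a φ * ψ + par φ * cut a ψ := rfl

theorem mul_cons (φ ψ : Shuffle ι R) (a : ι) (l : List ι) :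
    (φ * ψ) (a :: l) = (cut a φ * ψ) l + (par φ * cut a ψ) l := rfl

theorem one_nil : (1 : Shuffle ι R) [] = 1 := rfl

theorem cut_one (a : ι) : cut a (1 : Shuffle ι R) = 0 := by
  ext l; rfl

theorem par_one : par (1 : Shuffle ι R) = 1 := by
  ext l
  cases l with
  | nil => simp
  | cons a l => exact smul_zero _

theorem mul_add' (φ ψ ψ' : Shuffle ι R) : φ * (ψ + ψ') = φ * ψ + φ * ψ' :=
  funext fun l => mulAux_add l φ ψ ψ'

theorem add_mul' (φ φ' ψ : Shuffle ι R) : (φ + φ') * ψ = φ * ψ + φ' * ψ :=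
  funext fun l => add_mulAux l φ φ' ψ

theorem smul_mul' (r : ℝ) (φ ψ : Shuffle ι R) : (r • φ) * ψ = r • (φ * ψ) :=
  funext fun l => smul_mulAux r l φ ψ

theorem mul_smul' (r : ℝ) (φ ψ : Shuffle ι R) : φ * (r • ψ) = r • (φ * ψ) :=
  funext fun l => mulAux_smul r l φ ψ

theorem zero_mul' (ψ : Shuffle ι R) : 0 * ψ = 0 := by
  simpa using smul_mul' (0 : ℝ) 0 ψ

theorem mul_zero' (ψ : Shuffle ι R) : ψ * 0 = 0 := by
  simpa using mul_smul' (0 : ℝ) ψ 0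

theorem neg_mul'' (φ ψ : Shuffle ι R) : (-φ) * ψ = -(φ * ψ) := by
  simpa using smul_mul' (-1 : ℝ) φ ψ

theorem mul_neg'' (φ ψ : Shuffle ι R) : φ * (-ψ) = -(φ * ψ) := by
  simpa using mul_smul' (-1 : ℝ) φ ψ

theorem par_mul (φ ψ : Shuffle ι R) : par (φ * ψ) = par φ * par ψ := by
  ext l
  induction l generalizing φ ψ with
  | nil => simp [mul_nil]
  | cons a l ih =>
    simp only [mul_cons, cut_par, neg_mul'', mul_neg'', neg_apply, ← ih]
    simp [mul_cons, pow_succ]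

/-- Inserting a direction acts on either bracketing as an antiderivation, so the coefficient at `a
:: l` splits into three associativity statements at `l`, with one factor cut in each. This is why
all three factors vary in the induction. -/
theorem mul_assoc' (φ ψ χ : Shuffle ι R) : φ * ψ * χ = φ * (ψ * χ) := by
  ext l
  induction l generalizing φ ψ χ with
  | nil => simp [mul_nil, mul_assoc]
  | cons a l ih =>
    simp only [mul_cons, cut_mul, par_mul, add_mul', mul_add', add_apply, ih, add_assoc]

theorem one_mul' (φ : Shuffle ι R) : 1 * φ = φ := by
  ext l
  induction l generalizing φ with
  | nil => simp [mul_nil, one_nil]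
  | cons a l ih => simp [mul_cons, cut_one, par_one, zero_mul', ih]

theorem mul_one' (φ : Shuffle ι R) : φ * 1 = φ := by
  ext l
  induction l generalizing φ with
  | nil => simp [mul_nil, one_nil]
  | cons a l ih => simp [mul_cons, cut_one, mul_zero', ih]

instance : Ring (Shuffle ι R) :=
  { (inferInstance : AddCommGroup (Shuffle ι R)) with
    mul := (· * ·)
    one := 1
    left_distrib := mul_add'
    right_distrib := add_mul'
    zero_mul := zero_mul'
    mul_zero := mul_zero'
    mul_assoc := mul_assoc'
    one_mul := one_mul'
    mul_one := mul_one' }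

instance : IsScalarTower ℝ (Shuffle ι R) (Shuffle ι R) := ⟨smul_mul'⟩
instance : SMulCommClass ℝ (Shuffle ι R) (Shuffle ι R) := ⟨fun r φ ψ => (mul_smul' r φ ψ).symm⟩

/-! ### Parity, degree and antisymmetry -/

/-- `φ` has the parity of `k`. -/
def HasParity (k : ℕ) (φ : Shuffle ι R) : Prop := par φ = (-1 : ℝ) ^ k • φ

/-- `φ` is homogeneous of degree `n`. -/
def HasDegree (n : ℤ) (φ : Shuffle ι R) : Prop := ∀ l : List ι, (l.length : ℤ) ≠ n → φ l = 0

/-- The components of `φ` are antisymmetric. -/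
def IsAlt (φ : Shuffle ι R) : Prop :=
  ∀ (p q : List ι) (a b : ι), φ (p ++ a :: b :: q) = -φ (p ++ b :: a :: q)

theorem HasDegree.hasParity {k : ℕ} {φ : Shuffle ι R} (h : HasDegree k φ) : HasParity k φ := by
  ext l
  by_cases hl : l.length = k
  · simp [hl]
  · simp [h l (by exact_mod_cast hl)]

/-- Insertion lowers the degree, but only the parity counts; writing it as `k + 1` avoids truncated
subtraction. -/
theorem HasParity.cut {k : ℕ} {φ : Shuffle ι R} (h : HasParity k φ) (a : ι) :
    HasParity (k + 1) (cut a φ) := by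
  rw [HasParity, par_cut, h, map_smul, pow_succ]; simp

theorem HasParity.mul {k l : ℕ} {φ ψ : Shuffle ι R} (h : HasParity k φ) (h' : HasParity l ψ) :
    HasParity (k + l) (φ * ψ) := by
  rw [HasParity, par_mul, h, h', pow_add, smul_mul_smul_comm]

theorem HasParity.comm {k l : ℕ} {φ ψ : Shuffle ι R} (h : HasParity k φ) (h' : HasParity l ψ) :
    φ * ψ = (-1 : ℝ) ^ (k * l) • (ψ * φ) := by
  ext s
  induction s generalizing φ ψ k l with
  | nil =>
    have h0 : φ [] = (-1 : ℝ) ^ k • φ [] := by simpa using congrFun h []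
    have h1 : ψ [] = (-1 : ℝ) ^ l • ψ [] := by simpa using congrFun h' []
    rw [smul_apply, mul_nil, mul_nil, mul_comm]
    rcases neg_one_pow_eq_or ℝ k with hk | hk
    · simp [pow_mul, hk]
    · rcases neg_one_pow_eq_or ℝ l with hl | hl
      · simp [pow_mul, hk, hl]
      -- Both parities are odd here, where the sign would be wrong; but the constant term of an odd
      -- form equals its own negative and so vanishes.
      · have : φ [] = 0 := self_eq_neg_real (by simpa [hk] using h0)
        simp [this]
  | cons a s ih =>
    rw [smul_apply, mul_cons, mul_cons, h, h', smul_mul_assoc, smul_mul_assoc, smul_apply,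
      smul_apply, ih (h.cut a) h', ih h (h'.cut a)]
    rcases neg_one_pow_eq_or ℝ k with hk | hk <;> rcases neg_one_pow_eq_or ℝ l with hl | hl <;>
      simp [pow_mul, mul_add, add_mul, pow_add, hk, hl] <;> abel
where
  self_eq_neg_real {x : R} (hx : x = -x) : x = 0 := by
    have h2 : (2 : ℝ) • x = 0 := by
      rw [two_smul]; nth_rewrite 1 [hx]; simp
    simpa using congrArg (fun y => (2⁻¹ : ℝ) • y) h2

theorem HasDegree.cut {n : ℤ} {φ : Shuffle ι R} (h : HasDegree n φ) (a : ι) :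
    HasDegree (n - 1) (cut a φ) := fun l hl => h _ (by simp; omega)

theorem HasDegree.par {n : ℤ} {φ : Shuffle ι R} (h : HasDegree n φ) :
    HasDegree n (par φ) := fun l hl => by simp [h l hl]

theorem HasDegree.mul {n p : ℤ} {φ ψ : Shuffle ι R} (h : HasDegree n φ) (h' : HasDegree p ψ) :
    HasDegree (n + p) (φ * ψ) := by
  intro l hl
  induction l generalizing φ ψ n p with
  | nil =>
    rw [mul_nil]
    by_cases hn : n = 0
    · rw [h' [] (by simp at hl ⊢; omega), mul_zero]
    · rw [h [] (by simp at hl ⊢; omega), zero_mul]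
  | cons a l ih =>
    simp at hl
    rw [mul_cons, ih (h.cut a) h' (by omega), ih h.par (h'.cut a) (by omega), add_zero]

theorem HasDegree.add {n : ℤ} {φ ψ : Shuffle ι R} (h : HasDegree n φ) (h' : HasDegree n ψ) :
    HasDegree n (φ + ψ) := fun l hl => by simp [h l hl, h' l hl]

theorem HasDegree.sub {n : ℤ} {φ ψ : Shuffle ι R} (h : HasDegree n φ) (h' : HasDegree n ψ) :
    HasDegree n (φ - ψ) := fun l hl => by simp [h l hl, h' l hl]

theorem HasDegree.smul {n : ℤ} {φ : Shuffle ι R} (h : HasDegree n φ) (r : ℝ) :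
    HasDegree n (r • φ) := fun l hl => by simp [h l hl]

theorem HasDegree.sum {n : ℤ} {α : Type*} {s : Finset α} {f : α → Shuffle ι R}
    (h : ∀ a, HasDegree n (f a)) : HasDegree n (∑ a ∈ s, f a) := fun l hl => by
  simp [fun a => h a l hl]

theorem HasDegree.congr {n p : ℤ} {φ : Shuffle ι R} (h : HasDegree n φ) (hp : n = p) :
    HasDegree p φ := hp ▸ h

theorem IsAlt.cut {φ : Shuffle ι R} (h : IsAlt φ) (c : ι) : IsAlt (cut c φ) :=
  fun p q a b => h (c :: p) q a b

theorem IsAlt.cut_cut {φ : Shuffle ι R} (h : IsAlt φ) (a b : ι) :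
    Shuffle.cut a (Shuffle.cut b φ) = -Shuffle.cut b (Shuffle.cut a φ) := by
  ext l; exact h [] l b a

theorem IsAlt.par {φ : Shuffle ι R} (h : IsAlt φ) : IsAlt (par φ) := fun p q a b => by
  simp [h p q a b]

theorem IsAlt.add {φ ψ : Shuffle ι R} (h : IsAlt φ) (h' : IsAlt ψ) : IsAlt (φ + ψ) :=
  fun p q a b => by simp [h p q a b, h' p q a b, add_comm]

theorem IsAlt.smul {φ : Shuffle ι R} (h : IsAlt φ) (r : ℝ) : IsAlt (r • φ) :=
  fun p q a b => by simp [h p q a b]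

theorem IsAlt.sub {φ ψ : Shuffle ι R} (h : IsAlt φ) (h' : IsAlt ψ) : IsAlt (φ - ψ) := by
  simpa [sub_eq_add_neg] using h.add (h'.smul (-1))

theorem IsAlt.sum {α : Type*} {s : Finset α} {f : α → Shuffle ι R} (h : ∀ a, IsAlt (f a)) :
    IsAlt (∑ a ∈ s, f a) := fun p q a b => by
  simp [fun c => h c p q a b]

/-- At the head of the list antisymmetry says that two insertions anticommute. In a product the
mixed terms, with one insertion on each factor, occur in both orders with opposite signs because
`par` changes sign under `cut`. Positions further down reduce to the head by cutting. -/
theorem IsAlt.mul {φ ψ : Shuffle ι R} (h : IsAlt φ) (h' : IsAlt ψ) : IsAlt (φ * ψ) := by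
  intro p q a b
  induction p generalizing φ ψ with
  | nil =>
    have : Shuffle.cut b (Shuffle.cut a (φ * ψ)) = -Shuffle.cut a (Shuffle.cut b (φ * ψ)) := by
      simp only [cut_mul, map_add, cut_par, par_par, h.cut_cut b a, h'.cut_cut b a]
      simp only [mul_neg, neg_mul]; abel
    exact congrFun this q
  | cons c p ih =>
    simp only [List.cons_append, mul_cons, ih (h.cut c) h', ih h.par (h'.cut c)]
    abel

/-! ### Partial derivatives and the exterior derivative -/

variable (D : ι → Derivation ℝ R R)

/-- The partial derivative `∂_a`, applied to all components. -/
def pd (a : ι) : Shuffle ι R →ₗ[ℝ] Shuffle ι R where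
  toFun φ := fun l => D a (φ l)
  map_add' _ _ := funext fun _ => map_add _ _ _
  map_smul' r φ := funext fun l => (D a).map_smul r (φ l)

@[simp] theorem pd_apply (a : ι) (φ : Shuffle ι R) (l : List ι) : pd D a φ l = D a (φ l) := rfl

theorem cut_pd (a b : ι) (φ : Shuffle ι R) : cut a (pd D b φ) = pd D b (cut a φ) := rfl

theorem par_pd (a : ι) (φ : Shuffle ι R) : par (pd D a φ) = pd D a (par φ) := by
  ext l; simp

theorem pd_mul (a : ι) (φ ψ : Shuffle ι R) :
    pd D a (φ * ψ) = pd D a φ * ψ + φ * pd D a ψ := by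
  ext l
  induction l generalizing φ ψ with
  | nil => simp [mul_nil, mul_comm]; ring
  | cons b l ih =>
    have h1 := ih (cut b φ) ψ
    have h2 := ih (par φ) (cut b ψ)
    simp only [pd_apply, add_apply] at h1 h2
    simp only [pd_apply, mul_cons, add_apply, map_add, h1, h2, cut_pd, par_pd]
    abel

/-- The recursion behind the exterior derivative. -/
def dAux : List ι → Shuffle ι R → R
  | [], _ => 0
  | a :: l, φ => D a (φ l) - dAux l (cut a φ)

theorem dAux_add (l : List ι) (φ ψ : Shuffle ι R) :
    dAux D l (φ + ψ) = dAux D l φ + dAux D l ψ := by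
  induction l generalizing φ ψ with
  | nil => simp [dAux]
  | cons a l ih => simp only [dAux, add_apply, map_add, ih]; abel

theorem dAux_smul (r : ℝ) (l : List ι) (φ : Shuffle ι R) :
    dAux D l (r • φ) = r • dAux D l φ := by
  induction l generalizing φ with
  | nil => simp [dAux]
  | cons a l ih => simp only [dAux, smul_apply, map_smul, (D a).map_smul, ih, smul_sub]

/-- The exterior derivative. -/
def d : Shuffle ι R →ₗ[ℝ] Shuffle ι R where
  toFun φ := fun l => dAux D l φ
  map_add' φ ψ := funext fun l => dAux_add D l φ ψ
  map_smul' r φ := funext fun l => dAux_smul D r l φ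

@[simp] theorem d_nil (φ : Shuffle ι R) : d D φ [] = 0 := rfl

theorem d_cons (φ : Shuffle ι R) (a : ι) (l : List ι) :
    d D φ (a :: l) = D a (φ l) - d D (cut a φ) l := rfl

/-- Cartan's formula `i_a d + d i_a = ∂_a` for the constant field `∂_a`. Here it is the definition
of `d`, and the Leibniz rule, `d² = 0` and antisymmetry follow from it by induction on the list. -/
theorem cut_d (a : ι) (φ : Shuffle ι R) : cut a (d D φ) = pd D a φ - d D (cut a φ) := rfl

theorem par_d (φ : Shuffle ι R) : par (d D φ) = -d D (par φ) := by
  ext l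
  induction l generalizing φ with
  | nil => simp
  | cons a l ih =>
    have := ih (cut a φ)
    simp only [par_apply, neg_apply] at this
    simp [d_cons, pow_succ, cut_par, smul_sub, this]; abel

theorem d_mul (φ ψ : Shuffle ι R) : d D (φ * ψ) = d D φ * ψ + par φ * d D ψ := by
  ext l
  induction l generalizing φ ψ with
  | nil => simp [mul_nil]
  | cons a l ih =>
    have h1 := ih (cut a φ) ψ
    have h2 := ih (par φ) (cut a ψ)
    have h3 : D a ((φ * ψ) l) = (pd D a φ * ψ) l + (φ * pd D a ψ) l :=
      congrFun (pd_mul D a φ ψ) l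
    simp only [add_apply] at h1 h2
    simp only [d_cons, mul_cons, add_apply, cut_mul, map_add, h1, h2, h3, cut_d, sub_mul,
      mul_sub, sub_apply, cut_par, par_par, par_d, neg_mul, neg_apply]
    abel

variable {D}

theorem pd_comm (hD : ∀ a b f, D a (D b f) = D b (D a f))
    (a b : ι) (φ : Shuffle ι R) : pd D a (pd D b φ) = pd D b (pd D a φ) := by
  ext l; exact hD a b _

theorem pd_d (hD : ∀ a b f, D a (D b f) = D b (D a f))
    (a : ι) (φ : Shuffle ι R) : pd D a (d D φ) = d D (pd D a φ) := by
  ext l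
  induction l generalizing φ with
  | nil => simp
  | cons b l ih =>
    have := ih (cut b φ)
    simp only [pd_apply] at this
    simp [d_cons, hD a b, this, cut_pd]

theorem d_d (hD : ∀ a b f, D a (D b f) = D b (D a f))
    (φ : Shuffle ι R) : d D (d D φ) = 0 := by
  ext l
  induction l generalizing φ with
  | nil => simp
  | cons b l ih =>
    have h := congrFun (pd_d hD b φ) l
    simp only [pd_apply] at h
    simp [d_cons, cut_d, ih, h]

variable (D)

theorem HasParity.pd {k : ℕ} {φ : Shuffle ι R} (h : HasParity k φ) (a : ι) :
    HasParity k (pd D a φ) := by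
  rw [HasParity, par_pd, h, map_smul]

theorem HasParity.d {k : ℕ} {φ : Shuffle ι R} (h : HasParity k φ) : HasParity (k + 1) (d D φ) := by
  rw [HasParity, par_d, h, map_smul, pow_succ]; simp

theorem HasDegree.pd {n : ℤ} {φ : Shuffle ι R} (h : HasDegree n φ) (a : ι) :
    HasDegree n (pd D a φ) := fun l hl => by simp [h l hl]

theorem HasDegree.d {n : ℤ} {φ : Shuffle ι R} (h : HasDegree n φ) :
    HasDegree (n + 1) (d D φ) := by
  intro l hl
  induction l generalizing φ n with
  | nil => simp
  | cons a l ih =>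
    simp at hl
    rw [d_cons, h l hl, ih (h.cut a) (by omega)]; simp

theorem IsAlt.pd {φ : Shuffle ι R} (h : IsAlt φ) (c : ι) : IsAlt (pd D c φ) :=
  fun p q a b => by simp [h p q a b]

theorem IsAlt.d {φ : Shuffle ι R} (h : IsAlt φ) : IsAlt (d D φ) := by
  intro p q a b
  induction p generalizing φ with
  | nil =>
    have : Shuffle.cut b (Shuffle.cut a (Shuffle.d D φ)) =
        -Shuffle.cut a (Shuffle.cut b (Shuffle.d D φ)) := by
      simp only [cut_d, map_sub, h.cut_cut b a, cut_pd, map_neg]; abel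
    exact congrFun this q
  | cons c p ih =>
    have h1 := h.pd D c p q a b
    simp only [pd_apply] at h1
    simp only [List.cons_append, d_cons, ih (h.cut c), h1]
    abel

end Shuffle

namespace Shuffle

/-! ### The Lie derivative along a vector valued form -/

variable {ι R : Type*} [CommRing R] [Algebra ℝ R] [Fintype ι] [DecidableEq ι]
  (D : ι → Derivation ℝ R R)

/-- The coordinate differential. -/
def dx (a : ι) : Shuffle ι R := fun l => if l = [a] then 1 else 0

theorem cut_dx (a b : ι) : cut b (dx a : Shuffle ι R) = if a = b then 1 else 0 := by
  ext l
  by_cases h : a = b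
  · subst h
    cases l with
    | nil => simp [dx, one_nil]
    | cons c l => rw [if_pos rfl]; exact if_neg (by simp)
  · simp [dx, h, Ne.symm h]

theorem dx_nil (a : ι) : (dx a : Shuffle ι R) [] = 0 := if_neg (by simp)

theorem hasDegree_dx (a : ι) : HasDegree 1 (dx a : Shuffle ι R) := fun l hl =>
  if_neg fun h => hl (by simp [h])

theorem isAlt_dx (a : ι) : IsAlt (dx a : Shuffle ι R) := fun p q b c => by
  have h : ∀ b c : ι, p ++ b :: c :: q ≠ [a] := fun b c h => by
    have := congrArg List.length h; simp at this; omega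
  simp [dx, h]

theorem pd_dx (a b : ι) : pd D b (dx a : Shuffle ι R) = 0 := by
  ext l; by_cases hl : l = [a] <;> simp [dx, hl]

theorem pd_one (b : ι) : pd D b (1 : Shuffle ι R) = 0 := by
  ext l
  cases l with
  | nil => simp [one_nil]
  | cons a l => exact (D b).map_zero

theorem d_one : d D (1 : Shuffle ι R) = 0 := by
  ext l
  cases l with
  | nil => simp
  | cons a l =>
    rw [d_cons, cut_one, map_zero, zero_apply, sub_zero]
    exact congrFun (pd_one D a) l

theorem d_dx (a : ι) : d D (dx a : Shuffle ι R) = 0 := by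
  ext l
  cases l with
  | nil => simp
  | cons b l =>
    have h := congrFun (pd_dx D a b) l
    rw [pd_apply] at h
    rw [d_cons, h, cut_dx]
    split_ifs <;> simp [d_one]

/-- The usual coordinate formula. It is needed where `d` must be seen as a first order operator: for
`Θ(φ ∧ I)` in `lie_wedgeI` and for jets in `SameJet.d`. -/
theorem d_eq_sum (φ : Shuffle ι R) : d D φ = ∑ a, dx a * pd D a φ := by
  ext l
  induction l generalizing φ with
  | nil => simp [mul_nil, dx_nil]
  | cons b l ih =>
    have hp (a : ι) : par (dx a : Shuffle ι R) = -dx a := by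
      simpa [HasParity] using (hasDegree_dx (R := R) a).hasParity (k := 1)
    simp [d_cons, ih, mul_cons, cut_dx, hp, ite_mul, cut_pd, Finset.sum_add_distrib,
      sub_eq_add_neg, apply_ite (fun φ : Shuffle ι R => φ l)]

/-- Euler's identity `∑ dx^a ∧ i_a φ = q φ` for `q`-forms. -/
theorem sum_dx_mul_cut {n : ℤ} {φ : Shuffle ι R} (h : IsAlt φ) (hn : HasDegree n φ) :
    ∑ a, dx a * cut a φ = (n : ℝ) • φ := by
  ext l
  induction l generalizing φ n with
  | nil =>
    by_cases h0 : n = 0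
    · simp [h0, mul_nil, dx_nil]
    · simp [mul_nil, dx_nil, hn [] (by simpa using Ne.symm h0)]
  | cons b l ih =>
    have hp (a : ι) : par (dx a : Shuffle ι R) = -dx a := by
      simpa [HasParity] using (hasDegree_dx (R := R) a).hasParity (k := 1)
    have := ih (h.cut b) (hn.cut b)
    simp only [sum_apply, smul_apply, cut_apply] at this
    simp [mul_cons, cut_dx, hp, h.cut_cut b, ite_mul, Finset.sum_add_distrib, this, sub_smul,
      apply_ite (fun φ : Shuffle ι R => φ l)]

/-- The insertion operator `i_K`. -/
def insK (K : ι → Shuffle ι R) : Shuffle ι R →ₗ[ℝ] Shuffle ι R :=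
  ∑ a, LinearMap.mulLeft ℝ (K a) ∘ₗ cut a

theorem insK_apply (K : ι → Shuffle ι R) (η : Shuffle ι R) :
    insK K η = ∑ a, K a * cut a η := by simp [insK]

/-- The Lie derivative `Θ(K) = i_K d + (-1)^k d i_K`. -/
def lie (k : ℕ) (K : ι → Shuffle ι R) : Shuffle ι R →ₗ[ℝ] Shuffle ι R :=
  insK K ∘ₗ d D + (-1 : ℝ) ^ k • d D ∘ₗ insK K

variable {D}

theorem lie_apply (k : ℕ) (K : ι → Shuffle ι R) (η : Shuffle ι R) :
    lie D k K η = insK K (d D η) + (-1 : ℝ) ^ k • d D (insK K η) := rfl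

/-- By Cartan's formula `i_K d` contributes `-K^a ∧ d i_a η`, and the Leibniz rule for `(-1)^k d
i_K` contributes the same with the opposite sign. After this cancellation each summand is a
coefficient times `∂_a` or `i_a`. -/
theorem lie_eq_sum {k : ℕ} {K : ι → Shuffle ι R} (hK : ∀ a, HasParity k (K a))
    (η : Shuffle ι R) :
    lie D k K η = ∑ a, (K a * pd D a η + (-1 : ℝ) ^ k • (d D (K a) * cut a η)) := by
  simp only [lie_apply, insK_apply, map_sum, Finset.smul_sum, ← Finset.sum_add_distrib]
  refine Finset.sum_congr rfl fun a _ => ?_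
  rw [cut_d, d_mul, hK a, smul_mul_assoc, smul_add, smul_smul, ← mul_pow]
  simp [mul_sub]

theorem lie_d (hD : ∀ a b f, D a (D b f) = D b (D a f)) (k : ℕ) (K : ι → Shuffle ι R)
    (η : Shuffle ι R) : lie D k K (d D η) = (-1 : ℝ) ^ k • d D (lie D k K η) := by
  simp [lie_apply, d_d hD]

/-- Checked summand by summand: moving `K^a` past `φ` costs `(-1)^(kp)`. Moving `dK^a` past `φ`
costs an additional `(-1)^p`, which the antiderivation sign of `i_a` compensates. -/
theorem lie_mul {k p : ℕ} {K : ι → Shuffle ι R} (hK : ∀ a, HasParity k (K a))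
    {φ : Shuffle ι R} (hφ : HasParity p φ) (ψ : Shuffle ι R) :
    lie D k K (φ * ψ) = lie D k K φ * ψ + (-1 : ℝ) ^ (k * p) • (φ * lie D k K ψ) := by
  simp only [lie_eq_sum hK, Finset.sum_mul, Finset.mul_sum, Finset.smul_sum,
    ← Finset.sum_add_distrib]
  refine Finset.sum_congr rfl fun a _ => ?_
  have h1 := (hK a).comm hφ
  have h2 := ((hK a).d D).comm hφ
  rw [pd_mul, cut_mul, hφ, mul_add, ← mul_assoc, ← mul_assoc (K a) φ, h1, mul_add,
    ← mul_assoc, smul_mul_assoc, smul_mul_assoc, mul_smul_comm, ← mul_assoc (d D (K a)) φ, h2]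
  rcases neg_one_pow_eq_or ℝ k with hk | hk <;> rcases neg_one_pow_eq_or ℝ p with hp | hp <;>
    simp [pow_mul, add_mul, mul_add, pow_add, hk, hp, mul_assoc] <;> abel

/-- The Frölicher–Nijenhuis bracket in components. -/
def fn (D : ι → Derivation ℝ R R) (k l : ℕ) (K L : ι → Shuffle ι R) : ι → Shuffle ι R := fun b =>
  lie D k K (L b) - (-1 : ℝ) ^ (k * l) • lie D l L (K b)

theorem HasParity.lie {k p : ℕ} {K : ι → Shuffle ι R} (hK : ∀ a, HasParity k (K a))
    {φ : Shuffle ι R} (hφ : HasParity p φ) : HasParity (k + p) (lie D k K φ) := by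
  rw [HasParity, lie_eq_sum hK, map_sum, Finset.smul_sum]
  refine Finset.sum_congr rfl fun a _ => ?_
  have h1 := (hK a).mul (hφ.pd D a)
  have h2 := ((hK a).d D).mul (hφ.cut a)
  rw [HasParity] at h1 h2
  rw [map_add, map_smul, h1, h2, smul_add]
  rcases neg_one_pow_eq_or ℝ k with hk | hk <;> rcases neg_one_pow_eq_or ℝ p with hp | hp <;>
    simp [pow_add, hk, hp]

theorem HasParity.sub {k : ℕ} {φ ψ : Shuffle ι R} (h : HasParity k φ) (h' : HasParity k ψ) :
    HasParity k (φ - ψ) := by rw [HasParity, map_sub, h, h', smul_sub]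

theorem HasParity.smul {k : ℕ} {φ : Shuffle ι R} (h : HasParity k φ) (r : ℝ) :
    HasParity k (r • φ) := by rw [HasParity, map_smul, h, smul_comm]

theorem hasParity_fn {k l : ℕ} {K L : ι → Shuffle ι R} (hK : ∀ a, HasParity k (K a))
    (hL : ∀ a, HasParity l (L a)) (b : ι) : HasParity (k + l) (fn D k l K L b) :=
  (HasParity.lie hK (hL b)).sub ((add_comm l k ▸ HasParity.lie hL (hK b)).smul _)

/-- The part of `Θ(K) Θ(L) η` which is of second order in `η`. -/
theorem lie_lie {k l : ℕ} {K L : ι → Shuffle ι R} (hK : ∀ a, HasParity k (K a))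
    (hL : ∀ a, HasParity l (L a)) (η : Shuffle ι R) :
    lie D k K (lie D l L η) =
      (∑ b, (lie D k K (L b) * pd D b η + (-1 : ℝ) ^ l • (lie D k K (d D (L b)) * cut b η))) +
      ∑ b, ((-1 : ℝ) ^ (k * l) • (L b * lie D k K (pd D b η)) +
        (-1 : ℝ) ^ l • (-1 : ℝ) ^ (k * (l + 1)) • (d D (L b) * lie D k K (cut b η))) := by
  rw [lie_eq_sum hL, map_sum, ← Finset.sum_add_distrib]
  refine Finset.sum_congr rfl fun b _ => ?_
  rw [map_add, map_smul, lie_mul hK (hL b), lie_mul hK ((hL b).d D), smul_add]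
  abel

/-- The second order part is graded symmetric in `K` and `L`, hence drops out of the graded
commutator. The summands for `(a, b)` and `(b, a)` are matched: coefficients commute up to sign, the
`∂` commute by `hD`, and the insertions anticommute because `η` is antisymmetric. -/
theorem lie_lie_symm (hD : ∀ a b f, D a (D b f) = D b (D a f)) {k l : ℕ}
    {K L : ι → Shuffle ι R} (hK : ∀ a, HasParity k (K a))
    (hL : ∀ a, HasParity l (L a)) {η : Shuffle ι R} (hη : IsAlt η) :
    ∑ b, ((-1 : ℝ) ^ (k * l) • (L b * lie D k K (pd D b η)) +
        (-1 : ℝ) ^ l • (-1 : ℝ) ^ (k * (l + 1)) • (d D (L b) * lie D k K (cut b η))) =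
    (-1 : ℝ) ^ (k * l) • ∑ b, ((-1 : ℝ) ^ (l * k) • (K b * lie D l L (pd D b η)) +
        (-1 : ℝ) ^ k • (-1 : ℝ) ^ (l * (k + 1)) • (d D (K b) * lie D l L (cut b η))) := by
  simp only [lie_eq_sum hK, lie_eq_sum hL, Finset.mul_sum, Finset.smul_sum,
    ← Finset.sum_add_distrib]
  rw [Finset.sum_comm]
  refine Finset.sum_congr rfl fun a _ => Finset.sum_congr rfl fun b _ => ?_
  have h1 := (hL b).comm (hK a)
  have h2 := (hL b).comm ((hK a).d D)
  have h3 := ((hL b).d D).comm (hK a)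
  have h4 := ((hL b).d D).comm ((hK a).d D)
  simp only [mul_add, mul_smul_comm, ← mul_assoc, h1, h2, h3, h4, cut_pd, pd_comm hD b a,
    hη.cut_cut b a]
  rcases neg_one_pow_eq_or ℝ k with hk | hk <;> rcases neg_one_pow_eq_or ℝ l with hl | hl <;>
    simp [pow_mul, add_mul, pow_add, hk, hl] <;> abel

/-- `Θ([K, L]) = Θ(K) Θ(L) - (-1)^(kl) Θ(L) Θ(K)`. -/
theorem lie_fn (hD : ∀ a b f, D a (D b f) = D b (D a f)) {k l : ℕ}
    {K L : ι → Shuffle ι R} (hK : ∀ a, HasParity k (K a))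
    (hL : ∀ a, HasParity l (L a)) {η : Shuffle ι R} (hη : IsAlt η) :
    lie D (k + l) (fn D k l K L) η =
      lie D k K (lie D l L η) - (-1 : ℝ) ^ (k * l) • lie D l L (lie D k K η) := by
  rw [lie_lie hK hL, lie_lie hL hK, lie_lie_symm hD hK hL hη, smul_add, add_sub_add_right_eq_sub,
    lie_eq_sum (hasParity_fn hK hL), Finset.smul_sum, ← Finset.sum_sub_distrib]
  refine Finset.sum_congr rfl fun b _ => ?_
  -- Only the part of first order in `η` is left; `lie_d` takes `d` out of `Θ(K) dL^b` and `Θ(L)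
  -- dK^b`, so that the coefficient of `i_b η` becomes `d [K, L]^b` up to sign.
  simp only [fn, lie_d hD, map_sub, map_smul]
  rcases neg_one_pow_eq_or ℝ k with hk | hk <;> rcases neg_one_pow_eq_or ℝ l with hl | hl <;>
    simp [pow_mul, pow_add, hk, hl, sub_mul, add_mul] <;> abel

theorem fn_antisymm (k l : ℕ) (K L : ι → Shuffle ι R) (b : ι) :
    fn D k l K L b = -((-1 : ℝ) ^ (k * l) • fn D l k L K b) := by
  simp only [fn]
  rcases neg_one_pow_eq_or ℝ k with hk | hk <;> rcases neg_one_pow_eq_or ℝ l with hl | hl <;>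
    simp [pow_mul, hk, hl]

theorem lie_sub_left (k : ℕ) (K L : ι → Shuffle ι R) (η : Shuffle ι R) :
    lie D k (K - L) η = lie D k K η - lie D k L η := by
  simp [lie_apply, insK_apply, sub_mul, smul_sub]; abel

theorem lie_smul_left (k : ℕ) (r : ℝ) (K : ι → Shuffle ι R) (η : Shuffle ι R) :
    lie D k (r • K) η = r • lie D k K η := by
  simp only [lie_apply, insK_apply, Pi.smul_apply, smul_mul_assoc, ← Finset.smul_sum, map_smul,
    smul_add, smul_comm r]

theorem fn_sub_left (k l : ℕ) (K K' L : ι → Shuffle ι R) :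
    fn D k l (K - K') L = fn D k l K L - fn D k l K' L := by
  funext b; simp [fn, lie_sub_left, smul_sub]; abel

theorem fn_sub_right (k l : ℕ) (K L L' : ι → Shuffle ι R) :
    fn D k l K (L - L') = fn D k l K L - fn D k l K L' := by
  funext b; simp [fn, lie_sub_left, smul_sub]; abel

theorem fn_smul_left (k l : ℕ) (r : ℝ) (K L : ι → Shuffle ι R) :
    fn D k l (r • K) L = r • fn D k l K L := by
  funext b; simp [fn, lie_smul_left, smul_sub, smul_comm r]

theorem fn_smul_right (k l : ℕ) (r : ℝ) (K L : ι → Shuffle ι R) :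
    fn D k l K (r • L) = r • fn D k l K L := by
  funext b; simp [fn, lie_smul_left, smul_sub, smul_comm r]

/-- The `b`-component of a double bracket consists of one operator `Θ` applied to a component of a
bracket and of `Θ` of a bracket applied to a component. With `lie_fn` the latter become commutators,
and every term is a double product of operators `Θ` applied to `K^b`, `L^b` or `P^b`. -/
theorem fn_jacobi (hD : ∀ a b f, D a (D b f) = D b (D a f)) {k l p : ℕ}
    {K L P : ι → Shuffle ι R} (hK : ∀ a, HasParity k (K a)) (hL : ∀ a, HasParity l (L a))
    (hP : ∀ a, HasParity p (P a)) (hK' : ∀ a, IsAlt (K a)) (hL' : ∀ a, IsAlt (L a))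
    (hP' : ∀ a, IsAlt (P a)) :
    fn D k (l + p) K (fn D l p L P) =
      fn D (k + l) p (fn D k l K L) P +
        (-1 : ℝ) ^ (k * l) • fn D l (k + p) L (fn D k p K P) := by
  funext b
  have h1 := lie_fn hD hL hP (hK' b)
  have h2 := lie_fn hD hK hL (hP' b)
  have h3 := lie_fn hD hK hP (hL' b)
  rw [Pi.add_apply, Pi.smul_apply]
  -- The outer brackets are unfolded one at a time, so that `Θ` of an inner bracket stays
  -- recognizable for `lie_fn`.
  rw [fn, h1]
  nth_rewrite 2 [fn]
  nth_rewrite 3 [fn]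
  rw [h2, h3]
  simp only [fn, map_sub, map_smul]
  rcases neg_one_pow_eq_or ℝ k with hk | hk <;> rcases neg_one_pow_eq_or ℝ l with hl | hl <;>
    rcases neg_one_pow_eq_or ℝ p with hp | hp <;>
    simp [pow_mul, pow_add, mul_add, add_mul, hk, hl, hp] <;> abel

end Shuffle

namespace Shuffle

/-! ### The trace, and the bracket of traceless vector valued forms -/

variable {ι R : Type*} [CommRing R] [Algebra ℝ R] [Fintype ι] [DecidableEq ι]
  {D : ι → Derivation ℝ R R}

/-- The trace of a vector valued form. -/
def tr : (ι → Shuffle ι R) →ₗ[ℝ] Shuffle ι R := ∑ a, cut a ∘ₗ LinearMap.proj a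

theorem tr_apply (K : ι → Shuffle ι R) : tr K = ∑ a, cut a (K a) := by simp [tr]

/-- The bilinear expression `S (K, L)`. -/
def S (K L : ι → Shuffle ι R) : Shuffle ι R := ∑ a, ∑ b, cut b (K a) * cut a (L b)

/-- `φ ∧ I`, where `I` is the identity. -/
def wedgeI : Shuffle ι R →ₗ[ℝ] (ι → Shuffle ι R) := LinearMap.pi fun b => LinearMap.mulRight ℝ (dx b)

theorem wedgeI_apply (φ : Shuffle ι R) (b : ι) : wedgeI φ b = φ * dx b := rfl

/-- In `K^a ∧ ∂_a L^b` and `dK^a ∧ i_a L^b` the insertion of `∂_b` may hit the second factor, which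
gives `Θ(K)` of the trace, or the first, which gives the double sum; there `i_b dK^a = ∂_b K^a - d
i_b K^a`. -/
theorem tr_lie {k : ℕ} {K L : ι → Shuffle ι R} (hK : ∀ a, HasParity k (K a))
    (hL' : ∀ a, IsAlt (L a)) :
    ∑ b, cut b (lie D k K (L b)) = (-1 : ℝ) ^ k • lie D k K (tr L) +
      ∑ a, ∑ b, (cut b (K a) * pd D a (L b) + (-1 : ℝ) ^ k • (pd D b (K a) * cut a (L b)) -
        (-1 : ℝ) ^ k • (d D (cut b (K a)) * cut a (L b))) := by
  simp only [lie_eq_sum hK, tr_apply, map_sum, Finset.mul_sum, ← Finset.sum_add_distrib,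
    Finset.smul_sum]
  rw [Finset.sum_comm]
  refine Finset.sum_congr rfl fun a _ => Finset.sum_congr rfl fun b _ => ?_
  have h1 := hK a
  have h2 := (hK a).d D
  rw [HasParity] at h1 h2
  rw [map_add, map_smul, cut_mul, cut_mul, h1, h2, cut_d, (hL' b).cut_cut b a, cut_pd]
  rcases neg_one_pow_eq_or ℝ k with hk | hk <;>
    simp [pow_add, hk, sub_mul] <;> abel

/-- The trace of the Frölicher–Nijenhuis bracket. -/
theorem tr_fn {k l : ℕ} {K L : ι → Shuffle ι R} (hK : ∀ a, HasParity k (K a))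
    (hL : ∀ a, HasParity l (L a)) (hK' : ∀ a, IsAlt (K a)) (hL' : ∀ a, IsAlt (L a)) :
    tr (fn D k l K L) = (-1 : ℝ) ^ k • lie D k K (tr L) -
      (-1 : ℝ) ^ (k * l) • (-1 : ℝ) ^ l • lie D l L (tr K) - (-1 : ℝ) ^ k • d D (S K L) := by
  have h1 := tr_lie (D := D) hK hL'
  have h2 := tr_lie (D := D) hL hK'
  -- Interchanging `a` and `b` in the second sum makes both sums bilinear in the same pairs `i_b
  -- K^a`, `i_a L^b`. The terms with a partial derivative cancel, and those with `d` combine to the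
  -- Leibniz rule for `dS(K, L)`.
  have h3 : ∑ a, ∑ b, (cut b (K a) * pd D a (L b) +
        (-1 : ℝ) ^ k • (pd D b (K a) * cut a (L b)) -
        (-1 : ℝ) ^ k • (d D (cut b (K a)) * cut a (L b))) -
      (-1 : ℝ) ^ (k * l) • ∑ a, ∑ b, (cut b (L a) * pd D a (K b) +
        (-1 : ℝ) ^ l • (pd D b (L a) * cut a (K b)) -
        (-1 : ℝ) ^ l • (d D (cut b (L a)) * cut a (K b))) = -((-1 : ℝ) ^ k • d D (S K L)) := by
    rw [Finset.sum_comm (f := fun a b => cut b (L a) * pd D a (K b) +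
        (-1 : ℝ) ^ l • (pd D b (L a) * cut a (K b)) -
        (-1 : ℝ) ^ l • (d D (cut b (L a)) * cut a (K b)))]
    simp only [S, map_sum, Finset.smul_sum, ← Finset.sum_neg_distrib, ← Finset.sum_sub_distrib]
    refine Finset.sum_congr rfl fun a _ => Finset.sum_congr rfl fun b _ => ?_
    have e1 := ((hL b).cut a).comm ((hK a).pd D b)
    have e2 := ((hL b).pd D a).comm ((hK a).cut b)
    have e3 := (((hL b).cut a).d D).comm ((hK a).cut b)
    have e4 := (hK a).cut b
    rw [HasParity] at e4
    rw [e1, e2, e3, d_mul, e4]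
    rcases neg_one_pow_eq_or ℝ k with hk | hk <;> rcases neg_one_pow_eq_or ℝ l with hl | hl <;>
      simp [pow_mul, mul_add, add_mul, pow_add, hk, hl] <;> abel
  rw [tr_apply]
  simp only [fn, map_sub, map_smul, Finset.sum_sub_distrib, ← Finset.smul_sum]
  rw [h1, h2, smul_add, sub_eq_add_neg _ ((-1 : ℝ) ^ k • d D (S K L)), ← h3]
  abel

/-- Insertion into `dx^a` gives `m` copies of `φ`; insertion into `φ`, which has degree `n - 1`,
gives `n - 1` copies of the opposite sign by Euler's identity. -/
theorem tr_wedgeI {n : ℕ} {φ : Shuffle ι R} (h : IsAlt φ) (hn : HasDegree ((n : ℤ) - 1) φ)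
    (hp : HasParity (n + 1) φ) :
    tr (wedgeI φ) = ((-1 : ℝ) ^ (n + 1) * ((Fintype.card ι : ℝ) - n + 1)) • φ := by
  have h1 (a : ι) : cut a φ * dx a = (-1 : ℝ) ^ n • (dx a * cut a φ) := by
    have := (hp.cut a).comm (k := n + 1 + 1) (l := 1) (hasDegree_dx a).hasParity
    rw [this]; simp [pow_add]
  rw [HasParity] at hp
  simp only [tr_apply, wedgeI_apply, cut_mul, h1, cut_dx, hp, if_true, mul_one,
    Finset.sum_add_distrib, ← Finset.smul_sum, sum_dx_mul_cut h hn]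
  rw [Finset.sum_const, Finset.card_univ, ← Nat.cast_smul_eq_nsmul ℝ]
  push_cast
  module

/-- Since `φ` and `dx^a` are closed, only `∑ φ ∧ dx^a ∧ ∂_a η` survives. -/
theorem lie_wedgeI {n : ℕ} {φ : Shuffle ι R} (hp : HasParity n φ)
    (hφ : d D φ = 0) (η : Shuffle ι R) : lie D (n + 1) (wedgeI φ) η = φ * d D η := by
  rw [lie_eq_sum (K := wedgeI φ) fun a => hp.mul (l := 1) (hasDegree_dx a).hasParity]
  simp [wedgeI_apply, d_mul, hφ, d_dx, mul_assoc, ← Finset.mul_sum, ← d_eq_sum]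

theorem lie_dx {k : ℕ} {K : ι → Shuffle ι R} (b : ι) :
    lie D k K (dx b) = (-1 : ℝ) ^ k • d D (K b) := by
  simp [lie_apply, d_dx, insK_apply, cut_dx]

/-- Closed forms times the identity form an ideal in a subalgebra. -/
theorem fn_wedgeI {k n : ℕ} {K : ι → Shuffle ι R} (hK : ∀ a, HasParity k (K a)) {φ : Shuffle ι R}
    (hp : HasParity n φ) (hφ : d D φ = 0) :
    fn D k (n + 1) K (wedgeI φ) = wedgeI (lie D k K φ) := by
  funext b
  -- The derivation `Θ(K)` applied to `φ ∧ dx^b` also produces a term `φ ∧ dK^b`. It equals `Θ(φ ∧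
  -- I) K^b` up to sign and is cancelled by the other half of the bracket.
  rw [fn, lie_wedgeI hp hφ, wedgeI_apply, wedgeI_apply, lie_mul hK hp, lie_dx]
  rcases neg_one_pow_eq_or ℝ k with hk | hk <;> rcases neg_one_pow_eq_or ℝ n with hn | hn <;>
    simp [pow_mul, mul_add, pow_add, hk, hn]

theorem d_lie_of_closed (hD : ∀ a b f, D a (D b f) = D b (D a f)) {k : ℕ} {K : ι → Shuffle ι R}
    {φ : Shuffle ι R} (hφ : d D φ = 0) : d D (lie D k K φ) = 0 := by
  have := lie_d hD k K φ
  rw [hφ, map_zero] at this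
  rcases neg_one_pow_eq_or ℝ k with hk | hk <;> simpa [hk] using this.symm

/-- The projection onto the traceless part, in degree `n`. -/
def pr (n : ℕ) : (ι → Shuffle ι R) →ₗ[ℝ] (ι → Shuffle ι R) :=
  LinearMap.id + ((-1 : ℝ) ^ n / ((Fintype.card ι : ℝ) - n + 1)) • wedgeI ∘ₗ tr

theorem pr_apply (n : ℕ) (K : ι → Shuffle ι R) :
    pr n K = K + ((-1 : ℝ) ^ n / ((Fintype.card ι : ℝ) - n + 1)) • wedgeI (tr K) := rfl

/-- `V` has all the properties of the components of a smooth vector valued `n`-form. -/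
structure IsForm (n : ℕ) (V : ι → Shuffle ι R) : Prop where
  alt : ∀ a, IsAlt (V a)
  deg : ∀ a, HasDegree n (V a)

theorem IsForm.parity {n : ℕ} {V : ι → Shuffle ι R} (h : IsForm n V) (a : ι) :
    HasParity n (V a) := (h.deg a).hasParity

theorem HasDegree.hasParity_succ {n : ℕ} {φ : Shuffle ι R} (h : HasDegree ((n : ℤ) - 1) φ) :
    HasParity (n + 1) φ := by
  ext l
  by_cases hl : l.length + 1 = n
  · simp [← hl, pow_succ]
  · simp [h l (by omega)]

theorem IsForm.degree_tr {n : ℕ} {V : ι → Shuffle ι R} (h : IsForm n V) :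
    HasDegree ((n : ℤ) - 1) (tr V) := by
  rw [tr_apply]; exact HasDegree.sum fun a => (h.deg a).cut a

theorem IsForm.alt_tr {n : ℕ} {V : ι → Shuffle ι R} (h : IsForm n V) : IsAlt (tr V) := by
  rw [tr_apply]; exact IsAlt.sum fun a => (h.alt a).cut a

theorem HasDegree.lie {k : ℕ} {n : ℤ} {K : ι → Shuffle ι R} (h : IsForm k K) {φ : Shuffle ι R}
    (hφ : HasDegree n φ) : HasDegree (k + n) (lie D k K φ) := by
  rw [lie_eq_sum h.parity]
  exact HasDegree.sum fun a => ((h.deg a).mul (hφ.pd D a)).add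
    (((((h.deg a).d D).mul (hφ.cut a)).congr (by ring)).smul _)

theorem IsAlt.lie {k : ℕ} {K : ι → Shuffle ι R} (h : IsForm k K) {φ : Shuffle ι R}
    (hφ : IsAlt φ) : IsAlt (lie D k K φ) := by
  rw [lie_eq_sum h.parity]
  exact IsAlt.sum fun a => ((h.alt a).mul (hφ.pd D a)).add
    ((((h.alt a).d D).mul (hφ.cut a)).smul _)

theorem IsForm.fn {k l : ℕ} {K L : ι → Shuffle ι R} (hK : IsForm k K) (hL : IsForm l L) :
    IsForm (k + l) (fn D k l K L) where
  alt a := (IsAlt.lie hK (hL.alt a)).sub ((IsAlt.lie hL (hK.alt a)).smul _)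
  deg a := (((HasDegree.lie hK (hL.deg a))).sub
    (((HasDegree.lie hL (hK.deg a)).congr (by ring)).smul _)).congr (by simp)

theorem IsForm.wedgeI {n : ℕ} {φ : Shuffle ι R} (h : IsAlt φ)
    (hn : HasDegree ((n : ℤ) - 1) φ) : IsForm n (wedgeI φ) where
  alt a := h.mul (isAlt_dx a)
  deg a := (hn.mul (hasDegree_dx a)).congr (by ring)

theorem IsForm.add {n : ℕ} {V W : ι → Shuffle ι R} (h : IsForm n V) (h' : IsForm n W) :
    IsForm n (V + W) where
  alt a := (h.alt a).add (h'.alt a)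
  deg a := (h.deg a).add (h'.deg a)

theorem IsForm.smul {n : ℕ} {V : ι → Shuffle ι R} (h : IsForm n V) (r : ℝ) :
    IsForm n (r • V) where
  alt a := (h.alt a).smul r
  deg a := (h.deg a).smul r

theorem IsForm.pr {n : ℕ} {V : ι → Shuffle ι R} (h : IsForm n V) : IsForm n (pr n V) :=
  h.add ((IsForm.wedgeI h.alt_tr h.degree_tr).smul _)

/-- The constant in `pr` is minus the inverse of the factor in `tr_wedgeI`; `n ≤ m` makes that
factor nonzero. The same cancellation proves `tr_pr`. -/
theorem pr_wedgeI {n : ℕ} {φ : Shuffle ι R} (h : IsAlt φ) (hn : HasDegree ((n : ℤ) - 1) φ)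
    (hm : n ≤ Fintype.card ι) : pr n (wedgeI φ) = 0 := by
  have h0 : (Fintype.card ι : ℝ) - n + 1 ≠ 0 := by
    have : (n : ℝ) ≤ Fintype.card ι := by exact_mod_cast hm
    linarith
  rw [pr_apply, tr_wedgeI h hn hn.hasParity_succ, map_smul, smul_smul]
  have : (-1 : ℝ) ^ n / ((Fintype.card ι : ℝ) - n + 1) *
      ((-1 : ℝ) ^ (n + 1) * ((Fintype.card ι : ℝ) - n + 1)) = -1 := by
    field_simp
    rcases neg_one_pow_eq_or ℝ n with hn | hn <;> simp [pow_succ, hn]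
  rw [this]; simp

theorem tr_pr {n : ℕ} {V : ι → Shuffle ι R} (h : IsForm n V) (hm : n ≤ Fintype.card ι) :
    tr (pr n V) = 0 := by
  have h0 : (Fintype.card ι : ℝ) - n + 1 ≠ 0 := by
    have : (n : ℝ) ≤ Fintype.card ι := by exact_mod_cast hm
    linarith
  rw [pr_apply, map_add, map_smul, tr_wedgeI h.alt_tr h.degree_tr h.degree_tr.hasParity_succ,
    smul_smul]
  have : (-1 : ℝ) ^ n / ((Fintype.card ι : ℝ) - n + 1) *
      ((-1 : ℝ) ^ (n + 1) * ((Fintype.card ι : ℝ) - n + 1)) = -1 := by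
    field_simp
    rcases neg_one_pow_eq_or ℝ n with hn | hn <;> simp [pow_succ, hn]
  rw [this]; simp

theorem pr_of_tr {n : ℕ} {V : ι → Shuffle ι R} (h : tr V = 0) : pr n V = V := by
  simp [pr_apply, h]

/-- The bracket of traceless vector valued forms. -/
def cb (D : ι → Derivation ℝ R R) (k l : ℕ) (K L : ι → Shuffle ι R) : ι → Shuffle ι R :=
  fn D k l K L - ((-1 : ℝ) ^ l / ((Fintype.card ι : ℝ) - k - l + 1)) • wedgeI (d D (S K L))

/-- With vanishing traces, `tr_fn` leaves `-(-1)^k dS(K, L)`, and the correction made by `pr` in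
degree `k + l` is the one in the definition of `cb`. No bound on `k + l` is needed: if the
denominator is zero, both corrections are zero. -/
theorem cb_eq_pr {k l : ℕ} {K L : ι → Shuffle ι R} (hK : IsForm k K) (hL : IsForm l L)
    (hK0 : tr K = 0) (hL0 : tr L = 0) : cb D k l K L = pr (k + l) (fn D k l K L) := by
  rw [pr_apply, tr_fn hK.parity hL.parity hK.alt hL.alt, hK0, hL0, cb]
  simp only [map_zero, smul_zero, sub_zero, zero_sub, map_neg, map_smul, smul_neg, smul_smul,
    ← sub_eq_add_neg, Nat.cast_add, ← sub_sub]
  congr 2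
  rcases neg_one_pow_eq_or ℝ k with hk | hk <;> simp [pow_add, hk, neg_div]

/-- The fields whose trace is closed are closed under the bracket. -/
theorem d_tr_fn (hD : ∀ a b f, D a (D b f) = D b (D a f)) {k l : ℕ} {K L : ι → Shuffle ι R}
    (hK : IsForm k K) (hL : IsForm l L) (hK0 : d D (tr K) = 0) (hL0 : d D (tr L) = 0) :
    d D (tr (fn D k l K L)) = 0 := by
  rw [tr_fn hK.parity hL.parity hK.alt hL.alt]
  simp [d_lie_of_closed hD hK0, d_lie_of_closed hD hL0, d_d hD]

theorem pr_fn_wedgeI {k n : ℕ} {K : ι → Shuffle ι R} (hK : IsForm k K) {φ : Shuffle ι R}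
    (h : IsAlt φ) (hn : HasDegree ((n : ℤ) - 1) φ) (hφ : d D φ = 0)
    (hm : k + n ≤ Fintype.card ι) : pr (k + n) (fn D k n K (wedgeI φ)) = 0 := by
  cases n with
  | zero =>
    -- In this case `φ` would have degree `-1`; `fn_wedgeI` applies only when the degree of `φ ∧ I`
    -- is a successor.
    have : φ = 0 := by ext l; exact hn l (by simp)
    rw [this, map_zero]
    have : fn D k 0 K (0 : ι → Shuffle ι R) = 0 := by
      simpa using fn_smul_right (D := D) k 0 (0 : ℝ) K 0
    simp [this]
  | succ n =>
    have hp : HasParity n φ := (hn.congr (by simp)).hasParity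
    rw [fn_wedgeI hK.parity hp hφ]
    exact pr_wedgeI (IsAlt.lie hK h) ((HasDegree.lie hK hn).congr (by push_cast; ring)) hm

theorem pr_fn_wedgeI_left {k n : ℕ} {K : ι → Shuffle ι R} (hK : IsForm k K) {φ : Shuffle ι R}
    (h : IsAlt φ) (hn : HasDegree ((n : ℤ) - 1) φ) (hφ : d D φ = 0)
    (hm : n + k ≤ Fintype.card ι) : pr (n + k) (fn D n k (wedgeI φ) K) = 0 := by
  have h1 : fn D n k (wedgeI φ) K = -((-1 : ℝ) ^ (n * k) • fn D k n K (wedgeI φ)) :=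
    funext fun b => fn_antisymm n k _ _ b
  rw [h1, map_neg, map_smul, add_comm n k, pr_fn_wedgeI hK h hn hφ (add_comm n k ▸ hm)]
  simp

/-- The projection onto the traceless part is a homomorphism. -/
theorem pr_fn {k l : ℕ} {K L : ι → Shuffle ι R}
    (hK : IsForm k K) (hL : IsForm l L) (hK0 : d D (tr K) = 0) (hL0 : d D (tr L) = 0)
    (hm : k + l ≤ Fintype.card ι) :
    pr (k + l) (fn D k l K L) = cb D k l (pr k K) (pr l L) := by
  rw [cb_eq_pr hK.pr hL.pr (tr_pr hK (by omega)) (tr_pr hL (by omega))]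
  -- `L` and `K` are replaced by their projections one after the other. Each differs from its
  -- projection by a multiple of its closed trace times `I`, and `pr` kills the bracket with such a
  -- field.
  have hL1 : fn D k l K L = fn D k l K (pr l L) -
      ((-1 : ℝ) ^ l / ((Fintype.card ι : ℝ) - l + 1)) • fn D k l K (wedgeI (tr L)) := by
    rw [← fn_smul_right, ← fn_sub_right, pr_apply, add_sub_cancel_right]
  have hK1 : fn D k l K (pr l L) = fn D k l (pr k K) (pr l L) -
      ((-1 : ℝ) ^ k / ((Fintype.card ι : ℝ) - k + 1)) • fn D k l (wedgeI (tr K)) (pr l L) := by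
    rw [← fn_smul_left, ← fn_sub_left, pr_apply k, add_sub_cancel_right]
  rw [hL1, hK1]
  simp only [map_sub, map_smul, pr_fn_wedgeI hK hL.alt_tr hL.degree_tr hL0 hm,
    pr_fn_wedgeI_left hL.pr hK.alt_tr hK.degree_tr hK0 hm, smul_zero, sub_zero]

theorem cb_antisymm {k l : ℕ} {K L : ι → Shuffle ι R} (hK : IsForm k K) (hL : IsForm l L)
    (hK0 : tr K = 0) (hL0 : tr L = 0) :
    cb D k l K L = -((-1 : ℝ) ^ (k * l) • cb D l k L K) := by
  rw [cb_eq_pr hK hL hK0 hL0, cb_eq_pr hL hK hL0 hK0, add_comm l k, ← map_smul, ← map_neg]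
  congr 1
  funext b
  exact fn_antisymm k l K L b

theorem tr_cb {k l : ℕ} {K L : ι → Shuffle ι R} (hK : IsForm k K) (hL : IsForm l L)
    (hK0 : tr K = 0) (hL0 : tr L = 0) (hm : k + l ≤ Fintype.card ι) : tr (cb D k l K L) = 0 := by
  rw [cb_eq_pr hK hL hK0 hL0, tr_pr (hK.fn hL) hm]

/-- The inner bracket `[L, P]` is not traceless but has closed trace `∓dS(L, P)`, so the
homomorphism property of `pr` still applies and the inner projection can be dropped. The Jacobi
identity for `cb` is thus the projection of the one for `fn`. -/
theorem cb_cb (hD : ∀ a b f, D a (D b f) = D b (D a f)) {k l p : ℕ} {K L P : ι → Shuffle ι R}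
    (hK : IsForm k K) (hL : IsForm l L) (hP : IsForm p P) (hK0 : tr K = 0) (hL0 : tr L = 0)
    (hP0 : tr P = 0) (hm : k + (l + p) ≤ Fintype.card ι) :
    cb D k (l + p) K (cb D l p L P) = pr (k + (l + p)) (fn D k (l + p) K (fn D l p L P)) := by
  rw [pr_fn hK (hL.fn hP) (by simp [hK0]) (d_tr_fn hD hL hP (by simp [hL0]) (by simp [hP0])) hm,
    pr_of_tr hK0, cb_eq_pr hL hP hL0 hP0]

theorem cb_cb_left (hD : ∀ a b f, D a (D b f) = D b (D a f)) {k l p : ℕ}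
    {K L P : ι → Shuffle ι R}
    (hK : IsForm k K) (hL : IsForm l L) (hP : IsForm p P) (hK0 : tr K = 0) (hL0 : tr L = 0)
    (hP0 : tr P = 0) (hm : k + l + p ≤ Fintype.card ι) :
    cb D (k + l) p (cb D k l K L) P = pr (k + l + p) (fn D (k + l) p (fn D k l K L) P) := by
  rw [pr_fn (hK.fn hL) hP (d_tr_fn hD hK hL (by simp [hK0]) (by simp [hL0])) (by simp [hP0]) hm,
    pr_of_tr hP0, cb_eq_pr hK hL hK0 hL0]

theorem cb_jacobi (hD : ∀ a b f, D a (D b f) = D b (D a f)) {k l p : ℕ} {K L P : ι → Shuffle ι R}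
    (hK : IsForm k K) (hL : IsForm l L) (hP : IsForm p P) (hK0 : tr K = 0) (hL0 : tr L = 0)
    (hP0 : tr P = 0) (hm : k + (l + p) ≤ Fintype.card ι) :
    cb D k (l + p) K (cb D l p L P) = cb D (k + l) p (cb D k l K L) P +
      (-1 : ℝ) ^ (k * l) • cb D l (k + p) L (cb D k p K P) := by
  rw [cb_cb hD hK hL hP hK0 hL0 hP0 hm, cb_cb_left hD hK hL hP hK0 hL0 hP0 (by omega),
    cb_cb hD hL hK hP hL0 hK0 hP0 (by omega),
    fn_jacobi hD hK.parity hL.parity hP.parity hK.alt hL.alt hP.alt, map_add, map_smul,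
    add_assoc k l p, add_left_comm l k p]

end Shuffle

/-! ### Components of alternating maps -/

section Alternatization

variable {E F : Type*} [NormedAddCommGroup E] [NormedSpace ℝ E]
  [NormedAddCommGroup F] [NormedSpace ℝ F]

/-- Permutations of `Fin (n + 1)` split according to the preimage of `0`. -/
def permSplit (n : ℕ) (x : Fin (n + 1) × Equiv.Perm (Fin n)) : Equiv.Perm (Fin (n + 1)) :=
  Equiv.Perm.decomposeFin.symm (0, x.2) * x.1.cycleRange

/-- `p` is recovered as the preimage of `0` and `e` by cancelling the cycle; the cardinalities agree
since `(n + 1)! = (n + 1) · n!`. -/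
theorem permSplit_bijective (n : ℕ) : Function.Bijective (permSplit n) := by
  rw [Fintype.bijective_iff_injective_and_card]
  constructor
  · rintro ⟨p, e⟩ ⟨q, f⟩ h
    have hp : permSplit n (p, e) p = 0 := by simp [permSplit]
    have hq : permSplit n (q, f) q = 0 := by simp [permSplit]
    have hpq : p = q := by
      rw [← hp, h] at hq
      exact ((permSplit n (q, f)).injective hq).symm
    subst hpq
    have := mul_right_cancel h
    have := Equiv.Perm.decomposeFin.symm.injective this
    simpa using this
  · simp [Fintype.card_perm, Nat.factorial_succ]

/-- Permutations are sorted by the slot `p` which receives the first vector; the cycle bringing that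
slot to the front has sign `(-1)^p`. -/
theorem alternatization_cons {n : ℕ} (T : ContinuousMultilinearMap ℝ (fun _ : Fin (n + 1) => E) F)
    (x : E) (v : Fin n → E) :
    ContinuousMultilinearMap.alternatization T (Fin.cons x v : Fin (n + 1) → E) =
      ∑ p : Fin (n + 1), (-1 : ℝ) ^ (p : ℕ) •
        ∑ e : Equiv.Perm (Fin n), Equiv.Perm.sign e • T (p.insertNth x (v ∘ e)) := by
  rw [ContinuousMultilinearMap.alternatization_apply_apply,
    ← (Equiv.ofBijective _ (permSplit_bijective n)).sum_comp, Fintype.sum_prod_type]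
  refine Finset.sum_congr rfl fun p _ => ?_
  rw [Finset.smul_sum]
  refine Finset.sum_congr rfl fun e _ => ?_
  have h : (Fin.cons x v : Fin (n + 1) → E) ∘ permSplit n (p, e) = p.insertNth x (v ∘ e) := by
    rw [← Fin.cons_comp_cycleRange, permSplit, Equiv.Perm.coe_mul, ← Function.comp_assoc]
    congr 1
    funext j
    cases j using Fin.cases <;> simp
  have hs : Equiv.Perm.sign (permSplit n (p, e)) = (-1) ^ (p : ℕ) * Equiv.Perm.sign e := by
    simp [permSplit, mul_comm]
  simp only [Equiv.ofBijective_apply, hs, h]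
  rcases Nat.even_or_odd (p : ℕ) with hp | hp <;> simp [hp.neg_one_pow]

theorem tensor_apply {k l : ℕ} (φ : E [⋀^Fin k]→L[ℝ] ℝ) (ψ : E [⋀^Fin l]→L[ℝ] F)
    (v : Fin (k + l) → E) :
    tensor φ ψ v = φ (fun i => v (Fin.castAdd l i)) • ψ (fun i => v (Fin.natAdd k i)) := rfl

theorem tensor_insertNth_left {k l : ℕ} (φ : E [⋀^Fin (k + 1)]→L[ℝ] ℝ) (ψ : E [⋀^Fin l]→L[ℝ] F)
    (h : k + 1 + l = k + l + 1) (p : Fin (k + 1)) (x : E) (w : Fin (k + l) → E) :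
    tensor φ ψ (((Fin.castAdd l p).cast h).insertNth x w ∘ Fin.cast h) =
      (-1 : ℝ) ^ (p : ℕ) • tensor (φ.curryLeft x) ψ w := by
  have h1 : (fun i => (((Fin.castAdd l p).cast h).insertNth x w ∘ Fin.cast h) (Fin.castAdd l i)) =
      p.insertNth x fun i => w (Fin.castAdd l i) := by
    funext i
    cases i using p.succAboveCases with
    | x => simp
    | p j =>
      have : (Fin.castAdd l (p.succAbove j)).cast h =
          ((Fin.castAdd l p).cast h).succAbove (Fin.castAdd l j) := by
        ext; simp only [Fin.succAbove, Fin.lt_def]; simp; split_ifs <;> simp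
      simp [this]
  have h2 : (fun i => (((Fin.castAdd l p).cast h).insertNth x w ∘ Fin.cast h)
      (Fin.natAdd (k + 1) i)) = fun i => w (Fin.natAdd k i) := by
    funext i
    have : (Fin.natAdd (k + 1) i).cast h =
        ((Fin.castAdd l p).cast h).succAbove (Fin.natAdd k i) := by
      ext; simp only [Fin.succAbove, Fin.lt_def]; simp; split_ifs <;> simp <;> omega
    simp [this]
  rw [tensor_apply, tensor_apply, h1, h2, φ.map_insertNth]
  rcases Nat.even_or_odd (p : ℕ) with hp | hp <;> simp [hp.neg_one_pow]

theorem tensor_insertNth_right {k l : ℕ} (φ : E [⋀^Fin k]→L[ℝ] ℝ) (ψ : E [⋀^Fin (l + 1)]→L[ℝ] F)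
    (p : Fin (l + 1)) (x : E) (w : Fin (k + l) → E) :
    tensor φ ψ ((Fin.natAdd k p : Fin (k + l + 1)).insertNth x w) =
      (-1 : ℝ) ^ (p : ℕ) • tensor φ (ψ.curryLeft x) w := by
  have h1 : (fun i => ((Fin.natAdd k p : Fin (k + l + 1)).insertNth x w : _ → E)
      (Fin.castAdd (l + 1) i)) = fun i => w (Fin.castAdd l i) := by
    funext i
    have : (Fin.castAdd (l + 1) i : Fin (k + l + 1)) =
        (Fin.natAdd k p : Fin (k + l + 1)).succAbove (Fin.castAdd l i) := by
      ext; simp only [Fin.succAbove, Fin.lt_def]; simp; split_ifs <;> simp <;> omega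
    simp [this]
  have h2 : (fun i => ((Fin.natAdd k p : Fin (k + l + 1)).insertNth x w : _ → E)
      (Fin.natAdd k i)) = p.insertNth x fun i => w (Fin.natAdd k i) := by
    funext i
    cases i using p.succAboveCases with
    | x => simp
    | p j =>
      have : (Fin.natAdd k (p.succAbove j) : Fin (k + l + 1)) =
          (Fin.natAdd k p : Fin (k + l + 1)).succAbove (Fin.natAdd k j) := by
        ext; simp only [Fin.succAbove, Fin.lt_def]; simp; split_ifs <;> simp; omega
      simp [this]
  have h3 := tensor_apply φ ψ ((Fin.natAdd k p : Fin (k + l + 1)).insertNth x w)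
  rw [h1, h2] at h3
  refine h3.trans ?_
  rw [tensor_apply, ψ.map_insertNth, smul_comm]
  rcases Nat.even_or_odd (p : ℕ) with hp | hp <;> simp [hp.neg_one_pow]

/-- The sign of the expansion cancels the sign of moving `x` to the front of `φ`, so all `k + 1`
slots of `φ` contribute equally. For a slot of `ψ` the expansion sign is `(-1)^(k + p)`, which
leaves `(-1)^k` in `sum_insertNth_right`. -/
theorem sum_insertNth_left {k l n : ℕ} (φ : E [⋀^Fin (k + 1)]→L[ℝ] ℝ) (ψ : E [⋀^Fin l]→L[ℝ] F)
    (hn : n = k + l) (h : k + 1 + l = n + 1) (x : E) (v : Fin n → E) :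
    ∑ p : Fin (k + 1), (-1 : ℝ) ^ (((Fin.castAdd l p).cast h : Fin (n + 1)) : ℕ) •
      ∑ e : Equiv.Perm (Fin n), Equiv.Perm.sign e •
        tensor φ ψ (((Fin.castAdd l p).cast h).insertNth x (v ∘ e) ∘ Fin.cast h) =
      (k + 1 : ℝ) • ContinuousMultilinearMap.alternatization (tensor (φ.curryLeft x) ψ)
        (v ∘ Fin.cast hn.symm) := by
  subst hn
  simp only [tensor_insertNth_left, smul_comm (Equiv.Perm.sign _) ((-1 : ℝ) ^ _),
    ← Finset.smul_sum, smul_smul]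
  simp [ContinuousMultilinearMap.alternatization_apply_apply, ← mul_pow,
    ← Nat.cast_smul_eq_nsmul ℝ]

theorem sum_insertNth_right {k l : ℕ} (φ : E [⋀^Fin k]→L[ℝ] ℝ) (ψ : E [⋀^Fin (l + 1)]→L[ℝ] F)
    (x : E) (v : Fin (k + l) → E) :
    ∑ p : Fin (l + 1), (-1 : ℝ) ^ ((Fin.natAdd k p : Fin (k + l + 1)) : ℕ) •
      ∑ e : Equiv.Perm (Fin (k + l)), Equiv.Perm.sign e •
        tensor φ ψ ((Fin.natAdd k p : Fin (k + l + 1)).insertNth x (v ∘ e)) =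
      ((-1 : ℝ) ^ k * (l + 1 : ℝ)) •
        ContinuousMultilinearMap.alternatization (tensor φ (ψ.curryLeft x)) v := by
  simp only [tensor_insertNth_right, smul_comm (Equiv.Perm.sign _) ((-1 : ℝ) ^ _),
    ← Finset.smul_sum, smul_smul]
  have h (p : Fin (l + 1)) : (-1 : ℝ) ^ ((Fin.natAdd k p : Fin (k + l + 1)) : ℕ) *
      (-1 : ℝ) ^ (p : ℕ) = (-1 : ℝ) ^ k := by
    rw [Fin.val_natAdd, pow_add, mul_assoc, ← mul_pow]; simp
  simp only [h, Finset.sum_const, Finset.card_univ, Fintype.card_fin,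
    ContinuousMultilinearMap.alternatization_apply_apply, ← Nat.cast_smul_eq_nsmul ℝ, smul_smul]
  push_cast
  rw [mul_comm]

/-- Insertion of a vector is an antiderivation of the exterior product. -/
theorem wedge_cons {k l : ℕ} (φ : E [⋀^Fin (k + 1)]→L[ℝ] ℝ) (ψ : E [⋀^Fin (l + 1)]→L[ℝ] F)
    (x : E) (v : Fin (k + 1 + l) → E) :
    wedge φ ψ (Fin.cons x v : Fin (k + 1 + l + 1) → E) =
      wedge (φ.curryLeft x) ψ (v ∘ Fin.cast (by omega : k + (l + 1) = k + 1 + l)) +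
        (-1 : ℝ) ^ (k + 1) • wedge φ (ψ.curryLeft x) v := by
  have h0 := alternatization_cons (n := k + 1 + l) (tensor (k := k + 1) (l := l + 1) φ ψ) x v
  have h1 := sum_insertNth_left φ ψ (by omega : k + 1 + l = k + (l + 1)) rfl x v
  have h2 := sum_insertNth_right φ ψ x v
  have h3 := h0.trans (Fin.sum_univ_add (a := k + 1) (b := l + 1) _)
  have h4 := h3.trans (congrArg₂ (· + ·) h1 h2)
  simp only [wedge, ContinuousAlternatingMap.smul_apply]
  refine (congrArg _ h4).trans ?_
  rw [smul_add, smul_smul, smul_smul, smul_smul]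
  congr 2
  -- The multiplicity `k + 1` turns `1 / (k + 1)!` into `1 / k!`, the normalization for `φ` with one
  -- slot filled; likewise for `ψ`.
  · rw [Nat.factorial_succ k]; push_cast
    field_simp
  · rw [Nat.factorial_succ l]; push_cast
    field_simp

theorem wedge_cons_left {k : ℕ} (φ : E [⋀^Fin (k + 1)]→L[ℝ] ℝ) (ψ : E [⋀^Fin 0]→L[ℝ] F)
    (x : E) (v : Fin k → E) :
    wedge φ ψ (Fin.cons x v : Fin (k + 1) → E) = wedge (φ.curryLeft x) ψ v := by
  have h0 := alternatization_cons (n := k) (tensor (k := k + 1) (l := 0) φ ψ) x v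
  have h1 := sum_insertNth_left φ ψ (rfl : k = k + 0) rfl x v
  have h3 := h0.trans (Fin.sum_univ_add (a := k + 1) (b := 0) _)
  have h4 := h3.trans (congrArg₂ (· + ·) h1 (Finset.sum_empty))
  simp only [wedge, ContinuousAlternatingMap.smul_apply]
  refine (congrArg _ h4).trans ?_
  rw [smul_add, smul_zero, add_zero, smul_smul]
  congr 1
  rw [Nat.factorial_succ k]; push_cast
  field_simp

theorem wedge_cons_right {l : ℕ} (φ : E [⋀^Fin 0]→L[ℝ] ℝ) (ψ : E [⋀^Fin (l + 1)]→L[ℝ] F)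
    (x : E) (v : Fin (0 + l) → E) :
    wedge φ ψ (Fin.cons x v : Fin (0 + l + 1) → E) = wedge φ (ψ.curryLeft x) v := by
  have h0 := alternatization_cons (n := 0 + l) (tensor (k := 0) (l := l + 1) φ ψ) x v
  have h2 := sum_insertNth_right φ ψ x v
  have h3 := h0.trans (Fin.sum_univ_add (a := 0) (b := l + 1) _)
  have h4 := h3.trans (congrArg₂ (· + ·) (Finset.sum_empty) h2)
  simp only [wedge, ContinuousAlternatingMap.smul_apply]
  refine (congrArg _ h4).trans ?_
  rw [smul_add, smul_zero, zero_add, smul_smul]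
  congr 1
  rw [Nat.factorial_succ l]; push_cast
  field_simp

theorem wedge_zero_zero (φ : E [⋀^Fin 0]→L[ℝ] ℝ) (ψ : E [⋀^Fin 0]→L[ℝ] F)
    (v : Fin (0 + 0) → E) (w : Fin 0 → E) : wedge φ ψ v = φ w • ψ w := by
  have : IsEmpty (Fin (0 + 0)) := by simpa using Fin.isEmpty
  simp only [wedge, ContinuousAlternatingMap.smul_apply,
    ContinuousMultilinearMap.alternatization_apply_apply, tensor_apply]
  rw [Fintype.sum_unique]
  simp [Subsingleton.elim _ w]


end Alternatization

/-! ### Alternating maps as elements of the shuffle algebra -/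

section Components

variable {E : Type*} [NormedAddCommGroup E] [NormedSpace ℝ E]

/-- The value of an alternating map on a list of vectors, zero if the length is not the degree. -/
def evalL : ∀ {k : ℕ}, (E [⋀^Fin k]→L[ℝ] ℝ) → Shuffle E ℝ
  | 0, θ, [] => θ ![]
  | 0, _, _ :: _ => 0
  | _ + 1, _, [] => 0
  | _ + 1, θ, v :: l => evalL (θ.curryLeft v) l

@[simp] theorem evalL_zero_nil (θ : E [⋀^Fin 0]→L[ℝ] ℝ) : evalL θ [] = θ ![] := rfl
@[simp] theorem evalL_zero_cons (θ : E [⋀^Fin 0]→L[ℝ] ℝ) (v : E) (l : List E) :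
    evalL θ (v :: l) = 0 := rfl
@[simp] theorem evalL_succ_nil {k : ℕ} (θ : E [⋀^Fin (k + 1)]→L[ℝ] ℝ) : evalL θ [] = 0 := rfl
@[simp] theorem evalL_succ_cons {k : ℕ} (θ : E [⋀^Fin (k + 1)]→L[ℝ] ℝ) (v : E) (l : List E) :
    evalL θ (v :: l) = evalL (θ.curryLeft v) l := rfl

theorem hasDegree_evalL {k : ℕ} (θ : E [⋀^Fin k]→L[ℝ] ℝ) : Shuffle.HasDegree k (evalL θ) := by
  intro l hl
  induction l generalizing k with
  | nil =>
    cases k with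
    | zero => simp at hl
    | succ k => simp
  | cons v l ih =>
    cases k with
    | zero => simp
    | succ k => exact ih _ (by simpa using hl)

theorem evalL_ofFn {k n : ℕ} (h : k = n) (θ : E [⋀^Fin k]→L[ℝ] ℝ) (v : Fin n → E) :
    evalL θ (List.ofFn v) = θ (v ∘ Fin.cast h) := by
  subst h
  induction k with
  | zero => simp [Subsingleton.elim v ![]]
  | succ k ih =>
    rw [List.ofFn_succ, evalL_succ_cons, ih]
    simp only [ContinuousAlternatingMap.curryLeft_apply_apply]
    congr 1
    funext i
    cases i using Fin.cases <;> simp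

theorem evalL_add {k : ℕ} (θ θ' : E [⋀^Fin k]→L[ℝ] ℝ) : evalL (θ + θ') = evalL θ + evalL θ' := by
  ext l
  induction l generalizing k with
  | nil => cases k <;> simp
  | cons v l ih => cases k <;> simp [ih]

theorem evalL_smul {k : ℕ} (r : ℝ) (θ : E [⋀^Fin k]→L[ℝ] ℝ) : evalL (r • θ) = r • evalL θ := by
  ext l
  induction l generalizing k with
  | nil => cases k <;> simp
  | cons v l ih => cases k <;> simp [ih]

/-- `evalL` as a linear map. -/
def evalLₗ (E : Type*) [NormedAddCommGroup E] [NormedSpace ℝ E] (k : ℕ) :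
    (E [⋀^Fin k]→L[ℝ] ℝ) →ₗ[ℝ] Shuffle E ℝ where
  toFun := evalL
  map_add' := evalL_add
  map_smul' := evalL_smul

theorem evalL_sub {k : ℕ} (θ θ' : E [⋀^Fin k]→L[ℝ] ℝ) : evalL (θ - θ') = evalL θ - evalL θ' :=
  (evalLₗ E k).map_sub _ _

/-- Components of an exterior product. -/
theorem evalL_wedge {k l : ℕ} (φ : E [⋀^Fin k]→L[ℝ] ℝ) (ψ : E [⋀^Fin l]→L[ℝ] ℝ) :
    evalL (wedge φ ψ) = evalL φ * evalL ψ := by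
  ext s
  -- At lists of any other length both sides vanish by degree.
  by_cases hs : s.length = k + l
  swap
  · rw [hasDegree_evalL _ s (by exact_mod_cast hs),
      ((hasDegree_evalL φ).mul (hasDegree_evalL ψ)) s (by exact_mod_cast hs)]
  induction s generalizing k l with
  | nil =>
    obtain rfl : k = 0 := by simp at hs; omega
    obtain rfl : l = 0 := by simp at hs; omega
    rw [Shuffle.mul_nil]
    exact wedge_zero_zero φ ψ _ _
  | cons x s ih =>
    rw [Shuffle.mul_cons, (hasDegree_evalL φ).hasParity, smul_mul_assoc, Shuffle.smul_apply]
    obtain ⟨n, v, rfl⟩ : ∃ n, ∃ v : Fin n → E, s = List.ofFn v :=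
      ⟨s.length, s.get, (List.ofFn_get s).symm⟩
    have hn : n + 1 = k + l := by simpa using hs
    have hc : x :: List.ofFn v = List.ofFn (Fin.cons x v : Fin (n + 1) → E) := by simp
    cases k with
    | zero =>
      have h0 : Shuffle.cut x (evalL φ) = 0 := by ext l; simp
      rw [h0, zero_mul, Shuffle.zero_apply, pow_zero, one_smul, zero_add (_ : ℝ)]
      cases l with
      | zero => omega
      | succ l =>
        obtain rfl : n = 0 + l := by omega
        have h1 : Shuffle.cut x (evalL ψ) = evalL (ψ.curryLeft x) := by ext l; simp
        rw [h1, ← ih _ _ (by simp), hc, evalL_ofFn rfl, evalL_ofFn rfl]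
        exact wedge_cons_right φ ψ x v
    | succ k =>
      have h1 : Shuffle.cut x (evalL φ) = evalL (φ.curryLeft x) := by ext l; simp
      cases l with
      | zero =>
        obtain rfl : n = k := by omega
        have h0 : Shuffle.cut x (evalL ψ) = 0 := by ext l; simp
        rw [h0, mul_zero, Shuffle.zero_apply, smul_zero, add_zero (_ : ℝ), h1, ← ih _ _ (by simp), hc,
          evalL_ofFn rfl, evalL_ofFn rfl]
        exact wedge_cons_left φ ψ x v
      | succ l =>
        obtain rfl : n = k + 1 + l := by omega
        have h2 : Shuffle.cut x (evalL ψ) = evalL (ψ.curryLeft x) := by ext l; simp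
        rw [h1, h2, ← ih _ _ (by simp; omega), ← ih _ _ (by simp), hc, evalL_ofFn rfl,
          evalL_ofFn (by omega), evalL_ofFn rfl]
        exact wedge_cons φ ψ x v

theorem isAlt_evalL {k : ℕ} (θ : E [⋀^Fin k]→L[ℝ] ℝ) : Shuffle.IsAlt (evalL θ) := by
  intro p q a b
  induction p generalizing k with
  | nil =>
    match k with
    | 0 => simp
    | 1 => simp
    | k + 2 =>
      have h : (θ.curryLeft a).curryLeft b = -(θ.curryLeft b).curryLeft a := by
        -- Polarization: expand the vanishing double insertion of `a + b`.
        have := θ.curryLeft_same (a + b)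
        simp only [map_add, ContinuousAlternatingMap.curryLeft_add, add_apply,
          ContinuousAlternatingMap.curryLeft_same, add_zero, zero_add] at this
        exact eq_neg_of_add_eq_zero_right this
      have h' : evalL (-(θ.curryLeft b).curryLeft a) = -evalL ((θ.curryLeft b).curryLeft a) :=
        (evalLₗ E k).map_neg _
      simp only [List.nil_append, evalL_succ_cons, h, h', Shuffle.neg_apply]
  | cons c p ih =>
    cases k with
    | zero => simp
    | succ k => exact ih _

/-- An alternating map is determined by its values on lists of basis vectors. -/
theorem evalL_injective {ι : Type*} (b : Module.Basis ι ℝ E) {k : ℕ} {θ θ' : E [⋀^Fin k]→L[ℝ] ℝ}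
    (h : ∀ l : List ι, evalL θ (l.map b) = evalL θ' (l.map b)) : θ = θ' := by
  induction k with
  | zero =>
    ext v
    rw [Subsingleton.elim v ![]]
    exact h []
  | succ k ih =>
    have h1 : θ.curryLeft.toLinearMap = θ'.curryLeft.toLinearMap :=
      b.ext fun a => ih fun l => h (a :: l)
    ext v
    have h2 := congrArg (fun f => f (Fin.tail v)) (LinearMap.congr_fun h1 (v 0))
    simpa [Matrix.vecCons] using h2

/-- Evaluation of the first argument of alternating maps at `x`. -/
def curryAt (k : ℕ) (x : E) : (E [⋀^Fin (k + 1)]→L[ℝ] ℝ) →L[ℝ] E [⋀^Fin k]→L[ℝ] ℝ :=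
  ContinuousAlternatingMap.curryLeftLI.toContinuousLinearMap.flip x

@[simp] theorem curryAt_apply {k : ℕ} (x : E) (θ : E [⋀^Fin (k + 1)]→L[ℝ] ℝ) :
    curryAt k x θ = θ.curryLeft x := rfl

/-- Insertion of a vector into an exterior derivative. -/
theorem curryLeft_alternatizeUncurryFin {k : ℕ} (f : E →L[ℝ] E [⋀^Fin (k + 1)]→L[ℝ] ℝ) (x : E) :
    (ContinuousAlternatingMap.alternatizeUncurryFin f).curryLeft x =
      f x - ContinuousAlternatingMap.alternatizeUncurryFin ((curryAt k x).comp f) := by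
  ext v
  have h (j : Fin (k + 1)) : j.succ.removeNth (Matrix.vecCons x v) =
      Matrix.vecCons x (j.removeNth v) := by
    funext i
    cases i using Fin.cases <;> simp [Fin.removeNth]
  simp only [ContinuousAlternatingMap.curryLeft_apply_apply, ContinuousAlternatingMap.sub_apply,
    ContinuousAlternatingMap.alternatizeUncurryFin_apply]
  rw [Fin.sum_univ_succ]
  simp only [h, Matrix.cons_val_succ, Fin.val_succ, pow_succ, ContinuousLinearMap.comp_apply,
    curryAt_apply, ContinuousAlternatingMap.curryLeft_apply_apply]
  simp [sub_eq_add_neg, Matrix.vecCons]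

theorem curryLeft_alternatizeUncurryFin_zero (f : E →L[ℝ] E [⋀^Fin 0]→L[ℝ] ℝ) (x : E) :
    (ContinuousAlternatingMap.alternatizeUncurryFin f).curryLeft x = f x := by
  ext v
  simp [ContinuousAlternatingMap.alternatizeUncurryFin_apply, Subsingleton.elim _ v]

end Components

/-! ### The algebra of smooth functions on an open set -/

section SmoothAlg

open TopologicalSpace (Opens)

variable {E : Type*} [NormedAddCommGroup E] [NormedSpace ℝ E]

/-- Extension by zero of a function on an open set. -/
def extZero {U : Opens E} (f : U → ℝ) : E → ℝ := Function.extend Subtype.val f 0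

theorem extZero_apply {U : Opens E} (f : U → ℝ) (x : U) : extZero f x = f x :=
  Subtype.val_injective.extend_apply f 0 x

theorem contDiffOn_extZero {U : Opens E} {f : U → ℝ} {g : E → ℝ} (h : ∀ x : U, f x = g x)
    (hg : ContDiffOn ℝ ∞ g U) : ContDiffOn ℝ ∞ (extZero f) U :=
  hg.congr fun x hx => (extZero_apply f ⟨x, hx⟩).trans (h ⟨x, hx⟩)

/-- The algebra of smooth functions on `U`. -/
def SmoothAlg (U : Opens E) : Subalgebra ℝ (U → ℝ) where
  -- Functions on the subtype are used so that equality in the algebra is equality on `U`; the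
  -- extension by zero makes differentiation in `E` available.
  carrier := {f | ContDiffOn ℝ ∞ (extZero f) U}
  mul_mem' {f g} hf hg := contDiffOn_extZero (g := extZero f * extZero g)
    (fun x => by simp [extZero_apply]) (hf.mul hg)
  add_mem' {f g} hf hg := contDiffOn_extZero (g := extZero f + extZero g)
    (fun x => by simp [extZero_apply]) (hf.add hg)
  algebraMap_mem' r := contDiffOn_extZero (g := fun _ => r) (fun _ => rfl) contDiffOn_const

theorem extZero_eventuallyEq {U : Opens E} {f : U → ℝ} {g : E → ℝ} (h : ∀ x : U, f x = g x)
    (x : U) : extZero f =ᶠ[nhds (x : E)] g := by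
  filter_upwards [U.isOpen.mem_nhds x.2] with y hy
  exact (extZero_apply f ⟨y, hy⟩).trans (h ⟨y, hy⟩)

theorem contDiffAt_extZero {U : Opens E} (f : SmoothAlg U) (x : U) :
    ContDiffAt ℝ ∞ (extZero f.1) x :=
  f.2.contDiffAt (U.isOpen.mem_nhds x.2)

theorem contDiffOn_fderiv_apply {U : Opens E} {g : E → ℝ} (hg : ContDiffOn ℝ ∞ g U) (v : E) :
    ContDiffOn ℝ ∞ (fun x => fderiv ℝ g x v) U :=
  (hg.fderiv_of_isOpen U.isOpen (m := ∞) (by simp)).clm_apply contDiffOn_const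

/-- The derivative in direction `v`, as a derivation of the algebra of smooth functions. -/
def dirDeriv (U : Opens E) (v : E) : Derivation ℝ (SmoothAlg U) (SmoothAlg U) :=
  Derivation.mk'
    { toFun := fun f => ⟨fun x => fderiv ℝ (extZero f.1) x v,
        contDiffOn_extZero (fun _ => rfl) (contDiffOn_fderiv_apply f.2 v)⟩
      map_add' := fun f g => by
        ext x
        have h := (extZero_eventuallyEq (f := (f + g).1) (g := extZero f.1 + extZero g.1)
          (fun x => by simp [extZero_apply]) x).fderiv_eq (𝕜 := ℝ)
        have h' := fderiv_add ((contDiffAt_extZero f x).differentiableAt (by simp))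
          ((contDiffAt_extZero g x).differentiableAt (by simp))
        exact congrArg (fun f => f v) (h.trans h')
      map_smul' := fun r f => by
        ext x
        have h := (extZero_eventuallyEq (f := (r • f).1) (g := r • extZero f.1)
          (fun x => by simp [extZero_apply]) x).fderiv_eq (𝕜 := ℝ)
        have h' := fderiv_const_smul ((contDiffAt_extZero f x).differentiableAt (by simp)) r
        exact congrArg (fun f => f v) (h.trans h') }
    fun f g => by
      ext x
      have h := (extZero_eventuallyEq (f := (f * g).1) (g := extZero f.1 * extZero g.1)
          (fun x => by simp [extZero_apply]) x).fderiv_eq (𝕜 := ℝ)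
      have h' := fderiv_mul ((contDiffAt_extZero f x).differentiableAt (by simp))
          ((contDiffAt_extZero g x).differentiableAt (by simp))
      rw [extZero_apply, extZero_apply] at h'
      exact congrArg (fun f => f v) (h.trans h')

theorem dirDeriv_apply {U : Opens E} (v : E) (f : SmoothAlg U) {g : E → ℝ}
    (h : ∀ x : U, f.1 x = g x) (x : U) : (dirDeriv U v f).1 x = fderiv ℝ g x v := by
  rw [← (extZero_eventuallyEq h x).fderiv_eq (𝕜 := ℝ)]; rfl

theorem dirDeriv_comm (U : Opens E) (v w : E) (f : SmoothAlg U) :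
    dirDeriv U v (dirDeriv U w f) = dirDeriv U w (dirDeriv U v f) := by
  ext x
  have h0 : DifferentiableAt ℝ (fderiv ℝ (extZero f.1)) (x : E) :=
    ((contDiffAt_extZero f x).fderiv_right (m := 1) (by norm_cast)).differentiableAt (by simp)
  have h (v w : E) : (dirDeriv U v (dirDeriv U w f)).1 x =
      fderiv ℝ (fderiv ℝ (extZero f.1)) x v w := by
    rw [dirDeriv_apply v _ (g := fun y => fderiv ℝ (extZero f.1) y w) (fun _ => rfl) x,
      fderiv_clm_apply h0 (by simp)]
    simp
  have hs : IsSymmSndFDerivAt ℝ (extZero f.1) x :=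
    (contDiffAt_extZero f x).isSymmSndFDerivAt (by simp; norm_cast)
  rw [h, h, hs]

end SmoothAlg

/-! ### Component representation of scalar forms on an open set -/

section Rep

open TopologicalSpace (Opens)

/-- The product is a recursion using only ring operations and signs, so it is compatible with
relabelling directions and changing coefficients. This is used for evaluation at a point, with
directions sent to basis vectors or left unchanged. -/
theorem Shuffle.map_mul_apply {ι κ R R' : Type*} [CommRing R] [Algebra ℝ R] [CommRing R']
    [Algebra ℝ R'] (f : ι → κ) (g : R →ₐ[ℝ] R') {φ ψ : Shuffle ι R} {φ' ψ' : Shuffle κ R'}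
    (h : ∀ l, g (φ l) = φ' (l.map f)) (h' : ∀ l, g (ψ l) = ψ' (l.map f)) (l : List ι) :
    g ((φ * ψ) l) = (φ' * ψ') (l.map f) := by
  induction l generalizing φ ψ φ' ψ' with
  | nil =>
    rw [mul_nil, map_mul, h, h']; rfl
  | cons a l ih =>
    rw [List.map_cons, mul_cons, mul_cons, map_add,
      ih (φ := cut a φ) (φ' := cut (f a) φ') (ψ' := ψ') (fun l => h (a :: l)) h',
      ih (φ := par φ) (ψ := cut a ψ) (φ' := par φ') (ψ' := cut (f a) ψ')
        (fun l => by simp [h]) (fun l => h' (a :: l))]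

variable {E : Type*} [NormedAddCommGroup E] [NormedSpace ℝ E] [FiniteDimensional ℝ E]

/-- Components of smooth forms on `U`. -/
abbrev Comp (U : Opens E) := Shuffle (Fin (Module.finrank ℝ E)) (SmoothAlg U)

/-- The coordinate derivations. -/
def coordD (U : Opens E) (a : Fin (Module.finrank ℝ E)) :
    Derivation ℝ (SmoothAlg U) (SmoothAlg U) := dirDeriv U (Module.finBasis ℝ E a)

theorem coordD_comm (U : Opens E) (a b : Fin (Module.finrank ℝ E)) (f : SmoothAlg U) :
    coordD U a (coordD U b f) = coordD U b (coordD U a f) := dirDeriv_comm U _ _ f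

variable {U : Opens E} {k l : ℕ}

/-- `w` consists of the components of the form `η` on `U`. -/
def Rep (η : E → E [⋀^Fin k]→L[ℝ] ℝ) (w : Comp U) : Prop :=
  ∀ (s : List (Fin (Module.finrank ℝ E))) (x : U),
    (w s).1 x = evalL (η x) (s.map (Module.finBasis ℝ E))

/-- Continuity and linearity of a single component let it pass through smoothness statements and
through `fderiv`. -/
theorem exists_clm_evalL (k : ℕ) (s : List E) :
    ∃ L : (E [⋀^Fin k]→L[ℝ] ℝ) →L[ℝ] ℝ, ∀ θ, L θ = evalL θ s := by
  induction s generalizing k with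
  | nil =>
    cases k with
    | zero => exact ⟨ContinuousAlternatingMap.apply ℝ E ℝ ![], fun _ => rfl⟩
    | succ k => exact ⟨0, fun _ => rfl⟩
  | cons v s ih =>
    cases k with
    | zero => exact ⟨0, fun _ => rfl⟩
    | succ k =>
      obtain ⟨L, hL⟩ := ih k
      exact ⟨L.comp (curryAt k v), fun θ => hL _⟩

theorem exists_rep {η : E → E [⋀^Fin k]→L[ℝ] ℝ} (h : ContDiffOn ℝ ∞ η U) :
    ∃ w : Comp U, Rep η w := by
  choose L hL using exists_clm_evalL (E := E) k
  exact ⟨fun s => ⟨fun x => evalL (η x) (s.map (Module.finBasis ℝ E)),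
    contDiffOn_extZero (g := fun x => L (s.map (Module.finBasis ℝ E)) (η x))
      (fun x => (hL _ _).symm) ((L _).contDiff.comp_contDiffOn h)⟩, fun s x => rfl⟩

theorem contDiffOn_of_evalL {η : E → E [⋀^Fin k]→L[ℝ] ℝ} {s : Set E}
    (h : ∀ l : List (Fin (Module.finrank ℝ E)),
      ContDiffOn ℝ ∞ (fun x => evalL (η x) (l.map (Module.finBasis ℝ E))) s) :
    ContDiffOn ℝ ∞ η s := by
  induction k with
  | zero =>
    have : η = fun x => ContinuousAlternatingMap.constOfIsEmptyLIE ℝ E ℝ (Fin 0)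
        (evalL (η x) []) := by
      funext x; ext v; simp [Subsingleton.elim v ![]]
    rw [this]
    exact (ContinuousAlternatingMap.constOfIsEmptyLIE ℝ E ℝ (Fin 0)).contDiff.comp_contDiffOn (h [])
  | succ k ih =>
    have h1 : ContDiffOn ℝ ∞ (fun x => (η x).curryLeft) s := by
      rw [contDiffOn_clm_apply]
      intro y
      have h2 : ∀ x, (η x).curryLeft y = ∑ a, (Module.finBasis ℝ E).repr y a •
          (η x).curryLeft (Module.finBasis ℝ E a) := fun x => by
        conv_lhs => rw [← (Module.finBasis ℝ E).sum_repr y, map_sum]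
        simp only [map_smul]
      simp only [h2]
      exact ContDiffOn.sum fun a _ => (ih fun l => h (a :: l)).const_smul _
    -- Antisymmetrizing the curried form gives `k + 1` times the form, so `η` is a continuous linear
    -- image of its curried version, which is smooth by `h1`.
    have h3 : η = fun x => ((k : ℝ) + 1)⁻¹ • ContinuousAlternatingMap.alternatizeUncurryFinCLM ℝ E ℝ
        ((η x).curryLeft) := by
      funext x
      rw [ContinuousAlternatingMap.alternatizeUncurryFinCLM_apply,
        ContinuousAlternatingMap.alternatizeUncurryFin_curryLeft, ← Nat.cast_smul_eq_nsmul ℝ,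
        smul_smul]
      push_cast
      rw [inv_mul_cancel₀ (by positivity), one_smul]
    rw [h3]
    exact ((ContinuousLinearMap.contDiff _).comp_contDiffOn h1).const_smul _

theorem Rep.contDiffOn {η : E → E [⋀^Fin k]→L[ℝ] ℝ} {w : Comp U} (h : Rep η w) :
    ContDiffOn ℝ ∞ η U :=
  contDiffOn_of_evalL fun l => (w l).2.congr fun x hx =>
    ((extZero_apply (w l).1 ⟨x, hx⟩).trans (h l ⟨x, hx⟩)).symm

theorem Rep.differentiableAt {η : E → E [⋀^Fin k]→L[ℝ] ℝ} {w : Comp U} (h : Rep η w) (x : U) :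
    DifferentiableAt ℝ η x :=
  (h.contDiffOn.contDiffAt (U.isOpen.mem_nhds x.2)).differentiableAt (by simp)

theorem Rep.unique {η : E → E [⋀^Fin k]→L[ℝ] ℝ} {w w' : Comp U} (h : Rep η w) (h' : Rep η w') :
    w = w' := by
  ext s x; exact (h s x).trans (h' s x).symm

theorem Rep.eq {η η' : E → E [⋀^Fin k]→L[ℝ] ℝ} {w : Comp U} (h : Rep η w) (h' : Rep η' w)
    (x : U) : η x = η' x :=
  evalL_injective (Module.finBasis ℝ E) fun l => (h l x).symm.trans (h' l x)

theorem Rep.hasDegree {η : E → E [⋀^Fin k]→L[ℝ] ℝ} {w : Comp U} (h : Rep η w) :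
    w.HasDegree k := fun s hs => by
  ext x
  rw [h s x]
  exact hasDegree_evalL _ _ (by simpa using hs)

theorem Rep.isAlt {η : E → E [⋀^Fin k]→L[ℝ] ℝ} {w : Comp U} (h : Rep η w) :
    w.IsAlt := fun p q a b => by
  ext x
  have := isAlt_evalL (η x) (p.map (Module.finBasis ℝ E)) (q.map (Module.finBasis ℝ E))
    (Module.finBasis ℝ E a) (Module.finBasis ℝ E b)
  have h1 := h (p ++ a :: b :: q) x
  have h2 := h (p ++ b :: a :: q) x
  simp only [List.map_append, List.map_cons] at h1 h2
  rw [h1, this, ← h2]; rfl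

theorem Rep.zero : Rep (fun _ => (0 : E [⋀^Fin k]→L[ℝ] ℝ)) (0 : Comp U) := fun _ _ =>
  (congrFun ((evalLₗ E k).map_zero) _).symm

theorem Rep.add {η η' : E → E [⋀^Fin k]→L[ℝ] ℝ} {w w' : Comp U} (h : Rep η w) (h' : Rep η' w') :
    Rep (fun x => η x + η' x) (w + w') := fun s x => by
  rw [evalL_add]; exact congrArg₂ (· + ·) (h s x) (h' s x)

theorem Rep.smul {η : E → E [⋀^Fin k]→L[ℝ] ℝ} {w : Comp U} (h : Rep η w) (r : ℝ) :
    Rep (fun x => r • η x) (r • w) := fun s x => by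
  rw [evalL_smul]; exact congrArg (r • ·) (h s x)

theorem Rep.sub {η η' : E → E [⋀^Fin k]→L[ℝ] ℝ} {w w' : Comp U} (h : Rep η w) (h' : Rep η' w') :
    Rep (fun x => η x - η' x) (w - w') := fun s x => by
  rw [evalL_sub]; exact congrArg₂ (· - ·) (h s x) (h' s x)

theorem Rep.sum {α : Type*} (t : Finset α) {η : α → E → E [⋀^Fin k]→L[ℝ] ℝ} {w : α → Comp U}
    (h : ∀ a, Rep (η a) (w a)) : Rep (fun x => ∑ a ∈ t, η a x) (∑ a ∈ t, w a) := by
  classical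
  induction t using Finset.induction_on with
  | empty => simpa using Rep.zero
  | insert a t ha ih => simp only [Finset.sum_insert ha]; exact (h a).add ih

theorem rep_degCast {k' : ℕ} (e : k = k') {η : E → E [⋀^Fin k]→L[ℝ] ℝ} {w : Comp U}
    (h : Rep η w) : Rep (fun x => degCast (fun n => E [⋀^Fin n]→L[ℝ] ℝ) e (η x)) w := by
  subst e; exact h

/-- Evaluation of smooth functions at a point. -/
def evalAt (x : U) : SmoothAlg U →ₐ[ℝ] ℝ :=
  (Pi.evalAlgHom ℝ (fun _ : U => ℝ) x).comp (SmoothAlg U).val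

theorem Rep.wedge {φ : E → E [⋀^Fin k]→L[ℝ] ℝ} {ψ : E → E [⋀^Fin l]→L[ℝ] ℝ} {w w' : Comp U}
    (h : Rep φ w) (h' : Rep ψ w') : Rep (fun x => wedge (φ x) (ψ x)) (w * w') := fun s x => by
  rw [evalL_wedge]
  exact Shuffle.map_mul_apply _ (evalAt x) (fun s => h s x) (fun s => h' s x) s

theorem Rep.ins {η : E → E [⋀^Fin (k + 1)]→L[ℝ] ℝ} {w : Comp U} (h : Rep η w)
    (a : Fin (Module.finrank ℝ E)) : Rep (fun x => ins a (η x)) (Shuffle.cut a w) :=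
  fun s x => h (a :: s) x

theorem Rep.cut_eq_zero {η : E → E [⋀^Fin 0]→L[ℝ] ℝ} {w : Comp U} (h : Rep η w)
    (a : Fin (Module.finrank ℝ E)) : Shuffle.cut a w = 0 := by
  ext s x; exact h (a :: s) x

theorem Rep.fderiv_apply {η : E → E [⋀^Fin k]→L[ℝ] ℝ} {w : Comp U} (h : Rep η w)
    (a : Fin (Module.finrank ℝ E)) (s : List (Fin (Module.finrank ℝ E))) (x : U) :
    (coordD U a (w s)).1 x =
      evalL (fderiv ℝ η x (Module.finBasis ℝ E a)) (s.map (Module.finBasis ℝ E)) := by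
  obtain ⟨L, hL⟩ := exists_clm_evalL (E := E) k (s.map (Module.finBasis ℝ E))
  rw [coordD, dirDeriv_apply _ (w s) (g := fun y => L (η y)) (fun y => (h s y).trans (hL _).symm),
    ← hL]
  have := (L.hasFDerivAt.comp (x : E) (h.differentiableAt x).hasFDerivAt).fderiv
  exact congrArg (fun f => f (Module.finBasis ℝ E a)) this

/-- Both exterior derivatives obey Cartan's formula for coordinate fields: one by definition, the
other by `curryLeft_alternatizeUncurryFin`. The remaining term `d i_a η` has lower degree, so
induction on the list applies; it is absent for functions. -/
theorem Rep.extDeriv {η : E → E [⋀^Fin k]→L[ℝ] ℝ} {w : Comp U} (h : Rep η w) :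
    Rep (extDeriv η) (Shuffle.d (coordD U) w) := by
  intro s x
  induction s generalizing k w with
  | nil => rfl
  | cons a s ih =>
    rw [Shuffle.d_cons, List.map_cons, evalL_succ_cons]
    cases k with
    | zero =>
      rw [_root_.extDeriv, curryLeft_alternatizeUncurryFin_zero, h.cut_eq_zero a, map_zero,
        Shuffle.zero_apply, sub_zero, h.fderiv_apply]
    | succ k =>
      have h1 := ih (h.ins a)
      have h2 : _root_.extDeriv (fun x => VVForm.ins a (η x)) x =
          ContinuousAlternatingMap.alternatizeUncurryFin
            ((curryAt k (Module.finBasis ℝ E a)).comp (fderiv ℝ η x)) := by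
        rw [_root_.extDeriv]
        congr 1
        exact ((curryAt k (Module.finBasis ℝ E a)).hasFDerivAt.comp (x : E)
          (h.differentiableAt x).hasFDerivAt).fderiv
      rw [_root_.extDeriv, curryLeft_alternatizeUncurryFin, ← h2, evalL_sub]
      exact congrArg₂ (· - ·) (h.fderiv_apply a s x) h1

end Rep

/-! ### Component representation of vector valued forms -/

section RepV

open TopologicalSpace (Opens)

variable {E : Type*} [NormedAddCommGroup E] [NormedSpace ℝ E] [FiniteDimensional ℝ E]
  {U : Opens E} {k l : ℕ}

/-- `coeff` as a continuous linear map. -/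
def coeffCLM (k : ℕ) (a : Fin (Module.finrank ℝ E)) :
    (E [⋀^Fin k]→L[ℝ] E) →L[ℝ] E [⋀^Fin k]→L[ℝ] ℝ :=
  ContinuousLinearMap.compContinuousAlternatingMapCLM ℝ E E ℝ (Fin k)
    (LinearMap.toContinuousLinearMap ((Module.finBasis ℝ E).coord a))

theorem coeffCLM_apply (K : E [⋀^Fin k]→L[ℝ] E) (a : Fin (Module.finrank ℝ E)) :
    coeffCLM k a K = coeff K a := rfl

theorem coeff_apply (K : E [⋀^Fin k]→L[ℝ] E) (a : Fin (Module.finrank ℝ E)) (v : Fin k → E) :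
    coeff K a v = (Module.finBasis ℝ E).repr (K v) a := rfl

theorem coeff_add (K L : E [⋀^Fin k]→L[ℝ] E) (a : Fin (Module.finrank ℝ E)) :
    coeff (K + L) a = coeff K a + coeff L a := (coeffCLM k a).map_add K L

theorem coeff_sub (K L : E [⋀^Fin k]→L[ℝ] E) (a : Fin (Module.finrank ℝ E)) :
    coeff (K - L) a = coeff K a - coeff L a := (coeffCLM k a).map_sub K L

theorem coeff_smul (r : ℝ) (K : E [⋀^Fin k]→L[ℝ] E) (a : Fin (Module.finrank ℝ E)) :
    coeff (r • K) a = r • coeff K a := (coeffCLM k a).map_smul r K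

theorem coeff_injective {K L : E [⋀^Fin k]→L[ℝ] E} (h : ∀ a, coeff K a = coeff L a) : K = L := by
  ext v
  apply (Module.finBasis ℝ E).repr.injective
  ext a
  exact congrArg (fun φ => φ v) (h a)

theorem coeff_wedge (φ : E [⋀^Fin k]→L[ℝ] ℝ) (K : E [⋀^Fin l]→L[ℝ] E)
    (a : Fin (Module.finrank ℝ E)) : coeff (wedge φ K) a = wedge φ (coeff K a) := by
  ext v
  rw [coeff_apply]
  simp only [wedge, ContinuousAlternatingMap.smul_apply,
    ContinuousMultilinearMap.alternatization_apply_apply, tensor_apply, map_smul, map_sum,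
    Finsupp.smul_apply, Finsupp.finsetSum_apply, Units.smul_def, map_zsmul]
  rfl

theorem coeff_insV (K : E [⋀^Fin k]→L[ℝ] E) (L : E [⋀^Fin (l + 1)]→L[ℝ] E)
    (a : Fin (Module.finrank ℝ E)) : coeff (insV K L) a = insV K (coeff L a) := by
  rw [insV, ← coeffCLM_apply, map_sum, insV]
  refine Finset.sum_congr rfl fun b _ => ?_
  rw [coeffCLM_apply, coeff_wedge]
  rfl

theorem coeff_extDeriv {L : E → E [⋀^Fin k]→L[ℝ] E} {y : E} (h : DifferentiableAt ℝ L y)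
    (a : Fin (Module.finrank ℝ E)) :
    coeff (extDeriv L y) a = extDeriv (fun z => coeff (L z) a) y := by
  have h1 : fderiv ℝ (fun z => coeff (L z) a) y = (coeffCLM k a).comp (fderiv ℝ L y) :=
    ((coeffCLM k a).hasFDerivAt.comp y h.hasFDerivAt).fderiv
  ext v
  rw [coeff_apply, extDeriv, extDeriv, h1, ContinuousAlternatingMap.alternatizeUncurryFin_apply,
    ContinuousAlternatingMap.alternatizeUncurryFin_apply, map_sum, Finsupp.finsetSum_apply]
  refine Finset.sum_congr rfl fun i _ => ?_
  rw [map_zsmul]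
  rfl

/-- `W` consists of the components of the vector valued form `K` on `U`. -/
def RepV (K : E → E [⋀^Fin k]→L[ℝ] E) (W : Fin (Module.finrank ℝ E) → Comp U) : Prop :=
  ∀ a, Rep (fun x => coeff (K x) a) (W a)

theorem exists_repV {K : E → E [⋀^Fin k]→L[ℝ] E} (h : ContDiffOn ℝ ∞ K U) :
    ∃ W : Fin (Module.finrank ℝ E) → Comp U, RepV K W := by
  choose W hW using fun a => exists_rep ((coeffCLM k a).contDiff.comp_contDiffOn h)
  exact ⟨W, hW⟩

theorem contDiffOn_of_coeff {K : E → E [⋀^Fin k]→L[ℝ] E} {s : Set E}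
    (h : ∀ a, ContDiffOn ℝ ∞ (fun x => coeff (K x) a) s) : ContDiffOn ℝ ∞ K s := by
  have h1 : K = fun x => ∑ a, ContinuousLinearMap.compContinuousAlternatingMapCLM ℝ E ℝ E (Fin k)
      (ContinuousLinearMap.toSpanSingleton ℝ (Module.finBasis ℝ E a)) (coeff (K x) a) := by
    funext x; ext v
    rw [ContinuousAlternatingMap.sum_apply]
    exact ((Module.finBasis ℝ E).sum_repr (K x v)).symm
  rw [h1]
  exact ContDiffOn.sum fun a _ => (ContinuousLinearMap.contDiff _).comp_contDiffOn (h a)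

theorem RepV.contDiffOn {K : E → E [⋀^Fin k]→L[ℝ] E} {W : Fin (Module.finrank ℝ E) → Comp U}
    (h : RepV K W) : ContDiffOn ℝ ∞ K U :=
  contDiffOn_of_coeff fun a => (h a).contDiffOn

theorem RepV.differentiableAt {K : E → E [⋀^Fin k]→L[ℝ] E}
    {W : Fin (Module.finrank ℝ E) → Comp U} (h : RepV K W) (x : U) : DifferentiableAt ℝ K x :=
  (h.contDiffOn.contDiffAt (U.isOpen.mem_nhds x.2)).differentiableAt (by simp)

theorem RepV.eq {K K' : E → E [⋀^Fin k]→L[ℝ] E} {W : Fin (Module.finrank ℝ E) → Comp U}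
    (h : RepV K W) (h' : RepV K' W) (x : U) : K x = K' x :=
  coeff_injective fun a => (h a).eq (h' a) x

theorem RepV.isForm {K : E → E [⋀^Fin k]→L[ℝ] E} {W : Fin (Module.finrank ℝ E) → Comp U}
    (h : RepV K W) : Shuffle.IsForm k W := ⟨fun a => (h a).isAlt, fun a => (h a).hasDegree⟩

theorem RepV.parity {K : E → E [⋀^Fin k]→L[ℝ] E} {W : Fin (Module.finrank ℝ E) → Comp U}
    (h : RepV K W) (a : Fin (Module.finrank ℝ E)) : Shuffle.HasParity k (W a) :=
  h.isForm.parity a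

theorem RepV.add {K K' : E → E [⋀^Fin k]→L[ℝ] E} {W W' : Fin (Module.finrank ℝ E) → Comp U}
    (h : RepV K W) (h' : RepV K' W') : RepV (fun x => K x + K' x) (W + W') := fun a => by
  simp only [coeff_add]; exact (h a).add (h' a)

theorem RepV.sub {K K' : E → E [⋀^Fin k]→L[ℝ] E} {W W' : Fin (Module.finrank ℝ E) → Comp U}
    (h : RepV K W) (h' : RepV K' W') : RepV (fun x => K x - K' x) (W - W') := fun a => by
  simp only [coeff_sub]; exact (h a).sub (h' a)

theorem RepV.smul {K : E → E [⋀^Fin k]→L[ℝ] E} {W : Fin (Module.finrank ℝ E) → Comp U}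
    (h : RepV K W) (r : ℝ) : RepV (fun x => r • K x) (r • W) := fun a => by
  simp only [coeff_smul]; exact (h a).smul r

theorem repV_degCast {k' : ℕ} (e : k = k') {K : E → E [⋀^Fin k]→L[ℝ] E}
    {W : Fin (Module.finrank ℝ E) → Comp U} (h : RepV K W) :
    RepV (fun x => degCast (fun n => E [⋀^Fin n]→L[ℝ] E) e (K x)) W := by
  subst e; exact h

theorem Rep.insV {K : E → E [⋀^Fin k]→L[ℝ] E} {W : Fin (Module.finrank ℝ E) → Comp U}
    (h : RepV K W) {η : E → E [⋀^Fin (l + 1)]→L[ℝ] ℝ} {w : Comp U} (hη : Rep η w) :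
    Rep (fun x => insV (K x) (η x)) (Shuffle.insK W w) := by
  rw [Shuffle.insK_apply]
  exact Rep.sum _ fun a => (h a).wedge (hη.ins a)

theorem Rep.theta {K : E → E [⋀^Fin k]→L[ℝ] E} {W : Fin (Module.finrank ℝ E) → Comp U}
    (h : RepV K W) {η : E → E [⋀^Fin l]→L[ℝ] ℝ} {w : Comp U} (hη : Rep η w) :
    Rep (thetaFlat K η) (Shuffle.lie (coordD U) k W w) := by
  rw [Shuffle.lie_apply]
  cases l with
  | zero =>
    have h0 : Shuffle.insK W w = 0 := by
      simp [Shuffle.insK_apply, hη.cut_eq_zero]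
    rw [h0, map_zero, smul_zero, add_zero (_ : Comp U)]
    exact Rep.insV h hη.extDeriv
  | succ l => exact (Rep.insV h hη.extDeriv).add ((Rep.insV h hη).extDeriv.smul _)

/-- Links the bracket, defined with `E`-valued forms, to its componentwise version. Taking a
coordinate commutes with `extDeriv` only for differentiable fields; differentiability comes from the
representations. -/
theorem coeff_thetaFlat {K : E → E [⋀^Fin k]→L[ℝ] E} {L : E → E [⋀^Fin l]→L[ℝ] E}
    {W W' : Fin (Module.finrank ℝ E) → Comp U} (h : RepV K W) (h' : RepV L W') (x : U)
    (a : Fin (Module.finrank ℝ E)) :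
    coeff (thetaFlat K L x) a = thetaFlat K (fun z => coeff (L z) a) x := by
  cases l with
  | zero =>
    simp only [thetaFlat]
    rw [coeff_insV, coeff_extDeriv (h'.differentiableAt x)]
  | succ l =>
    have h1 : RepV (fun x => insV (K x) (L x)) fun a => Shuffle.insK W (W' a) := fun a => by
      simp only [coeff_insV]
      exact Rep.insV h (h' a)
    simp only [thetaFlat]
    rw [coeff_add, coeff_smul, coeff_insV, coeff_extDeriv (h'.differentiableAt x),
      coeff_extDeriv (h1.differentiableAt x)]
    simp only [coeff_insV]

theorem Rep.congr {η η' : E → E [⋀^Fin k]→L[ℝ] ℝ} {w : Comp U} (h : Rep η w)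
    (he : ∀ x : U, η' x = η x) : Rep η' w := fun s x => by
  rw [he x]; exact h s x

theorem RepV.congr {K K' : E → E [⋀^Fin k]→L[ℝ] E} {W : Fin (Module.finrank ℝ E) → Comp U}
    (h : RepV K W) (he : ∀ x : U, K' x = K x) : RepV K' W := fun a =>
  (h a).congr fun x => by rw [he x]

theorem RepV.fnFlat {K : E → E [⋀^Fin k]→L[ℝ] E} {L : E → E [⋀^Fin l]→L[ℝ] E}
    {W W' : Fin (Module.finrank ℝ E) → Comp U} (h : RepV K W) (h' : RepV L W') :
    RepV (fnFlat K L) (Shuffle.fn (coordD U) k l W W') := by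
  have h1 : RepV (thetaFlat K L) fun a => Shuffle.lie (coordD U) k W (W' a) := fun a =>
    (Rep.theta h (h' a)).congr fun x => coeff_thetaFlat h h' x a
  have h2 : RepV (thetaFlat L K) fun a => Shuffle.lie (coordD U) l W' (W a) := fun a =>
    (Rep.theta h' (h a)).congr fun x => coeff_thetaFlat h' h x a
  exact h1.sub ((repV_degCast (Nat.add_comm l k) h2).smul _)

theorem RepV.contr {K : E → E [⋀^Fin k]→L[ℝ] E} {W : Fin (Module.finrank ℝ E) → Comp U}
    (h : RepV K W) : Rep (fun x => contr (K x)) (Shuffle.tr W) := by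
  rw [Shuffle.tr_apply]
  cases k with
  | zero =>
    simp only [(h _).cut_eq_zero, Finset.sum_const_zero]
    exact Rep.zero
  | succ k => exact Rep.sum _ fun a => (h a).ins a

theorem RepV.algS {K : E → E [⋀^Fin (k + 1)]→L[ℝ] E} {L : E → E [⋀^Fin (l + 1)]→L[ℝ] E}
    {W W' : Fin (Module.finrank ℝ E) → Comp U} (h : RepV K W) (h' : RepV L W') :
    Rep (fun x => algS (K x) (L x)) (Shuffle.S W W') :=
  Rep.sum _ fun a => Rep.sum _ fun b => ((h a).ins b).wedge ((h' b).ins a)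

theorem rep_idForm (a : Fin (Module.finrank ℝ E)) :
    Rep (fun _ => coeff (idForm E) a) (Shuffle.dx a : Comp U) := by
  intro s x
  match s with
  | [] => rw [Shuffle.dx_nil]; rfl
  | [b] =>
    have h1 : evalL (coeff (idForm E) a) [Module.finBasis ℝ E b] =
        (Module.finBasis ℝ E).repr (Module.finBasis ℝ E b) a := rfl
    rw [List.map_cons, List.map_nil, h1, Module.Basis.repr_self, Finsupp.single_apply, Shuffle.dx]
    by_cases hab : b = a <;> simp [hab]
  | b :: c :: s =>
    have h1 : (Shuffle.dx a : Comp U) (b :: c :: s) = 0 := if_neg (by simp)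
    rw [h1]; rfl

theorem Rep.wedgeI {φ : E → E [⋀^Fin k]→L[ℝ] ℝ} {w : Comp U} (h : Rep φ w) :
    RepV (fun x => VVForm.wedge (φ x) (idForm E)) (Shuffle.wedgeI w) := fun a => by
  simp only [coeff_wedge]
  exact h.wedge (rep_idForm a)

end RepV

/-! ### The model space as a manifold whose only chart is the identity -/

section Model

variable {E : Type*} [NormedAddCommGroup E] [NormedSpace ℝ E]

theorem tmap_model (f : E → E) (x : E) : tmap f x = fderiv ℝ f x := mfderiv_eq_fderiv

theorem pullS_id {k : ℕ} (η : SField E E k) : pullS id η = η := by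
  funext x; ext v; simp [pullS, tmap_model]

theorem pullV_id {k : ℕ} (K : VField E E k) : pullV id K = K := by
  funext x; ext v; simp [pullV, tmap_model]

theorem extd_model {k : ℕ} (η : SField E E k) : extd η = extDeriv η := by
  funext x
  change pullS id (extDeriv (pullS id η)) x = _
  rw [pullS_id, pullS_id]

variable [FiniteDimensional ℝ E]

theorem fnBracket_model {k l : ℕ} (K : VField E E k) (L : VField E E l) :
    fnBracket K L = fnFlat K L := by
  funext x
  change pullV id (fnFlat (pullV id K) (pullV id L)) x = _
  rw [pullV_id, pullV_id, pullV_id]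

open TopologicalSpace (Opens)

variable {U : Opens E} {k l : ℕ}

theorem dSWedgeId_succ {M : Type*} [TopologicalSpace M] [ChartedSpace E M]
    (K : VField E M (k + 1)) (L : VField E M (l + 1)) (x : M) :
    dSWedgeId K L x = degCast (fun n => E [⋀^Fin n]→L[ℝ] E)
      (by omega : k + l + 1 + 1 = k + 1 + (l + 1))
      (wedge (extd (fun z => algS (K z) (L z)) x) (idForm E)) := by
  have h : ∀ {n n' : ℕ} (e : n = n') (V : VField E M n),
      degCast (VField E M) e V x = degCast (fun n => E [⋀^Fin n]→L[ℝ] E) e (V x) := by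
    intro n n' e V; subst e; rfl
  exact h _ _

theorem RepV.dSWedgeId {K : E → E [⋀^Fin k]→L[ℝ] E} {L : E → E [⋀^Fin l]→L[ℝ] E}
    {W W' : Fin (Module.finrank ℝ E) → Comp U} (h : RepV K W) (h' : RepV L W') :
    RepV (dSWedgeId (M := E) K L) (Shuffle.wedgeI (Shuffle.d (coordD U) (Shuffle.S W W'))) := by
  cases k with
  | zero =>
    have h0 : Shuffle.S W W' = 0 := by simp [Shuffle.S, (h _).cut_eq_zero]
    rw [h0, map_zero, map_zero]
    intro a
    exact Rep.zero.congr fun x => (coeffCLM _ a).map_zero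
  | succ k =>
    cases l with
    | zero =>
      have h0 : Shuffle.S W W' = 0 := by simp [Shuffle.S, (h' _).cut_eq_zero]
      rw [h0, map_zero, map_zero]
      intro a
      exact Rep.zero.congr fun x => (coeffCLM _ a).map_zero
    | succ l =>
      refine (repV_degCast (by omega : k + l + 1 + 1 = k + 1 + (l + 1))
        (Rep.wedgeI (RepV.algS h h').extDeriv)).congr fun x => ?_
      rw [dSWedgeId_succ, extd_model]

theorem RepV.cBracket {K : E → E [⋀^Fin k]→L[ℝ] E} {L : E → E [⋀^Fin l]→L[ℝ] E}
    {W W' : Fin (Module.finrank ℝ E) → Comp U} (h : RepV K W) (h' : RepV L W') :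
    RepV (cBracket (M := E) K L) (Shuffle.cb (coordD U) k l W W') := by
  have := (h.fnFlat h').sub ((RepV.dSWedgeId h h').smul
    ((-1 : ℝ) ^ l / ((Module.finrank ℝ E : ℝ) - k - l + 1)))
  rw [VVForm.cBracket, Shuffle.cb, fnBracket_model, Fintype.card_fin]
  exact this

end Model

/-! ### Naturality under linear isomorphisms -/

section LinearNaturality

variable {E F : Type*} [NormedAddCommGroup E] [NormedSpace ℝ E]
  [NormedAddCommGroup F] [NormedSpace ℝ F] {k l : ℕ}

theorem wedge_apply (φ : E [⋀^Fin k]→L[ℝ] ℝ) (ψ : E [⋀^Fin l]→L[ℝ] F) (v : Fin (k + l) → E) :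
    wedge φ ψ v = ((k.factorial : ℝ) * (l.factorial : ℝ))⁻¹ • ∑ σ : Equiv.Perm (Fin (k + l)),
      Equiv.Perm.sign σ • (φ (fun i => v (σ (Fin.castAdd l i))) •
        ψ (fun i => v (σ (Fin.natAdd k i)))) := by
  simp only [wedge, ContinuousAlternatingMap.smul_apply,
    ContinuousMultilinearMap.alternatization_apply_apply, tensor_apply, Function.comp_apply]

/-- The exterior product as a bilinear map. -/
def wedgeₗ : (E [⋀^Fin k]→L[ℝ] ℝ) →ₗ[ℝ] (E [⋀^Fin l]→L[ℝ] F) →ₗ[ℝ] E [⋀^Fin (k + l)]→L[ℝ] F :=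
  LinearMap.mk₂ ℝ wedge
    (fun φ φ' ψ => by ext v; simp [wedge_apply, add_smul, Finset.sum_add_distrib])
    (fun r φ ψ => by
      ext v
      simp only [wedge_apply, ContinuousAlternatingMap.smul_apply, smul_assoc,
        smul_comm _ r, ← Finset.smul_sum])
    (fun φ ψ ψ' => by ext v; simp [wedge_apply, smul_add, Finset.sum_add_distrib])
    (fun r φ ψ => by
      ext v
      simp only [wedge_apply, ContinuousAlternatingMap.smul_apply,
        smul_comm _ r, ← Finset.smul_sum])

theorem wedge_comp (φ : E [⋀^Fin k]→L[ℝ] ℝ) (ψ : E [⋀^Fin l]→L[ℝ] F) (A : E →L[ℝ] E) :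
    wedge (φ.compContinuousLinearMap A) (ψ.compContinuousLinearMap A) =
      (wedge φ ψ).compContinuousLinearMap A := by
  ext v
  rw [ContinuousAlternatingMap.compContinuousLinearMap_apply, wedge_apply, wedge_apply]
  rfl

theorem clm_wedge {G : Type*} [NormedAddCommGroup G] [NormedSpace ℝ G] (B : F →L[ℝ] G)
    (φ : E [⋀^Fin k]→L[ℝ] ℝ) (ψ : E [⋀^Fin l]→L[ℝ] F) :
    B.compContinuousAlternatingMap (wedge φ ψ) = wedge φ (B.compContinuousAlternatingMap ψ) := by
  ext v
  rw [ContinuousLinearMap.compContinuousAlternatingMap_coe, Function.comp_apply, wedge_apply,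
    wedge_apply]
  simp only [map_smul, map_sum, Units.smul_def, map_zsmul]
  rfl

/-- Pointwise pullback of vector valued alternating maps. -/
def pullPt (A : E →L[ℝ] E) (K : E [⋀^Fin k]→L[ℝ] E) : E [⋀^Fin k]→L[ℝ] E :=
  A.inverse.compContinuousAlternatingMap (K.compContinuousLinearMap A)

theorem wedge_pullPt (φ : E [⋀^Fin k]→L[ℝ] ℝ) (K : E [⋀^Fin l]→L[ℝ] E) (A : E →L[ℝ] E) :
    wedge (φ.compContinuousLinearMap A) (pullPt A K) = pullPt A (wedge φ K) := by
  rw [pullPt, pullPt, ← wedge_comp, clm_wedge]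

theorem pullPt_idForm {A : E →L[ℝ] E} (hA : A.IsInvertible) : pullPt A (idForm E) = idForm E := by
  obtain ⟨e, rfl⟩ := hA
  ext v
  simp [pullPt, idForm, ContinuousLinearMap.inverse_equiv]

theorem pullPt_sub (A : E →L[ℝ] E) (K L : E [⋀^Fin k]→L[ℝ] E) :
    pullPt A (K - L) = pullPt A K - pullPt A L := by
  ext v; simp [pullPt]

theorem pullPt_smul (A : E →L[ℝ] E) (r : ℝ) (K : E [⋀^Fin k]→L[ℝ] E) :
    pullPt A (r • K) = r • pullPt A K := by
  ext v; simp [pullPt]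

theorem pullPt_degCast (A : E →L[ℝ] E) {k' : ℕ} (h : k = k') (K : E [⋀^Fin k]→L[ℝ] E) :
    pullPt A (degCast (fun n => E [⋀^Fin n]→L[ℝ] E) h K) =
      degCast (fun n => E [⋀^Fin n]→L[ℝ] E) h (pullPt A K) := by
  subst h; rfl

theorem comp_degCast (A : E →L[ℝ] E) {k' : ℕ} (h : k = k') (η : E [⋀^Fin k]→L[ℝ] ℝ) :
    (degCast (fun n => E [⋀^Fin n]→L[ℝ] ℝ) h η).compContinuousLinearMap A =
      degCast (fun n => E [⋀^Fin n]→L[ℝ] ℝ) h (η.compContinuousLinearMap A) := by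
  subst h; rfl

theorem degCast_injective {V : ℕ → Type*} {k' : ℕ} (h : k = k') {v w : V k}
    (hvw : degCast V h v = degCast V h w) : v = w := by
  subst h; exact hvw

variable [FiniteDimensional ℝ E]

/-- The coordinate functionals. -/
def coordL (a : Fin (Module.finrank ℝ E)) : E →L[ℝ] ℝ :=
  LinearMap.toContinuousLinearMap ((Module.finBasis ℝ E).coord a)

/-- A contraction of a bilinear expression does not depend on the basis. -/
theorem sum_contraction {G : Type*} [AddCommGroup G] [Module ℝ G]
    (B : (E →L[ℝ] ℝ) →ₗ[ℝ] E →ₗ[ℝ] G) (e : E ≃L[ℝ] E) :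
    ∑ a, B ((coordL a).comp (e.symm : E →L[ℝ] E)) (e (Module.finBasis ℝ E a)) =
      ∑ a, B (coordL a) (Module.finBasis ℝ E a) := by
  have h1 (v : E) : v = ∑ c, coordL c v • Module.finBasis ℝ E c :=
    ((Module.finBasis ℝ E).sum_repr v).symm
  have h2 (a : Fin (Module.finrank ℝ E)) :
      B ((coordL a).comp (e.symm : E →L[ℝ] E)) (e (Module.finBasis ℝ E a)) =
      ∑ c, coordL c (e (Module.finBasis ℝ E a)) •
        B ((coordL a).comp (e.symm : E →L[ℝ] E)) (Module.finBasis ℝ E c) := by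
    conv_lhs => rw [h1 (e (Module.finBasis ℝ E a))]
    simp
  -- The `c`-th coordinate functional expanded in the dual basis of the transported basis `e (∂_a)`.
  have h3 (c : Fin (Module.finrank ℝ E)) :
      ∑ a, coordL c (e (Module.finBasis ℝ E a)) • (coordL a).comp (e.symm : E →L[ℝ] E) =
        coordL c := by
    ext v
    have := congrArg (fun w => coordL c (e w)) (h1 (e.symm v))
    simp only [map_sum, map_smul, ContinuousLinearEquiv.apply_symm_apply] at this
    rw [this]
    simp [mul_comm]
  simp only [h2]
  rw [Finset.sum_comm]
  refine Finset.sum_congr rfl fun c _ => ?_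
  conv_rhs => rw [← h3 c, map_sum, LinearMap.sum_apply]
  simp only [map_smul, LinearMap.smul_apply]

theorem coeff_pullPt (e : E ≃L[ℝ] E) (K : E [⋀^Fin k]→L[ℝ] E) (a : Fin (Module.finrank ℝ E)) :
    coeff (pullPt (e : E →L[ℝ] E) K) a =
      (((coordL a).comp (e.symm : E →L[ℝ] E)).compContinuousAlternatingMap
        K).compContinuousLinearMap (e : E →L[ℝ] E) := by
  rw [pullPt, ContinuousLinearMap.inverse_equiv]; rfl

theorem ins_comp {G : Type*} [NormedAddCommGroup G] [NormedSpace ℝ G]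
    (e : E ≃L[ℝ] E) (η : E [⋀^Fin (l + 1)]→L[ℝ] G) (a : Fin (Module.finrank ℝ E)) :
    ins a (η.compContinuousLinearMap (e : E →L[ℝ] E)) =
      (η.curryLeft (e (Module.finBasis ℝ E a))).compContinuousLinearMap (e : E →L[ℝ] E) := by
  rw [ins, ContinuousAlternatingMap.curryLeft_compContinuousLinearMap]; rfl

/-- `ξ ↦ ξ ∘ K` as a linear map. -/
def functionalComp (K : E [⋀^Fin k]→L[ℝ] E) : (E →L[ℝ] ℝ) →ₗ[ℝ] E [⋀^Fin k]→L[ℝ] ℝ where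
  toFun ξ := ξ.compContinuousAlternatingMap K
  map_add' _ _ := rfl
  map_smul' _ _ := rfl

/-- `v ↦ i_v η` as a linear map. -/
def insₗ (η : E [⋀^Fin (k + 1)]→L[ℝ] F) : E →ₗ[ℝ] E [⋀^Fin k]→L[ℝ] F := η.curryLeft.toLinearMap

/-- `(ξ, v) ↦ i_v (ξ ∘ K)` as a bilinear map. -/
def contrₗ (K : E [⋀^Fin (k + 1)]→L[ℝ] E) : (E →L[ℝ] ℝ) →ₗ[ℝ] E →ₗ[ℝ] E [⋀^Fin k]→L[ℝ] ℝ :=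
  LinearMap.mk₂ ℝ (fun ξ v => (ξ.compContinuousAlternatingMap K).curryLeft v)
    (fun _ _ _ => rfl) (fun _ _ _ => rfl) (fun _ _ _ => map_add _ _ _) (fun _ _ _ => map_smul _ _ _)

theorem sum_comp {α : Type*} (s : Finset α) (f : α → E [⋀^Fin k]→L[ℝ] F) (A : E →L[ℝ] E) :
    (∑ a ∈ s, f a).compContinuousLinearMap A = ∑ a ∈ s, (f a).compContinuousLinearMap A :=
  map_sum (ContinuousAlternatingMap.compContinuousLinearMapₗ (R := ℝ) (N := F) (ι := Fin k) A) f s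

/-- Pulling back replaces the basis by `e (∂_a)` and the coordinates by their composites with `e⁻¹`,
again a pair of dual bases; `sum_contraction` says that the contraction does not see this. -/
theorem insV_pullPt {A : E →L[ℝ] E} (hA : A.IsInvertible) (K : E [⋀^Fin k]→L[ℝ] E)
    (η : E [⋀^Fin (l + 1)]→L[ℝ] ℝ) :
    insV (pullPt A K) (η.compContinuousLinearMap A) = (insV K η).compContinuousLinearMap A := by
  obtain ⟨e, rfl⟩ := hA
  have h := sum_contraction ((wedgeₗ.compl₂ (insₗ η)).comp (functionalComp K)) e
  simp only [insV, coeff_pullPt, ins_comp, wedge_comp, ← sum_comp]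
  exact congrArg (fun θ => θ.compContinuousLinearMap (e : E →L[ℝ] E)) h

theorem contr_pullPt {A : E →L[ℝ] E} (hA : A.IsInvertible) (K : E [⋀^Fin k]→L[ℝ] E) :
    contr (pullPt A K) = (contr K).compContinuousLinearMap A := by
  cases k with
  | zero => simp only [contr]; rfl
  | succ k =>
    obtain ⟨e, rfl⟩ := hA
    have h := sum_contraction (contrₗ K) e
    simp only [contr, coeff_pullPt, ins_comp, ← sum_comp]
    exact congrArg (fun θ => θ.compContinuousLinearMap (e : E →L[ℝ] E)) h

theorem algS_pullPt {A : E →L[ℝ] E} (hA : A.IsInvertible) (K : E [⋀^Fin (k + 1)]→L[ℝ] E)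
    (L : E [⋀^Fin (l + 1)]→L[ℝ] E) :
    algS (pullPt A K) (pullPt A L) = (algS K L).compContinuousLinearMap A := by
  obtain ⟨e, rfl⟩ := hA
  simp only [algS, coeff_pullPt, ins_comp, wedge_comp, ← sum_comp]
  congr 1
  -- `S` contracts twice: the transported basis is removed in the index `a` with `b` fixed, then in
  -- `b`.
  have h1 (b : Fin (Module.finrank ℝ E)) := sum_contraction
    ((wedgeₗ.compl₂ (contrₗ L ((coordL b).comp (e.symm : E →L[ℝ] E)))).comp
      ((contrₗ K).flip (e (Module.finBasis ℝ E b)))) e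
  have h2 (a : Fin (Module.finrank ℝ E)) := sum_contraction
    ((wedgeₗ.flip.comp ((contrₗ L).flip (Module.finBasis ℝ E a))).compl₂
      (contrₗ K (coordL a))) e
  rw [Finset.sum_comm]
  refine (Finset.sum_congr rfl fun b _ => h1 b).trans ?_
  rw [Finset.sum_comm]
  exact Finset.sum_congr rfl fun a _ => h2 a

end LinearNaturality

/-! ### Naturality of the operators on a vector space -/

section FlatNaturality

open TopologicalSpace (Opens)

variable {E : Type*} [NormedAddCommGroup E] [NormedSpace ℝ E] [FiniteDimensional ℝ E]
  {U V : Opens E} {k l : ℕ}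

theorem contDiffOn_comp {η : E → E [⋀^Fin k]→L[ℝ] ℝ} {A : E → E →L[ℝ] E} {s : Set E}
    (hη : ContDiffOn ℝ ∞ η s) (hA : ContDiffOn ℝ ∞ A s) :
    ContDiffOn ℝ ∞ (fun x => (η x).compContinuousLinearMap (A x)) s := by
  refine contDiffOn_of_evalL fun t => ?_
  generalize t.map (Module.finBasis ℝ E) = t'
  induction t' generalizing k with
  | nil =>
    obtain ⟨L, hL⟩ := exists_clm_evalL (E := E) k []
    have h : ∀ x, evalL ((η x).compContinuousLinearMap (A x)) [] = L (η x) := fun x => by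
      rw [hL]
      cases k with
      | zero => simp [Subsingleton.elim (A x ∘ ![]) ![]]
      | succ k => rfl
    simp only [h]
    exact L.contDiff.comp_contDiffOn hη
  | cons v t ih =>
    cases k with
    | zero => exact contDiffOn_const
    | succ k =>
      simp only [evalL_succ_cons, ContinuousAlternatingMap.curryLeft_compContinuousLinearMap]
      refine ih ?_
      have h1 : ContDiffOn ℝ ∞ (fun x => (η x).curryLeft) s :=
        contDiffOn_clm_apply.2 fun y => (curryAt k y).contDiff.comp_contDiffOn hη
      exact h1.clm_apply (hA.clm_apply contDiffOn_const)

theorem contDiffOn_pullPt {K : E → E [⋀^Fin k]→L[ℝ] E} {A : E → E →L[ℝ] E} {s : Set E}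
    (hK : ContDiffOn ℝ ∞ K s) (hA : ContDiffOn ℝ ∞ A s) (hinv : ∀ x ∈ s, (A x).IsInvertible) :
    ContDiffOn ℝ ∞ (fun x => pullPt (A x) (K x)) s := by
  have h0 : ContDiffOn ℝ ∞ (fun x => (A x).inverse) s := fun x hx =>
    ((hinv x hx).contDiffAt_map_inverse).comp_contDiffWithinAt x (hA x hx)
  refine contDiffOn_of_coeff fun a => ?_
  have h1 : ∀ x, coeff (pullPt (A x) (K x)) a = ∑ b, coordL a ((A x).inverse
      (Module.finBasis ℝ E b)) • (coeff (K x) b).compContinuousLinearMap (A x) := fun x => by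
    ext v
    have h2 : coeff (pullPt (A x) (K x)) a v = coordL a ((A x).inverse (K x (A x ∘ v))) := rfl
    rw [h2, ← (Module.finBasis ℝ E).sum_repr (K x (A x ∘ v)), map_sum, map_sum,
      ContinuousAlternatingMap.sum_apply]
    refine Finset.sum_congr rfl fun b _ => ?_
    rw [map_smul, map_smul, smul_eq_mul, mul_comm]
    rfl
  simp only [h1]
  exact ContDiffOn.sum fun b _ => ((coordL a).contDiff.comp_contDiffOn
    (h0.clm_apply contDiffOn_const)).smul
      (contDiffOn_comp ((coeffCLM k b).contDiff.comp_contDiffOn hK) hA)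

theorem pullV_model (φ : E → E) (K : VField E E k) (x : E) :
    pullV φ K x = pullPt (fderiv ℝ φ x) (K (φ x)) := by
  rw [← tmap_model]; rfl

theorem pullS_model (φ : E → E) (η : SField E E k) :
    pullS φ η = fun x => (η (φ x)).compContinuousLinearMap (fderiv ℝ φ x) := by
  funext x; rw [← tmap_model]; rfl

/-- `φ` restricts to a smooth map `U → V` with invertible differentials. -/
structure IsEtale (φ : E → E) (U V : Opens E) : Prop where
  smooth : ContDiffOn ℝ ∞ φ U
  mapsTo : ∀ x ∈ U, φ x ∈ V
  inv : ∀ x ∈ U, (fderiv ℝ φ x).IsInvertible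

variable {φ : E → E}

namespace IsEtale

theorem contDiffOn_fderiv (hφ : IsEtale φ U V) : ContDiffOn ℝ ∞ (fderiv ℝ φ) U :=
  hφ.smooth.fderiv_of_isOpen U.isOpen (by simp)

theorem contDiffOn_pullS (hφ : IsEtale φ U V) {η : E → E [⋀^Fin k]→L[ℝ] ℝ}
    (hη : ContDiffOn ℝ ∞ η V) : ContDiffOn ℝ ∞ (pullS φ η) U := by
  rw [pullS_model]
  exact contDiffOn_comp (hη.comp hφ.smooth hφ.mapsTo) hφ.contDiffOn_fderiv

theorem contDiffOn_pullV (hφ : IsEtale φ U V) {K : E → E [⋀^Fin k]→L[ℝ] E}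
    (hK : ContDiffOn ℝ ∞ K V) : ContDiffOn ℝ ∞ (pullV φ K) U :=
  (contDiffOn_pullPt (hK.comp hφ.smooth hφ.mapsTo) hφ.contDiffOn_fderiv hφ.inv).congr
    fun x _ => pullV_model φ K x

theorem extDeriv_pullS (hφ : IsEtale φ U V) {η : E → E [⋀^Fin k]→L[ℝ] ℝ}
    (hη : ContDiffOn ℝ ∞ η V) {x : E} (hx : x ∈ U) :
    extDeriv (pullS φ η) x = pullS φ (extDeriv η) x := by
  have h1 : DifferentiableAt ℝ η (φ x) :=
    (hη.contDiffAt (V.isOpen.mem_nhds (hφ.mapsTo x hx))).differentiableAt (by simp)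
  rw [pullS_model, pullS_model, extDeriv_pullback h1 (hφ.smooth.contDiffAt (U.isOpen.mem_nhds hx))]
  rw [minSmoothness_of_isRCLikeNormedField]
  exact WithTop.coe_le_coe.2 (le_top : (2 : ℕ∞) ≤ ⊤)

end IsEtale

/-- The insertion of `K` into a constant `1`-form `ξ` is `ξ ∘ K`. -/
theorem insV_ofSubsingleton (K : E [⋀^Fin k]→L[ℝ] E) (ξ : E →L[ℝ] ℝ) :
    insV K (ContinuousAlternatingMap.ofSubsingleton ℝ E ℝ (0 : Fin 1) ξ) =
      ξ.compContinuousAlternatingMap K := by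
  have h1 (φ : E [⋀^Fin k]→L[ℝ] ℝ) (ψ : E [⋀^Fin 0]→L[ℝ] ℝ) : wedge φ ψ = ψ ![] • φ := by
    have h2 : evalL ψ = ψ ![] • 1 := by
      ext t
      cases t with
      | nil => simp [Shuffle.one_nil]
      | cons v t =>
        have h3 : (1 : Shuffle E ℝ) (v :: t) = 0 := if_neg (by simp)
        simp [h3]
    refine evalL_injective (Module.finBasis ℝ E) fun t => ?_
    have := evalL_wedge φ ψ
    rw [h2, mul_smul_comm, mul_one] at this
    rw [evalL_smul]
    exact congrFun this _
  rw [insV]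
  simp only [h1]
  ext v
  rw [ContinuousAlternatingMap.sum_apply]
  have h3 : ξ (K v) = ∑ a, (Module.finBasis ℝ E).repr (K v) a • ξ (Module.finBasis ℝ E a) := by
    conv_lhs => rw [← (Module.finBasis ℝ E).sum_repr (K v), map_sum]
    simp
  change _ = ξ (K v)
  rw [h3]
  refine Finset.sum_congr rfl fun a _ => ?_
  rw [smul_eq_mul, mul_comm]
  rfl

theorem extDeriv_congr_on {η η' : E → E [⋀^Fin k]→L[ℝ] ℝ} (h : ∀ x ∈ U, η x = η' x) {x : E}
    (hx : x ∈ U) : extDeriv η x = extDeriv η' x :=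
  Filter.EventuallyEq.extDeriv_eq (Filter.eventually_of_mem (U.isOpen.mem_nhds hx) h)

theorem thetaFlat_congr_on {K K' : E → E [⋀^Fin k]→L[ℝ] E} {η η' : E → E [⋀^Fin l]→L[ℝ] ℝ}
    (hK : ∀ x ∈ U, K x = K' x) (h : ∀ x ∈ U, η x = η' x) {x : E} (hx : x ∈ U) :
    thetaFlat K η x = thetaFlat K' η' x := by
  cases l with
  | zero => simp only [thetaFlat]; rw [hK x hx, extDeriv_congr_on h hx]
  | succ l =>
    have h1 : ∀ z ∈ U, insV (K z) (η z) = insV (K' z) (η' z) := fun z hz => by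
      rw [hK z hz, h z hz]
    simp only [thetaFlat]
    rw [hK x hx, extDeriv_congr_on h hx, extDeriv_congr_on h1 hx]

theorem contDiffOn_insV {K : E → E [⋀^Fin k]→L[ℝ] E} {η : E → E [⋀^Fin (l + 1)]→L[ℝ] ℝ}
    (hK : ContDiffOn ℝ ∞ K U) (hη : ContDiffOn ℝ ∞ η U) :
    ContDiffOn ℝ ∞ (fun x => insV (K x) (η x)) U := by
  obtain ⟨W, hW⟩ := exists_repV hK
  obtain ⟨w, hw⟩ := exists_rep hη
  exact (Rep.insV hW hw).contDiffOn

theorem contDiffOn_thetaFlat {K : E → E [⋀^Fin k]→L[ℝ] E} {η : E → E [⋀^Fin l]→L[ℝ] ℝ}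
    (hK : ContDiffOn ℝ ∞ K U) (hη : ContDiffOn ℝ ∞ η U) : ContDiffOn ℝ ∞ (thetaFlat K η) U := by
  obtain ⟨W, hW⟩ := exists_repV hK
  obtain ⟨w, hw⟩ := exists_rep hη
  exact (Rep.theta hW hw).contDiffOn

theorem contDiffOn_fnFlat {K : E → E [⋀^Fin k]→L[ℝ] E} {L : E → E [⋀^Fin l]→L[ℝ] E}
    (hK : ContDiffOn ℝ ∞ K U) (hL : ContDiffOn ℝ ∞ L U) : ContDiffOn ℝ ∞ (fnFlat K L) U := by
  obtain ⟨W, hW⟩ := exists_repV hK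
  obtain ⟨W', hW'⟩ := exists_repV hL
  exact (hW.fnFlat hW').contDiffOn

/-- `Θ([K, L]) = Θ(K) Θ(L) - (-1)^(kl) Θ(L) Θ(K)` on a vector space. -/
theorem thetaFlat_fnFlat {p : ℕ} {K : E → E [⋀^Fin k]→L[ℝ] E} {L : E → E [⋀^Fin l]→L[ℝ] E}
    {η : E → E [⋀^Fin p]→L[ℝ] ℝ} (hK : ContDiffOn ℝ ∞ K U) (hL : ContDiffOn ℝ ∞ L U)
    (hη : ContDiffOn ℝ ∞ η U) {x : E} (hx : x ∈ U) :
    degCast (fun n => E [⋀^Fin n]→L[ℝ] ℝ) (Nat.add_assoc k l p) (thetaFlat (fnFlat K L) η x) =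
      thetaFlat K (thetaFlat L η) x - (-1 : ℝ) ^ (k * l) •
        degCast (fun n => E [⋀^Fin n]→L[ℝ] ℝ) (Nat.add_left_comm l k p)
          (thetaFlat L (thetaFlat K η) x) := by
  obtain ⟨W, hW⟩ := exists_repV hK
  obtain ⟨W', hW'⟩ := exists_repV hL
  obtain ⟨w, hw⟩ := exists_rep hη
  have h1 := rep_degCast (Nat.add_assoc k l p) (Rep.theta (hW.fnFlat hW') hw)
  have h2 := (Rep.theta hW (Rep.theta hW' hw)).sub
    ((rep_degCast (Nat.add_left_comm l k p) (Rep.theta hW' (Rep.theta hW hw))).smul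
      ((-1 : ℝ) ^ (k * l)))
  rw [Shuffle.lie_fn (coordD_comm U) hW.parity hW'.parity hw.isAlt] at h1
  exact h1.eq h2 ⟨x, hx⟩

namespace IsEtale

theorem insV_pull (hφ : IsEtale φ U V) (K : E → E [⋀^Fin k]→L[ℝ] E)
    (η : E → E [⋀^Fin (l + 1)]→L[ℝ] ℝ) {x : E} (hx : x ∈ U) :
    insV (pullV φ K x) (pullS φ η x) = pullS φ (fun z => insV (K z) (η z)) x := by
  rw [pullV_model, pullS_model, pullS_model, insV_pullPt (hφ.inv x hx)]

theorem thetaFlat_pull (hφ : IsEtale φ U V) {K : E → E [⋀^Fin k]→L[ℝ] E}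
    {η : E → E [⋀^Fin l]→L[ℝ] ℝ} (hK : ContDiffOn ℝ ∞ K V) (hη : ContDiffOn ℝ ∞ η V)
    {x : E} (hx : x ∈ U) :
    thetaFlat (pullV φ K) (pullS φ η) x = pullS φ (thetaFlat K η) x := by
  cases l with
  | zero =>
    simp only [thetaFlat]
    rw [hφ.extDeriv_pullS hη hx, hφ.insV_pull K _ hx]
  | succ l =>
    simp only [thetaFlat]
    rw [hφ.extDeriv_pullS hη hx, hφ.insV_pull K _ hx,
      extDeriv_congr_on (fun z hz => hφ.insV_pull K η hz) hx,
      hφ.extDeriv_pullS (contDiffOn_insV hK hη) hx]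
    rfl

/-- No chain rule is applied to the coordinate formula. Testing on functions `h`, where `Θ(K) h =
i_K dh`, suffices: `Θ` commutes with pullback, and `Θ([K, L])` is a commutator of such operators. -/
theorem fnFlat_pull (hφ : IsEtale φ U V) {K : E → E [⋀^Fin k]→L[ℝ] E}
    {L : E → E [⋀^Fin l]→L[ℝ] E} (hK : ContDiffOn ℝ ∞ K V) (hL : ContDiffOn ℝ ∞ L V)
    {x : E} (hx : x ∈ U) :
    fnFlat (pullV φ K) (pullV φ L) x = pullV φ (fnFlat K L) x := by
  have key (ξ : E →L[ℝ] ℝ) : (ξ.comp (fderiv ℝ φ x)).compContinuousAlternatingMap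
      (fnFlat (pullV φ K) (pullV φ L) x) =
        (ξ.comp (fderiv ℝ φ x)).compContinuousAlternatingMap (pullV φ (fnFlat K L) x) := by
    -- The linear function `ξ` as a `0`-form; the differential of its pullback at `x` is `ξ ∘ dφ_x`.
    let h : E → E [⋀^Fin 0]→L[ℝ] ℝ := fun y =>
      ContinuousAlternatingMap.constOfIsEmpty ℝ E (Fin 0) (ξ y)
    have hh : ContDiffOn ℝ ∞ h V :=
      (ContinuousAlternatingMap.constOfIsEmptyLIE ℝ E ℝ (Fin 0)).contDiff.comp_contDiffOn
        ξ.contDiff.contDiffOn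
    have hd : extDeriv (pullS φ h) x =
        ContinuousAlternatingMap.ofSubsingleton ℝ E ℝ (0 : Fin 1) (ξ.comp (fderiv ℝ φ x)) := by
      rw [hφ.extDeriv_pullS hh hx, pullS_model]
      have : extDeriv h (φ x) = ContinuousAlternatingMap.ofSubsingleton ℝ E ℝ (0 : Fin 1) ξ := by
        rw [extDeriv_constOfIsEmpty, ξ.fderiv]
      simp only [this]
      rfl
    rw [← insV_ofSubsingleton, ← insV_ofSubsingleton, ← hd]
    change thetaFlat (fnFlat (pullV φ K) (pullV φ L)) (pullS φ h) x =
      thetaFlat (pullV φ (fnFlat K L)) (pullS φ h) x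
    rw [hφ.thetaFlat_pull (contDiffOn_fnFlat hK hL) hh hx]
    refine degCast_injective (V := fun n => E [⋀^Fin n]→L[ℝ] ℝ) (Nat.add_assoc k l 0) ?_
    rw [thetaFlat_fnFlat (hφ.contDiffOn_pullV hK) (hφ.contDiffOn_pullV hL)
      (hφ.contDiffOn_pullS hh) hx,
      thetaFlat_congr_on (fun _ _ => rfl) (fun z hz => hφ.thetaFlat_pull hL hh hz) hx,
      thetaFlat_congr_on (K := pullV φ L) (fun _ _ => rfl)
        (fun z hz => hφ.thetaFlat_pull hK hh hz) hx,
      hφ.thetaFlat_pull hK (contDiffOn_thetaFlat hL hh) hx,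
      hφ.thetaFlat_pull hL (contDiffOn_thetaFlat hK hh) hx]
    simp only [pullS_model, ← comp_degCast]
    rw [thetaFlat_fnFlat hK hL hh (hφ.mapsTo x hx)]
    rfl
  obtain ⟨e, he⟩ := hφ.inv x hx
  refine coeff_injective fun a => ?_
  -- As `dφ_x` is invertible, every covector has the form `ξ ∘ dφ_x`; this `ξ` produces the
  -- coordinate functional.
  have := key ((coordL a).comp (e.symm : E →L[ℝ] E))
  rw [← he] at this
  have h2 : ((coordL a).comp (e.symm : E →L[ℝ] E)).comp (e : E →L[ℝ] E) = coordL a := by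
    ext v; simp
  rw [h2] at this
  exact this

end IsEtale

end FlatNaturality

/-! ### The operators on a manifold in a parametrization -/

section Parametrization

open TopologicalSpace (Opens)

variable {E : Type*} [NormedAddCommGroup E] [NormedSpace ℝ E]
  {M : Type*} [TopologicalSpace M] [ChartedSpace E M]
  {N : Type*} [TopologicalSpace N] [ChartedSpace E N]
  {P : Type*} [TopologicalSpace P] [ChartedSpace E P] {k l : ℕ}

theorem tmap_comp {g : N → P} {f : M → N} {x : M} (hg : MDifferentiableAt 𝓘(ℝ, E) 𝓘(ℝ, E) g (f x))
    (hf : MDifferentiableAt 𝓘(ℝ, E) 𝓘(ℝ, E) f x) :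
    tmap (E := E) (g ∘ f) x = (tmap g (f x)).comp (tmap f x) := mfderiv_comp x hg hf

theorem pullPt_pullPt {A B : E →L[ℝ] E} (hA : A.IsInvertible) (hB : B.IsInvertible)
    (K : E [⋀^Fin k]→L[ℝ] E) : pullPt A (pullPt B K) = pullPt (B.comp A) K := by
  obtain ⟨e, rfl⟩ := hA
  obtain ⟨e', rfl⟩ := hB
  have : (e' : E →L[ℝ] E).comp (e : E →L[ℝ] E) = (e.trans e' : E ≃L[ℝ] E) := rfl
  rw [this]
  simp only [pullPt, ContinuousLinearMap.inverse_equiv]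
  rfl

theorem pullPt_injective {A : E →L[ℝ] E} (hA : A.IsInvertible) {K L : E [⋀^Fin k]→L[ℝ] E}
    (h : pullPt A K = pullPt A L) : K = L := by
  obtain ⟨e, rfl⟩ := hA
  have h1 : ∀ K : E [⋀^Fin k]→L[ℝ] E,
      pullPt (e.symm : E →L[ℝ] E) (pullPt (e : E →L[ℝ] E) K) = K := fun K => by
    simp only [pullPt, ContinuousLinearMap.inverse_equiv]
    ext v
    simp [Function.comp_def]
  rw [← h1 K, h, h1 L]

theorem comp_injective {A : E →L[ℝ] E} (hA : A.IsInvertible) {η θ : E [⋀^Fin k]→L[ℝ] ℝ}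
    (h : η.compContinuousLinearMap A = θ.compContinuousLinearMap A) : η = θ := by
  obtain ⟨e, rfl⟩ := hA
  have h1 : ∀ η : E [⋀^Fin k]→L[ℝ] ℝ, (η.compContinuousLinearMap
      (e : E →L[ℝ] E)).compContinuousLinearMap (e.symm : E →L[ℝ] E) = η := fun η => by
    ext v
    simp [Function.comp_def]
  rw [← h1 η, h, h1 θ]

theorem isInvertible_tmap_of_comp_eq {g : N → M} {f : M → N} {x : M}
    (hg : MDifferentiableAt 𝓘(ℝ, E) 𝓘(ℝ, E) g (f x))
    (hf : MDifferentiableAt 𝓘(ℝ, E) 𝓘(ℝ, E) f x)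
    (hf' : MDifferentiableAt 𝓘(ℝ, E) 𝓘(ℝ, E) f (g (f x)))
    (h : g ∘ f =ᶠ[nhds x] id) (h' : f ∘ g =ᶠ[nhds (f x)] id) :
    (tmap (E := E) f x).IsInvertible := by
  have h1 : (tmap (E := E) g (f x)).comp (tmap f x) = ContinuousLinearMap.id ℝ E := by
    rw [← tmap_comp hg hf]
    exact h.mfderiv_eq.trans mfderiv_id
  have h2 : (tmap (E := E) f (g (f x))).comp (tmap g (f x)) = ContinuousLinearMap.id ℝ E := by
    rw [← tmap_comp hf' hg]
    exact h'.mfderiv_eq.trans mfderiv_id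
  rw [show g (f x) = x from h.eq_of_nhds] at h2
  exact ContinuousLinearMap.IsInvertible.of_inverse h2 h1

/-- `ψ` is a local diffeomorphism on the open set `U` of `E`. -/
structure IsParam (ψ : E → N) (U : Opens E) : Prop where
  smooth : ContMDiffOn 𝓘(ℝ, E) 𝓘(ℝ, E) ∞ ψ U
  inv : ∀ y ∈ U, (tmap (E := E) ψ y).IsInvertible

variable [IsManifold 𝓘(ℝ, E) ∞ M] [IsManifold 𝓘(ℝ, E) ∞ N]

theorem mdifferentiableAt_chart {e : OpenPartialHomeomorph M E} (he : e ∈ atlas E M) {x : M}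
    (hx : x ∈ e.source) : MDifferentiableAt 𝓘(ℝ, E) 𝓘(ℝ, E) e x :=
  haveI : IsManifold 𝓘(ℝ, E) 1 M := IsManifold.of_le (n := ∞) (by simp)
  mdifferentiableAt_atlas he hx

theorem mdifferentiableAt_chart_symm {e : OpenPartialHomeomorph M E} (he : e ∈ atlas E M) {y : E}
    (hy : y ∈ e.target) : MDifferentiableAt 𝓘(ℝ, E) 𝓘(ℝ, E) e.symm y :=
  haveI : IsManifold 𝓘(ℝ, E) 1 M := IsManifold.of_le (n := ∞) (by simp)
  mdifferentiableAt_atlas_symm he hy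

theorem isInvertible_tmap_chart {e : OpenPartialHomeomorph M E} (he : e ∈ atlas E M) {x : M}
    (hx : x ∈ e.source) : (tmap (E := E) e x).IsInvertible :=
  isInvertible_tmap_of_comp_eq (g := e.symm) (mdifferentiableAt_chart_symm he (e.map_source hx))
    (mdifferentiableAt_chart he hx)
    (by rw [e.left_inv hx]; exact mdifferentiableAt_chart he hx)
    (Filter.eventually_of_mem (e.open_source.mem_nhds hx) fun z hz => e.left_inv hz)
    (Filter.eventually_of_mem (e.open_target.mem_nhds (e.map_source hx)) fun z hz => e.right_inv hz)

theorem isInvertible_tmap_chart_symm {e : OpenPartialHomeomorph M E} (he : e ∈ atlas E M) {y : E}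
    (hy : y ∈ e.target) : (tmap (E := E) e.symm y).IsInvertible :=
  isInvertible_tmap_of_comp_eq (g := e) (mdifferentiableAt_chart he (e.map_target hy))
    (mdifferentiableAt_chart_symm he hy)
    (by rw [e.right_inv hy]; exact mdifferentiableAt_chart_symm he hy)
    (Filter.eventually_of_mem (e.open_target.mem_nhds hy) fun z hz => e.right_inv hz)
    (Filter.eventually_of_mem (e.open_source.mem_nhds (e.map_target hy)) fun z hz => e.left_inv hz)

/-- The target of a chart as an open subset. -/
def targetOpens (e : OpenPartialHomeomorph M E) : Opens E := ⟨e.target, e.open_target⟩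

theorem isParam_chart_symm {e : OpenPartialHomeomorph M E} (he : e ∈ atlas E M) :
    IsParam e.symm (targetOpens e) where
  smooth := contMDiffOn_symm_of_mem_maximalAtlas (IsManifold.subset_maximalAtlas he)
  inv _ hy := isInvertible_tmap_chart_symm he hy

theorem isInvertible_tmap_of_isLocalDiffeomorphAt {f : M → N} {x : M}
    (hf : IsLocalDiffeomorphAt 𝓘(ℝ, E) 𝓘(ℝ, E) ∞ f x) : (tmap (E := E) f x).IsInvertible :=
  ⟨hf.mfderivToContinuousLinearEquiv (by simp), hf.mfderivToContinuousLinearEquiv_coe (by simp)⟩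

theorem isParam_comp_chart_symm {f : M → N} (hf : IsLocalDiffeomorph 𝓘(ℝ, E) 𝓘(ℝ, E) ∞ f)
    {e : OpenPartialHomeomorph M E} (he : e ∈ atlas E M) :
    IsParam (f ∘ e.symm) (targetOpens e) where
  smooth := hf.contMDiff.comp_contMDiffOn (isParam_chart_symm he).smooth
  inv y hy := by
    rw [tmap_comp (hf.mdifferentiable (by simp) _) (mdifferentiableAt_chart_symm he hy)]
    exact (isInvertible_tmap_of_isLocalDiffeomorphAt (hf _)).comp
      (isInvertible_tmap_chart_symm he hy)

namespace IsParam

variable {ψ : E → N} {U : Opens E}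

theorem mdifferentiableAt (hψ : IsParam ψ U) {y : E} (hy : y ∈ U) :
    MDifferentiableAt 𝓘(ℝ, E) 𝓘(ℝ, E) ψ y :=
  (hψ.smooth.contMDiffAt (U.isOpen.mem_nhds hy)).mdifferentiableAt (by simp)

/-- The part of the parameter domain which is mapped into the source of the chart `c`. -/
def dom (hψ : IsParam ψ U) (c : OpenPartialHomeomorph N E) : Opens E :=
  ⟨U ∩ ψ ⁻¹' c.source, hψ.smooth.continuousOn.isOpen_inter_preimage U.isOpen c.open_source⟩

theorem isEtale (hψ : IsParam ψ U) {c : OpenPartialHomeomorph N E} (hc : c ∈ atlas E N) :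
    IsEtale (c ∘ ψ) (hψ.dom c) (targetOpens c) where
  smooth := by
    rw [← contMDiffOn_iff_contDiffOn]
    exact (contMDiffOn_of_mem_maximalAtlas (IsManifold.subset_maximalAtlas hc)).comp
      (hψ.smooth.mono Set.inter_subset_left) fun z hz => hz.2
  mapsTo y hy := c.map_source hy.2
  inv y hy := by
    rw [← tmap_model, tmap_comp (mdifferentiableAt_chart hc hy.2) (hψ.mdifferentiableAt hy.1)]
    exact (isInvertible_tmap_chart hc hy.2).comp (hψ.inv y hy.1)

theorem tmap_eq (hψ : IsParam ψ U) {c : OpenPartialHomeomorph N E} (hc : c ∈ atlas E N) {y : E}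
    (hy : y ∈ hψ.dom c) : tmap (E := E) ψ y = (tmap c.symm (c (ψ y))).comp (fderiv ℝ (c ∘ ψ) y) := by
  have h1 : MDifferentiableAt 𝓘(ℝ, E) 𝓘(ℝ, E) (c ∘ ψ) y :=
    (mdifferentiableAt_chart hc hy.2).comp y (hψ.mdifferentiableAt hy.1)
  have h2 : ψ =ᶠ[nhds y] c.symm ∘ (c ∘ ψ) :=
    Filter.eventually_of_mem ((hψ.dom c).isOpen.mem_nhds hy) fun z hz => (c.left_inv hz.2).symm
  rw [← tmap_model]
  refine Eq.trans ?_ (tmap_comp (g := c.symm) (f := c ∘ ψ)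
    (mdifferentiableAt_chart_symm hc (c.map_source hy.2)) h1)
  exact h2.mfderiv_eq

variable [FiniteDimensional ℝ E]

/-- Locally `ψ = c⁻¹ ∘ (c ∘ ψ)`, which reduces a parametrization to a chart followed by the étale
map `c ∘ ψ` between open sets of `E`. -/
theorem pullV_eq (hψ : IsParam ψ U) {c : OpenPartialHomeomorph N E} (hc : c ∈ atlas E N) {y : E}
    (hy : y ∈ hψ.dom c) (K : VField E N k) :
    pullV ψ K y = pullV (c ∘ ψ) (pullV c.symm K) y := by
  rw [pullV_model]
  change pullPt (tmap ψ y) (K (ψ y)) =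
    pullPt _ (pullPt (tmap c.symm (c (ψ y))) (K (c.symm (c (ψ y)))))
  rw [pullPt_pullPt ((hψ.isEtale hc).inv y hy)
    (isInvertible_tmap_chart_symm hc (c.map_source hy.2)), ← hψ.tmap_eq hc hy, c.left_inv hy.2]

theorem pullS_eq (hψ : IsParam ψ U) {c : OpenPartialHomeomorph N E} (hc : c ∈ atlas E N) {y : E}
    (hy : y ∈ hψ.dom c) (η : SField E N k) :
    pullS ψ η y = pullS (c ∘ ψ) (pullS c.symm η) y := by
  rw [pullS_model]
  change (η (ψ y)).compContinuousLinearMap (tmap ψ y) =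
    ((η (c.symm (c (ψ y)))).compContinuousLinearMap
      (tmap c.symm (c (ψ y)))).compContinuousLinearMap _
  rw [hψ.tmap_eq hc hy, c.left_inv hy.2]
  rfl

theorem pullV_chart (hψ : IsParam ψ U) {c : OpenPartialHomeomorph N E} (hc : c ∈ atlas E N) {y : E}
    (hy : y ∈ hψ.dom c) (K : VField E E k) :
    pullPt (tmap ψ y) (pullV c K (ψ y)) = pullV (c ∘ ψ) K y := by
  change pullPt _ (pullPt (tmap c (ψ y)) (K (c (ψ y)))) =
    pullPt (tmap (c ∘ ψ) y) (K (c (ψ y)))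
  rw [pullPt_pullPt (hψ.inv y hy.1) (isInvertible_tmap_chart hc hy.2),
    tmap_comp (mdifferentiableAt_chart hc hy.2) (hψ.mdifferentiableAt hy.1)]

theorem pullS_chart (hψ : IsParam ψ U) {c : OpenPartialHomeomorph N E} (hc : c ∈ atlas E N) {y : E}
    (hy : y ∈ hψ.dom c) (η : SField E E k) :
    (pullS c η (ψ y)).compContinuousLinearMap (tmap ψ y) = pullS (c ∘ ψ) η y := by
  change ((η (c (ψ y))).compContinuousLinearMap (tmap c (ψ y))).compContinuousLinearMap _ =
    (η (c (ψ y))).compContinuousLinearMap (tmap (c ∘ ψ) y)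
  rw [tmap_comp (mdifferentiableAt_chart hc hy.2) (hψ.mdifferentiableAt hy.1)]
  rfl

theorem contDiffOn_pullV (hψ : IsParam ψ U) {K : VField E N k} (hK : K ∈ VectorForms E N k) :
    ContDiffOn ℝ ∞ (pullV ψ K) U := fun y hy => by
  have hc := chart_mem_atlas E (ψ y)
  have hy' : y ∈ hψ.dom (chartAt E (ψ y)) := ⟨hy, mem_chart_source E (ψ y)⟩
  refine ContDiffAt.contDiffWithinAt ?_
  exact (((hψ.isEtale hc).contDiffOn_pullV (hK _ hc)).congr fun z hz =>
    hψ.pullV_eq hc hz K).contDiffAt ((hψ.dom _).isOpen.mem_nhds hy')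

/-- `extd` uses a different chart at each point. Naturality under `c ∘ ψ` shows that this choice is
immaterial and that every parametrization computes the same derivative; the next theorem does this
for the bracket. -/
theorem pullS_extd (hψ : IsParam ψ U) {η : SField E N k} (hη : η ∈ ScalarForms E N k) {y : E}
    (hy : y ∈ U) : pullS ψ (extd η) y = extDeriv (pullS ψ η) y := by
  have hc := chart_mem_atlas E (ψ y)
  have hy' : y ∈ hψ.dom (chartAt E (ψ y)) := ⟨hy, mem_chart_source E (ψ y)⟩
  rw [extDeriv_congr_on (fun z hz => hψ.pullS_eq hc hz η) hy',
    (hψ.isEtale hc).extDeriv_pullS (hη _ hc) hy']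
  exact hψ.pullS_chart hc hy' _

theorem pullV_fnBracket (hψ : IsParam ψ U) {K : VField E N k} {L : VField E N l}
    (hK : K ∈ VectorForms E N k) (hL : L ∈ VectorForms E N l) {y : E} (hy : y ∈ U) :
    pullV ψ (fnBracket K L) y = fnFlat (pullV ψ K) (pullV ψ L) y := by
  have hc := chart_mem_atlas E (ψ y)
  have hy' : y ∈ hψ.dom (chartAt E (ψ y)) := ⟨hy, mem_chart_source E (ψ y)⟩
  refine (hψ.pullV_chart hc hy' _).trans ?_
  rw [← (hψ.isEtale hc).fnFlat_pull (hK _ hc) (hL _ hc) hy']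
  -- The bracket involves derivatives, so equality at `y` would not suffice: the two descriptions of
  -- the fields agree on the open set `hψ.dom`, hence have the same components there.
  obtain ⟨W, hW⟩ := exists_repV ((hψ.isEtale hc).contDiffOn_pullV (hK _ hc))
  obtain ⟨W', hW'⟩ := exists_repV ((hψ.isEtale hc).contDiffOn_pullV (hL _ hc))
  exact (hW.fnFlat hW').eq ((hW.congr fun z => hψ.pullV_eq hc z.2 K).fnFlat
    (hW'.congr fun z => hψ.pullV_eq hc z.2 L)) ⟨y, hy'⟩

end IsParam

end Parametrization

/-! ### Bilinearity of the brackets in components -/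

namespace Shuffle

variable {ι R : Type*} [Fintype ι] [DecidableEq ι] [CommRing R] [Algebra ℝ R]
  {D : ι → Derivation ℝ R R}

theorem lie_add_left (k : ℕ) (K L : ι → Shuffle ι R) (η : Shuffle ι R) :
    lie D k (K + L) η = lie D k K η + lie D k L η := by
  simp [lie_apply, insK_apply, add_mul, smul_add, Finset.sum_add_distrib]; abel

theorem fn_add_left (k l : ℕ) (K K' L : ι → Shuffle ι R) :
    fn D k l (K + K') L = fn D k l K L + fn D k l K' L := by
  funext b; simp [fn, lie_add_left, smul_add]; abel

theorem fn_add_right (k l : ℕ) (K L L' : ι → Shuffle ι R) :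
    fn D k l K (L + L') = fn D k l K L + fn D k l K L' := by
  funext b; simp [fn, lie_add_left, smul_add]; abel

theorem S_add_left (K K' L : ι → Shuffle ι R) : S (K + K') L = S K L + S K' L := by
  simp [S, add_mul, Finset.sum_add_distrib]

theorem S_add_right (K L L' : ι → Shuffle ι R) : S K (L + L') = S K L + S K L' := by
  simp [S, mul_add, Finset.sum_add_distrib]

theorem S_smul_left (r : ℝ) (K L : ι → Shuffle ι R) : S (r • K) L = r • S K L := by
  simp [S, Finset.smul_sum, smul_mul_assoc]

theorem S_smul_right (r : ℝ) (K L : ι → Shuffle ι R) : S K (r • L) = r • S K L := by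
  simp [S, Finset.smul_sum, mul_smul_comm]

theorem cb_add_left (k l : ℕ) (K K' L : ι → Shuffle ι R) :
    cb D k l (K + K') L = cb D k l K L + cb D k l K' L := by
  simp only [cb, fn_add_left, S_add_left, map_add, smul_add]; abel

theorem cb_add_right (k l : ℕ) (K L L' : ι → Shuffle ι R) :
    cb D k l K (L + L') = cb D k l K L + cb D k l K L' := by
  simp only [cb, fn_add_right, S_add_right, map_add, smul_add]; abel

theorem cb_smul_left (k l : ℕ) (r : ℝ) (K L : ι → Shuffle ι R) :
    cb D k l (r • K) L = r • cb D k l K L := by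
  simp only [cb, fn_smul_left, S_smul_left, map_smul, smul_sub, smul_comm r]

theorem cb_smul_right (k l : ℕ) (r : ℝ) (K L : ι → Shuffle ι R) :
    cb D k l K (r • L) = r • cb D k l K L := by
  simp only [cb, fn_smul_right, S_smul_right, map_smul, smul_sub, smul_comm r]

end Shuffle

/-! ### Forms on manifolds through their components in charts -/

section Components

open TopologicalSpace (Opens)

variable {E : Type*} [NormedAddCommGroup E] [NormedSpace ℝ E] [FiniteDimensional ℝ E]
  {N : Type*} [TopologicalSpace N] [ChartedSpace E N] [IsManifold 𝓘(ℝ, E) ∞ N] {k l p : ℕ}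

theorem vfield_ext {K L : VField E N k}
    (h : ∀ e ∈ atlas E N, ∀ y ∈ e.target, pullV e.symm K y = pullV e.symm L y) : K = L := by
  funext x
  have h1 := h _ (chart_mem_atlas E x) _ (mem_chart_target E x)
  have h2 := pullPt_injective (isInvertible_tmap_chart_symm (chart_mem_atlas E x)
    (mem_chart_target E x)) h1
  rwa [(chartAt E x).left_inv (mem_chart_source E x)] at h2

theorem sfield_ext {η θ : SField E N k}
    (h : ∀ e ∈ atlas E N, ∀ y ∈ e.target, pullS e.symm η y = pullS e.symm θ y) : η = θ := by
  funext x
  have h1 := h _ (chart_mem_atlas E x) _ (mem_chart_target E x)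
  have h2 := comp_injective (isInvertible_tmap_chart_symm (chart_mem_atlas E x)
    (mem_chart_target E x)) h1
  rwa [(chartAt E x).left_inv (mem_chart_source E x)] at h2

theorem pullV_apply {M : Type*} [TopologicalSpace M] [ChartedSpace E M] (f : M → N)
    (K : VField E N k) (x : M) : pullV f K x = pullPt (tmap f x) (K (f x)) := rfl

theorem cBracket_apply (K : VField E N k) (L : VField E N l) (x : N) :
    cBracket K L x = fnBracket K L x -
      ((-1 : ℝ) ^ l / ((Module.finrank ℝ E : ℝ) - k - l + 1)) • dSWedgeId K L x := rfl

namespace IsParam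

variable {ψ : E → N} {U : Opens E}

theorem pullS_insV (hψ : IsParam ψ U) (K : VField E N k) (η : SField E N (l + 1)) {y : E}
    (hy : y ∈ U) :
    pullS ψ (fun z => insV (K z) (η z)) y = insV (pullV ψ K y) (pullS ψ η y) :=
  (insV_pullPt (hψ.inv y hy) _ _).symm

theorem pullS_algS (hψ : IsParam ψ U) (K : VField E N (k + 1)) (L : VField E N (l + 1)) {y : E}
    (hy : y ∈ U) :
    pullS ψ (fun z => algS (K z) (L z)) y = algS (pullV ψ K y) (pullV ψ L y) :=
  (algS_pullPt (hψ.inv y hy) _ _).symm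

theorem pullS_contr (hψ : IsParam ψ U) (K : VField E N k) {y : E} (hy : y ∈ U) :
    pullS ψ (fun z => contr (K z)) y = contr (pullV ψ K y) :=
  (contr_pullPt (hψ.inv y hy) _).symm

end IsParam

theorem insV_mem {K : VField E N k} {η : SField E N (l + 1)} (hK : K ∈ VectorForms E N k)
    (hη : η ∈ ScalarForms E N (l + 1)) : (fun z => insV (K z) (η z)) ∈ ScalarForms E N (k + l) :=
  fun e he => (contDiffOn_insV (U := targetOpens e) (hK e he) (hη e he)).congr fun _ hy =>
    (isParam_chart_symm he).pullS_insV K η hy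

theorem algS_mem {K : VField E N (k + 1)} {L : VField E N (l + 1)}
    (hK : K ∈ VectorForms E N (k + 1)) (hL : L ∈ VectorForms E N (l + 1)) :
    (fun z => algS (K z) (L z)) ∈ ScalarForms E N (k + l) := fun e he => by
  obtain ⟨W, hW⟩ := exists_repV (U := targetOpens e) (hK e he)
  obtain ⟨W', hW'⟩ := exists_repV (U := targetOpens e) (hL e he)
  exact (hW.algS hW').contDiffOn.congr fun _ hy => (isParam_chart_symm he).pullS_algS K L hy

namespace IsParam

variable {ψ : E → N} {U : Opens E}

theorem pullS_theta (hψ : IsParam ψ U) {K : VField E N k} {η : SField E N l}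
    (hK : K ∈ VectorForms E N k) (hη : η ∈ ScalarForms E N l) {y : E} (hy : y ∈ U) :
    pullS ψ (theta K η) y = thetaFlat (pullV ψ K) (pullS ψ η) y := by
  cases l with
  | zero =>
    simp only [theta, thetaFlat]
    rw [hψ.pullS_insV K _ hy, hψ.pullS_extd hη hy]
  | succ l =>
    simp only [theta, thetaFlat]
    change pullS ψ (fun z => insV (K z) (extd η z)) y +
      (-1 : ℝ) ^ k • pullS ψ (extd fun z => insV (K z) (η z)) y = _
    rw [hψ.pullS_insV K _ hy, hψ.pullS_extd hη hy, hψ.pullS_extd (insV_mem hK hη) hy,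
      extDeriv_congr_on (fun z hz => hψ.pullS_insV K η hz) hy]

theorem pullV_dSWedgeId (hψ : IsParam ψ U) {K : VField E N k} {L : VField E N l}
    (hK : K ∈ VectorForms E N k) (hL : L ∈ VectorForms E N l) {y : E} (hy : y ∈ U) :
    pullV ψ (dSWedgeId K L) y = dSWedgeId (M := E) (pullV ψ K) (pullV ψ L) y := by
  have h0 : ∀ {n : ℕ}, pullV ψ (0 : VField E N n) y = 0 := fun {n} => by
    ext v; simp [pullV]
  cases k with
  | zero => exact h0
  | succ k =>
    cases l with
    | zero => exact h0
    | succ l =>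
      change pullPt (tmap ψ y) (dSWedgeId K L (ψ y)) = _
      have h1 := hψ.pullS_extd (algS_mem hK hL) hy
      rw [extDeriv_congr_on (fun z hz => hψ.pullS_algS K L hz) hy] at h1
      rw [dSWedgeId_succ, dSWedgeId_succ, pullPt_degCast, ← wedge_pullPt,
        pullPt_idForm (hψ.inv y hy), extd_model, ← h1]
      rfl

theorem pullV_cBracket (hψ : IsParam ψ U) {K : VField E N k} {L : VField E N l}
    (hK : K ∈ VectorForms E N k) (hL : L ∈ VectorForms E N l) {y : E} (hy : y ∈ U) :
    pullV ψ (cBracket K L) y = cBracket (M := E) (pullV ψ K) (pullV ψ L) y := by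
  rw [cBracket_apply, fnBracket_model, ← hψ.pullV_fnBracket hK hL hy,
    ← hψ.pullV_dSWedgeId hK hL hy, pullV_apply, cBracket_apply, pullPt_sub, pullPt_smul,
    pullV_apply, pullV_apply]

end IsParam

/-- `W` consists of the components of `K` in the chart `e`. -/
def ChartRep (e : OpenPartialHomeomorph N E) (K : VField E N k)
    (W : Fin (Module.finrank ℝ E) → Comp (targetOpens e)) : Prop := RepV (pullV e.symm K) W

/-- The projection onto the traceless part. -/
def prField : ∀ {k : ℕ}, VField E N k → VField E N k
  -- In degree `0` the contraction is typed in degree `0 - 1 = 0`, so its product with `I` would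
  -- have degree `1`; the trace is zero and no correction is made.
  | 0, K => K
  | k + 1, K => fun x => K x + ((-1 : ℝ) ^ (k + 1) / ((Module.finrank ℝ E : ℝ) - (k + 1 : ℕ) + 1)) •
      (wedge (k := k) (l := 1) (contr (K x)) (idForm E) : E [⋀^Fin (k + 1)]→L[ℝ] E)

theorem exists_chartRep {K : VField E N k} (hK : K ∈ VectorForms E N k)
    {e : OpenPartialHomeomorph N E} (he : e ∈ atlas E N) :
    ∃ W : Fin (Module.finrank ℝ E) → Comp (targetOpens e), ChartRep e K W :=
  exists_repV (hK e he)

theorem mem_vectorForms_of_chartRep {K : VField E N k} (h : ∀ e ∈ atlas E N,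
    ∃ W : Fin (Module.finrank ℝ E) → Comp (targetOpens e), ChartRep e K W) :
    K ∈ VectorForms E N k := fun e he => by
  obtain ⟨W, hW⟩ := h e he
  exact RepV.contDiffOn hW

theorem eq_of_chartRep {K L : VField E N k} (h : ∀ e ∈ atlas E N,
    ∃ W : Fin (Module.finrank ℝ E) → Comp (targetOpens e), ChartRep e K W ∧ ChartRep e L W) :
    K = L := vfield_ext fun e he y hy => by
  obtain ⟨W, hW, hW'⟩ := h e he
  exact RepV.eq hW hW' ⟨y, hy⟩

namespace ChartRep

variable {e : OpenPartialHomeomorph N E} {K L : VField E N k}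
  {W W' : Fin (Module.finrank ℝ E) → Comp (targetOpens e)}

theorem add (h : ChartRep e K W) (h' : ChartRep e L W') : ChartRep e (K + L) (W + W') := by
  rw [ChartRep, pullV_add]; exact RepV.add h h'

theorem smul (h : ChartRep e K W) (r : ℝ) : ChartRep e (r • K) (r • W) := by
  rw [ChartRep, pullV_smul]; exact RepV.smul h r

theorem neg (h : ChartRep e K W) : ChartRep e (-K) (-W) := by
  rw [← neg_one_smul ℝ K, ← neg_one_smul ℝ W]; exact h.smul _

theorem degCast {k' : ℕ} (hk : k = k') (h : ChartRep e K W) :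
    ChartRep e (VVForm.degCast (VField E N) hk K) W := by
  subst hk; exact h

theorem isForm (h : ChartRep e K W) : Shuffle.IsForm k W := RepV.isForm h

variable {L : VField E N l}

theorem fnBracket (he : e ∈ atlas E N) (hK : K ∈ VectorForms E N k) (hL : L ∈ VectorForms E N l)
    (h : ChartRep e K W) (h' : ChartRep e L W') :
    ChartRep e (fnBracket K L) (Shuffle.fn (coordD (targetOpens e)) k l W W') :=
  (RepV.fnFlat h h').congr fun y => (isParam_chart_symm he).pullV_fnBracket hK hL y.2

theorem cBracket (he : e ∈ atlas E N) (hK : K ∈ VectorForms E N k) (hL : L ∈ VectorForms E N l)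
    (h : ChartRep e K W) (h' : ChartRep e L W') :
    ChartRep e (cBracket K L) (Shuffle.cb (coordD (targetOpens e)) k l W W') :=
  (RepV.cBracket h h').congr fun y => (isParam_chart_symm he).pullV_cBracket hK hL y.2

theorem contr (h : ChartRep e K W) :
    Rep (fun y => contr (pullV e.symm K y)) (Shuffle.tr W) := RepV.contr h

theorem tr_eq_zero (he : e ∈ atlas E N) (h : ChartRep e K W) (h0 : ∀ x, VVForm.contr (K x) = 0) :
    Shuffle.tr W = 0 := by
  refine h.contr.unique (Rep.zero.congr fun y => ?_)
  rw [← (isParam_chart_symm he).pullS_contr K y.2]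
  change (VVForm.contr (K _)).compContinuousLinearMap _ = 0
  rw [h0]; rfl

theorem prField (he : e ∈ atlas E N) (h : ChartRep e K W) :
    ChartRep e (prField K) (Shuffle.pr k W) := by
  cases k with
  | zero =>
    have h0 : Shuffle.tr W = 0 := by
      rw [Shuffle.tr_apply]
      exact Finset.sum_eq_zero fun a _ => (h a).cut_eq_zero a
    rw [Shuffle.pr_of_tr h0]; exact h
  | succ k =>
    rw [Shuffle.pr_apply, Fintype.card_fin]
    refine (RepV.add h ((Rep.wedgeI h.contr).smul _)).congr fun y => ?_
    rw [pullV_apply, VVForm.prField]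
    have h1 : ∀ A B : E [⋀^Fin (k + 1)]→L[ℝ] E, pullPt (tmap e.symm (y : E)) (A + B) =
        pullPt (tmap e.symm (y : E)) A + pullPt (tmap e.symm (y : E)) B := fun A B => by
      ext v; simp [pullPt]
    have hi := isInvertible_tmap_chart_symm he y.2
    rw [h1, pullPt_smul, ← wedge_pullPt, pullPt_idForm hi, ← contr_pullPt hi]
    rfl

end ChartRep

end Components

/-! ### The graded Lie algebras -/

section Structures

variable {E : Type*} [NormedAddCommGroup E] [NormedSpace ℝ E] [FiniteDimensional ℝ E]
  {N : Type*} [TopologicalSpace N] [ChartedSpace E N] [IsManifold 𝓘(ℝ, E) ∞ N] {k l p : ℕ}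

theorem subsingleton_of_finrank_lt {F : Type*} [NormedAddCommGroup F] [NormedSpace ℝ F]
    (h : Module.finrank ℝ E < k) : Subsingleton (E [⋀^Fin k]→L[ℝ] F) := by
  have h0 : ∀ K : E [⋀^Fin k]→L[ℝ] F, K = 0 := fun K => by
    ext v
    refine K.toAlternatingMap.map_linearDependent v fun hv => ?_
    have := hv.fintype_card_le_finrank
    rw [Fintype.card_fin] at this
    omega
  exact ⟨fun K L => (h0 K).trans (h0 L).symm⟩

/-- Disposes of the degrees above `m`, where the denominators may vanish and the component
identities for `pr` are not available. -/
theorem vfield_eq_of_finrank_lt (h : Module.finrank ℝ E < k) (K L : VField E N k) : K = L :=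
  funext fun _ => (subsingleton_of_finrank_lt h).elim _ _

theorem fnBracket_mem {K : VField E N k} {L : VField E N l} (hK : K ∈ VectorForms E N k)
    (hL : L ∈ VectorForms E N l) : fnBracket K L ∈ VectorForms E N (k + l) :=
  mem_vectorForms_of_chartRep fun e he => by
    obtain ⟨W, hW⟩ := exists_chartRep hK he
    obtain ⟨W', hW'⟩ := exists_chartRep hL he
    exact ⟨_, hW.fnBracket he hK hL hW'⟩

theorem cBracket_mem {K : VField E N k} {L : VField E N l} (hK : K ∈ VectorForms E N k)
    (hL : L ∈ VectorForms E N l) : cBracket K L ∈ VectorForms E N (k + l) :=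
  mem_vectorForms_of_chartRep fun e he => by
    obtain ⟨W, hW⟩ := exists_chartRep hK he
    obtain ⟨W', hW'⟩ := exists_chartRep hL he
    exact ⟨_, hW.cBracket he hK hL hW'⟩

theorem prField_mem {K : VField E N k} (hK : K ∈ VectorForms E N k) :
    prField K ∈ VectorForms E N k :=
  mem_vectorForms_of_chartRep fun e he => by
    obtain ⟨W, hW⟩ := exists_chartRep hK he
    exact ⟨_, hW.prField he⟩

/-- Tracelessness can be checked on the components. -/
theorem contr_eq_zero_of_chartRep {K : VField E N k} (h : ∀ e ∈ atlas E N,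
    ∃ W : Fin (Module.finrank ℝ E) → Comp (targetOpens e), ChartRep e K W ∧ Shuffle.tr W = 0)
    (x : N) : contr (K x) = 0 := by
  have h1 : (fun z => contr (K z)) = (0 : SField E N (k - 1)) := sfield_ext fun e he y hy => by
    obtain ⟨W, hW, h0⟩ := h e he
    rw [(isParam_chart_symm he).pullS_contr K hy]
    have h2 := hW.contr
    rw [h0] at h2
    exact h2.eq Rep.zero ⟨y, hy⟩
  exact congrFun h1 x

theorem contr_zero : contr (0 : E [⋀^Fin k]→L[ℝ] E) = 0 := by
  simpa using contr_smul (0 : ℝ) (0 : E [⋀^Fin k]→L[ℝ] E)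

theorem traceless_of_finrank_lt (h : Module.finrank ℝ E < k) (K : VField E N k) :
    K ∈ Traceless E N k := by
  rw [vfield_eq_of_finrank_lt h K 0]; exact zero_mem _

theorem cBracket_mem_traceless {K : VField E N k} {L : VField E N l} (hK : K ∈ Traceless E N k)
    (hL : L ∈ Traceless E N l) : cBracket K L ∈ Traceless E N (k + l) := by
  rcases Nat.lt_or_ge (Module.finrank ℝ E) (k + l) with hm | hm
  · exact traceless_of_finrank_lt hm _
  refine ⟨cBracket_mem hK.1 hL.1, contr_eq_zero_of_chartRep fun e he => ?_⟩
  obtain ⟨W, hW⟩ := exists_chartRep hK.1 he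
  obtain ⟨W', hW'⟩ := exists_chartRep hL.1 he
  exact ⟨_, hW.cBracket he hK.1 hL.1 hW', Shuffle.tr_cb hW.isForm hW'.isForm
    (hW.tr_eq_zero he hK.2) (hW'.tr_eq_zero he hL.2) (by simpa using hm)⟩

theorem prField_mem_traceless {K : VField E N k} (hK : K ∈ VectorForms E N k) :
    prField K ∈ Traceless E N k := by
  rcases Nat.lt_or_ge (Module.finrank ℝ E) k with hm | hm
  · exact traceless_of_finrank_lt hm _
  refine ⟨prField_mem hK, contr_eq_zero_of_chartRep fun e he => ?_⟩
  obtain ⟨W, hW⟩ := exists_chartRep hK he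
  exact ⟨_, hW.prField he, Shuffle.tr_pr hW.isForm (by simpa using hm)⟩

theorem prField_eq_self {K : VField E N k} (h : ∀ x, contr (K x) = 0) : prField K = K := by
  cases k with
  | zero => rfl
  | succ k =>
    funext x
    have h1 : wedge (k := k) (l := 1) (contr (K x)) (idForm E) = 0 := by
      rw [h x]; exact (LinearMap.congr_fun (map_zero wedgeₗ) (idForm E))
    simp only [prField]
    rw [h1, smul_zero, add_zero (_ : E [⋀^Fin (k + 1)]→L[ℝ] E)]

theorem prField_add (K L : VField E N k) : prField (K + L) = prField K + prField L := by
  cases k with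
  | zero => rfl
  | succ k =>
    funext x
    have h1 : wedge (k := k) (l := 1) (contr (K x + L x)) (idForm E) =
        wedge (contr (K x)) (idForm E) + wedge (contr (L x)) (idForm E) := by
      rw [contr_add]; exact wedgeₗ.map_add₂ _ _ _
    simp only [prField, Pi.add_apply, h1, smul_add]
    abel

theorem prField_smul (r : ℝ) (K : VField E N k) : prField (r • K) = r • prField K := by
  cases k with
  | zero => rfl
  | succ k =>
    funext x
    have h1 : wedge (k := k) (l := 1) (contr (r • K x)) (idForm E) =
        r • wedge (contr (K x)) (idForm E) := by
      rw [contr_smul]; exact wedgeₗ.map_smul₂ _ _ _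
    simp only [prField, Pi.smul_apply, h1, smul_add, smul_comm r]

section Bilinear

variable {K K' : VField E N k} {L L' : VField E N l}

theorem fnBracket_add_left (hK : K ∈ VectorForms E N k) (hK' : K' ∈ VectorForms E N k)
    (hL : L ∈ VectorForms E N l) : fnBracket (K + K') L = fnBracket K L + fnBracket K' L :=
  eq_of_chartRep fun e he => by
    obtain ⟨W, hW⟩ := exists_chartRep hK he
    obtain ⟨W', hW'⟩ := exists_chartRep hK' he
    obtain ⟨V, hV⟩ := exists_chartRep hL he
    refine ⟨_, (hW.add hW').fnBracket he (add_mem hK hK') hL hV, ?_⟩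
    rw [Shuffle.fn_add_left]
    exact (hW.fnBracket he hK hL hV).add (hW'.fnBracket he hK' hL hV)

theorem fnBracket_add_right (hK : K ∈ VectorForms E N k) (hL : L ∈ VectorForms E N l)
    (hL' : L' ∈ VectorForms E N l) : fnBracket K (L + L') = fnBracket K L + fnBracket K L' :=
  eq_of_chartRep fun e he => by
    obtain ⟨W, hW⟩ := exists_chartRep hK he
    obtain ⟨V, hV⟩ := exists_chartRep hL he
    obtain ⟨V', hV'⟩ := exists_chartRep hL' he
    refine ⟨_, hW.fnBracket he hK (add_mem hL hL') (hV.add hV'), ?_⟩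
    rw [Shuffle.fn_add_right]
    exact (hW.fnBracket he hK hL hV).add (hW.fnBracket he hK hL' hV')

theorem fnBracket_smul_left (r : ℝ) (hK : K ∈ VectorForms E N k) (hL : L ∈ VectorForms E N l) :
    fnBracket (r • K) L = r • fnBracket K L :=
  eq_of_chartRep fun e he => by
    obtain ⟨W, hW⟩ := exists_chartRep hK he
    obtain ⟨V, hV⟩ := exists_chartRep hL he
    refine ⟨_, (hW.smul r).fnBracket he (Submodule.smul_mem _ r hK) hL hV, ?_⟩
    rw [Shuffle.fn_smul_left]
    exact (hW.fnBracket he hK hL hV).smul r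

theorem fnBracket_smul_right (r : ℝ) (hK : K ∈ VectorForms E N k) (hL : L ∈ VectorForms E N l) :
    fnBracket K (r • L) = r • fnBracket K L :=
  eq_of_chartRep fun e he => by
    obtain ⟨W, hW⟩ := exists_chartRep hK he
    obtain ⟨V, hV⟩ := exists_chartRep hL he
    refine ⟨_, hW.fnBracket he hK (Submodule.smul_mem _ r hL) (hV.smul r), ?_⟩
    rw [Shuffle.fn_smul_right]
    exact (hW.fnBracket he hK hL hV).smul r

theorem cBracket_add_left (hK : K ∈ VectorForms E N k) (hK' : K' ∈ VectorForms E N k)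
    (hL : L ∈ VectorForms E N l) : cBracket (K + K') L = cBracket K L + cBracket K' L :=
  eq_of_chartRep fun e he => by
    obtain ⟨W, hW⟩ := exists_chartRep hK he
    obtain ⟨W', hW'⟩ := exists_chartRep hK' he
    obtain ⟨V, hV⟩ := exists_chartRep hL he
    refine ⟨_, (hW.add hW').cBracket he (add_mem hK hK') hL hV, ?_⟩
    rw [Shuffle.cb_add_left]
    exact (hW.cBracket he hK hL hV).add (hW'.cBracket he hK' hL hV)

theorem cBracket_add_right (hK : K ∈ VectorForms E N k) (hL : L ∈ VectorForms E N l)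
    (hL' : L' ∈ VectorForms E N l) : cBracket K (L + L') = cBracket K L + cBracket K L' :=
  eq_of_chartRep fun e he => by
    obtain ⟨W, hW⟩ := exists_chartRep hK he
    obtain ⟨V, hV⟩ := exists_chartRep hL he
    obtain ⟨V', hV'⟩ := exists_chartRep hL' he
    refine ⟨_, hW.cBracket he hK (add_mem hL hL') (hV.add hV'), ?_⟩
    rw [Shuffle.cb_add_right]
    exact (hW.cBracket he hK hL hV).add (hW.cBracket he hK hL' hV')

theorem cBracket_smul_left (r : ℝ) (hK : K ∈ VectorForms E N k) (hL : L ∈ VectorForms E N l) :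
    cBracket (r • K) L = r • cBracket K L :=
  eq_of_chartRep fun e he => by
    obtain ⟨W, hW⟩ := exists_chartRep hK he
    obtain ⟨V, hV⟩ := exists_chartRep hL he
    refine ⟨_, (hW.smul r).cBracket he (Submodule.smul_mem _ r hK) hL hV, ?_⟩
    rw [Shuffle.cb_smul_left]
    exact (hW.cBracket he hK hL hV).smul r

theorem cBracket_smul_right (r : ℝ) (hK : K ∈ VectorForms E N k) (hL : L ∈ VectorForms E N l) :
    cBracket K (r • L) = r • cBracket K L :=
  eq_of_chartRep fun e he => by
    obtain ⟨W, hW⟩ := exists_chartRep hK he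
    obtain ⟨V, hV⟩ := exists_chartRep hL he
    refine ⟨_, hW.cBracket he hK (Submodule.smul_mem _ r hL) (hV.smul r), ?_⟩
    rw [Shuffle.cb_smul_right]
    exact (hW.cBracket he hK hL hV).smul r

end Bilinear

theorem fnBracket_antisymm {K : VField E N k} {L : VField E N l} (hK : K ∈ VectorForms E N k)
    (hL : L ∈ VectorForms E N l) : fnBracket K L =
      -((-1 : ℝ) ^ (k * l) • degCast (VField E N) (Nat.add_comm l k) (fnBracket L K)) :=
  eq_of_chartRep fun e he => by
    obtain ⟨W, hW⟩ := exists_chartRep hK he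
    obtain ⟨V, hV⟩ := exists_chartRep hL he
    refine ⟨_, hW.fnBracket he hK hL hV, ?_⟩
    rw [funext (Shuffle.fn_antisymm k l W V)]
    exact (((hV.fnBracket he hL hK hW).degCast (Nat.add_comm l k)).smul _).neg

theorem cBracket_antisymm {K : VField E N k} {L : VField E N l} (hK : K ∈ Traceless E N k)
    (hL : L ∈ Traceless E N l) : cBracket K L =
      -((-1 : ℝ) ^ (k * l) • degCast (VField E N) (Nat.add_comm l k) (cBracket L K)) :=
  eq_of_chartRep fun e he => by
    obtain ⟨W, hW⟩ := exists_chartRep hK.1 he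
    obtain ⟨V, hV⟩ := exists_chartRep hL.1 he
    refine ⟨_, hW.cBracket he hK.1 hL.1 hV, ?_⟩
    rw [Shuffle.cb_antisymm hW.isForm hV.isForm (hW.tr_eq_zero he hK.2) (hV.tr_eq_zero he hL.2)]
    exact (((hV.cBracket he hL.1 hK.1 hW).degCast (Nat.add_comm l k)).smul _).neg

theorem fnBracket_jacobi {K : VField E N k} {L : VField E N l} {P : VField E N p}
    (hK : K ∈ VectorForms E N k) (hL : L ∈ VectorForms E N l) (hP : P ∈ VectorForms E N p) :
    fnBracket K (fnBracket L P) =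
      degCast (VField E N) (Nat.add_assoc k l p) (fnBracket (fnBracket K L) P) +
        (-1 : ℝ) ^ (k * l) • degCast (VField E N) (Nat.add_left_comm l k p)
          (fnBracket L (fnBracket K P)) :=
  eq_of_chartRep fun e he => by
    obtain ⟨W, hW⟩ := exists_chartRep hK he
    obtain ⟨V, hV⟩ := exists_chartRep hL he
    obtain ⟨X, hX⟩ := exists_chartRep hP he
    refine ⟨_, hW.fnBracket he hK (fnBracket_mem hL hP) (hV.fnBracket he hL hP hX), ?_⟩
    rw [Shuffle.fn_jacobi (coordD_comm (targetOpens e)) hW.isForm.parity hV.isForm.parity hX.isForm.parity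
      hW.isForm.alt hV.isForm.alt hX.isForm.alt]
    have h1 := (hW.fnBracket he hK hL hV).fnBracket he (fnBracket_mem hK hL) hP hX
    have h2 := hV.fnBracket he hL (fnBracket_mem hK hP) (hW.fnBracket he hK hP hX)
    exact (h1.degCast (Nat.add_assoc k l p)).add
      ((h2.degCast (Nat.add_left_comm l k p)).smul ((-1 : ℝ) ^ (k * l)))

theorem cBracket_jacobi {K : VField E N k} {L : VField E N l} {P : VField E N p}
    (hK : K ∈ Traceless E N k) (hL : L ∈ Traceless E N l) (hP : P ∈ Traceless E N p) :
    cBracket K (cBracket L P) =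
      degCast (VField E N) (Nat.add_assoc k l p) (cBracket (cBracket K L) P) +
        (-1 : ℝ) ^ (k * l) • degCast (VField E N) (Nat.add_left_comm l k p)
          (cBracket L (cBracket K P)) := by
  rcases Nat.lt_or_ge (Module.finrank ℝ E) (k + (l + p)) with hm | hm
  · exact vfield_eq_of_finrank_lt hm _ _
  refine eq_of_chartRep fun e he => ?_
  obtain ⟨W, hW⟩ := exists_chartRep hK.1 he
  obtain ⟨V, hV⟩ := exists_chartRep hL.1 he
  obtain ⟨X, hX⟩ := exists_chartRep hP.1 he
  refine ⟨_, hW.cBracket he hK.1 (cBracket_mem hL.1 hP.1) (hV.cBracket he hL.1 hP.1 hX), ?_⟩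
  rw [Shuffle.cb_jacobi (coordD_comm (targetOpens e)) hW.isForm hV.isForm hX.isForm (hW.tr_eq_zero he hK.2)
    (hV.tr_eq_zero he hL.2) (hX.tr_eq_zero he hP.2) (by simpa using hm)]
  have h1 := (hW.cBracket he hK.1 hL.1 hV).cBracket he (cBracket_mem hK.1 hL.1) hP.1 hX
  have h2 := hV.cBracket he hL.1 (cBracket_mem hK.1 hP.1) (hW.cBracket he hK.1 hP.1 hX)
  exact (h1.degCast (Nat.add_assoc k l p)).add
    ((h2.degCast (Nat.add_left_comm l k p)).smul ((-1 : ℝ) ^ (k * l)))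

theorem coe_degCast (A : ∀ n, Submodule ℝ (VField E N n)) {k' : ℕ} (h : k = k') (K : A k) :
    ((degCast (fun n => A n) h K : A k') : VField E N k') = degCast (VField E N) h K.1 := by
  subst h; rfl

variable (E N) in
/-- The Frölicher–Nijenhuis algebra. -/
def fnStructure : GradedLieStructure (fun k => VectorForms E N k) where
  bracket := LinearMap.mk₂ ℝ (fun K L => ⟨fnBracket K.1 L.1, fnBracket_mem K.2 L.2⟩)
    (fun K K' L => Subtype.ext (fnBracket_add_left K.2 K'.2 L.2))
    (fun r K L => Subtype.ext (fnBracket_smul_left r K.2 L.2))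
    (fun K L L' => Subtype.ext (fnBracket_add_right K.2 L.2 L'.2))
    (fun r K L => Subtype.ext (fnBracket_smul_right r K.2 L.2))
  antisymm K L := Subtype.ext <| by
    refine (fnBracket_antisymm K.2 L.2).trans ?_
    rw [Submodule.coe_neg, Submodule.coe_smul, coe_degCast (VectorForms E N)]
    rfl
  jacobi K L P := Subtype.ext <| by
    refine (fnBracket_jacobi K.2 L.2 P.2).trans ?_
    rw [Submodule.coe_add, Submodule.coe_smul, coe_degCast (VectorForms E N),
      coe_degCast (VectorForms E N)]
    rfl

variable (E N) in
/-- The algebra of traceless vector valued forms. -/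
def cStructure : GradedLieStructure (fun k => Traceless E N k) where
  bracket := LinearMap.mk₂ ℝ (fun K L => ⟨cBracket K.1 L.1, cBracket_mem_traceless K.2 L.2⟩)
    (fun K K' L => Subtype.ext (cBracket_add_left K.2.1 K'.2.1 L.2.1))
    (fun r K L => Subtype.ext (cBracket_smul_left r K.2.1 L.2.1))
    (fun K L L' => Subtype.ext (cBracket_add_right K.2.1 L.2.1 L'.2.1))
    (fun r K L => Subtype.ext (cBracket_smul_right r K.2.1 L.2.1))
  antisymm K L := Subtype.ext <| by
    refine (cBracket_antisymm K.2 L.2).trans ?_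
    rw [Submodule.coe_neg, Submodule.coe_smul, coe_degCast (Traceless E N)]
    rfl
  jacobi K L P := Subtype.ext <| by
    refine (cBracket_jacobi K.2 L.2 P.2).trans ?_
    rw [Submodule.coe_add, Submodule.coe_smul, coe_degCast (Traceless E N),
      coe_degCast (Traceless E N)]
    rfl

/-- `Θ([K, L]) = Θ(K) Θ(L) - (-1)^(kl) Θ(L) Θ(K)`. -/
theorem theta_fnBracket {K : VField E N k} {L : VField E N l} (hK : K ∈ VectorForms E N k)
    (hL : L ∈ VectorForms E N l) {η : SField E N p} (hη : η ∈ ScalarForms E N p) :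
    degCast (SField E N) (Nat.add_assoc k l p) (theta (fnBracket K L) η) =
      theta K (theta L η) - (-1 : ℝ) ^ (k * l) •
        degCast (SField E N) (Nat.add_left_comm l k p) (theta L (theta K η)) := by
  have hmem {k l : ℕ} {K : VField E N k} {η : SField E N l} (hK : K ∈ VectorForms E N k)
      (hη : η ∈ ScalarForms E N l) : theta K η ∈ ScalarForms E N (k + l) := fun e he =>
    (contDiffOn_thetaFlat (U := targetOpens e) (hK e he) (hη e he)).congr fun _ hy =>
      (isParam_chart_symm he).pullS_theta hK hη hy
  refine sfield_ext fun e he y hy => ?_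
  have hp := isParam_chart_symm he
  have hy' : y ∈ targetOpens e := hy
  have h1 := thetaFlat_fnFlat (U := targetOpens e) (hK e he) (hL e he) (hη e he) hy'
  have h2 : ∀ {n n' : ℕ} (h : n = n') (θ : SField E N n), pullS e.symm (degCast (SField E N) h θ) y
      = degCast (fun n => E [⋀^Fin n]→L[ℝ] ℝ) h (pullS e.symm θ y) := by
    intro n n' h θ; subst h; rfl
  have h3 : ∀ (θ θ' : SField E N (k + (l + p))) (r : ℝ), pullS e.symm (θ - r • θ') y =
      pullS e.symm θ y - r • pullS e.symm θ' y := fun _ _ _ => rfl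
  rw [h3, h2, h2, hp.pullS_theta (fnBracket_mem hK hL) hη hy',
    hp.pullS_theta hK (hmem hL hη) hy', hp.pullS_theta hL (hmem hK hη) hy',
    thetaFlat_congr_on (fun z hz => hp.pullV_fnBracket hK hL hz) (fun _ _ => rfl) hy',
    thetaFlat_congr_on (K := pullV e.symm K) (fun _ _ => rfl)
      (fun z hz => hp.pullS_theta hL hη hz) hy',
    thetaFlat_congr_on (K := pullV e.symm L) (fun _ _ => rfl)
      (fun z hz => hp.pullS_theta hK hη hz) hy', h1]

variable (E N) in
/-- The vector valued forms whose trace is closed. -/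
def ClosedTrace (k : ℕ) : Submodule ℝ (VectorForms E N k) where
  carrier := {K | ∀ e ∈ atlas E N, ∀ y ∈ e.target,
    extDeriv (fun z => contr (pullV e.symm K.1 z)) y = 0}
  zero_mem' e he y hy := by
    have h : (fun z => contr (pullV e.symm (0 : VField E N k) z)) = 0 := by
      funext z
      have : pullV e.symm (0 : VField E N k) z = 0 := by ext v; simp [pullV]
      rw [this, contr_zero]; rfl
    refine (congrArg (fun θ => extDeriv θ y) h).trans ?_
    simpa using extDeriv_smul (0 : ℝ) (0 : E → E [⋀^Fin (k - 1)]→L[ℝ] ℝ) (x := y)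
  add_mem' {K L} hK hL e he y hy := by
    obtain ⟨W, hW⟩ := exists_chartRep K.2 he
    obtain ⟨V, hV⟩ := exists_chartRep L.2 he
    have h : (fun z => contr (pullV e.symm (K.1 + L.1) z)) =
        fun z => contr (pullV e.symm K.1 z) + contr (pullV e.symm L.1 z) := by
      funext z; rw [pullV_add, Pi.add_apply, contr_add]
    refine (congrArg (fun θ => extDeriv θ y) h).trans ?_
    rw [extDeriv_fun_add (hW.contr.differentiableAt ⟨y, hy⟩) (hV.contr.differentiableAt ⟨y, hy⟩),
      hK e he y hy, hL e he y hy, add_zero]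
  smul_mem' r K hK e he y hy := by
    have h : (fun z => contr (pullV e.symm (r • K.1) z)) =
        fun z => r • contr (pullV e.symm K.1 z) := by
      funext z; rw [pullV_smul, Pi.smul_apply, contr_smul]
    refine (congrArg (fun θ => extDeriv θ y) h).trans ?_
    refine (extDeriv_fun_smul r fun z => contr (pullV e.symm K.1 z)).trans ?_
    rw [hK e he y hy, smul_zero]

theorem ChartRep.d_tr_eq_zero {K : VectorForms E N k} (hK : K ∈ ClosedTrace E N k)
    {e : OpenPartialHomeomorph N E} (he : e ∈ atlas E N)
    {W : Fin (Module.finrank ℝ E) → Comp (targetOpens e)} (h : ChartRep e K.1 W) :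
    Shuffle.d (coordD (targetOpens e)) (Shuffle.tr W) = 0 :=
  h.contr.extDeriv.unique (Rep.zero.congr fun y => hK e he y y.2)

theorem fnBracket_mem_closedTrace {K : VectorForms E N k} {L : VectorForms E N l}
    (hK : K ∈ ClosedTrace E N k) (hL : L ∈ ClosedTrace E N l) :
    (⟨fnBracket K.1 L.1, fnBracket_mem K.2 L.2⟩ : VectorForms E N (k + l)) ∈
      ClosedTrace E N (k + l) := fun e he y hy => by
  obtain ⟨W, hW⟩ := exists_chartRep K.2 he
  obtain ⟨V, hV⟩ := exists_chartRep L.2 he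
  have h := (hW.fnBracket he K.2 L.2 hV).contr.extDeriv
  rw [Shuffle.d_tr_fn (coordD_comm (targetOpens e)) hW.isForm hV.isForm (hW.d_tr_eq_zero hK he)
    (hV.d_tr_eq_zero hL he)] at h
  exact h.eq Rep.zero ⟨y, hy⟩

variable (E N) in
/-- The subalgebra of the forms whose trace is closed. -/
def closedTraceSubalgebra : GradedLieSubalgebra (fnStructure E N) where
  carrier := ClosedTrace E N
  bracket_mem hK hL := fnBracket_mem_closedTrace hK hL

theorem prField_fnBracket {K : VectorForms E N k} {L : VectorForms E N l}
    (hK : K ∈ ClosedTrace E N k) (hL : L ∈ ClosedTrace E N l) :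
    prField (fnBracket K.1 L.1) = cBracket (prField K.1) (prField L.1) := by
  rcases Nat.lt_or_ge (Module.finrank ℝ E) (k + l) with hm | hm
  · exact vfield_eq_of_finrank_lt hm _ _
  refine eq_of_chartRep fun e he => ?_
  obtain ⟨W, hW⟩ := exists_chartRep K.2 he
  obtain ⟨V, hV⟩ := exists_chartRep L.2 he
  refine ⟨_, (hW.fnBracket he K.2 L.2 hV).prField he, ?_⟩
  rw [Shuffle.pr_fn hW.isForm hV.isForm (hW.d_tr_eq_zero hK he) (hV.d_tr_eq_zero hL he)
    (by simpa using hm)]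
  exact (hW.prField he).cBracket he (prField_mem K.2) (prField_mem L.2) (hV.prField he)

-- The homomorphism is `prField`. It is surjective because a traceless field has closed trace and is
-- fixed by the projection.
variable (E N) in
theorem isQuotientOf_closedTrace : IsQuotientOf (cStructure E N) (closedTraceSubalgebra E N) := by
  refine ⟨fun k =>
    { toFun := fun K => ⟨prField K.1.1, prField_mem_traceless K.1.2⟩
      map_add' := fun K L => Subtype.ext (prField_add K.1.1 L.1.1)
      map_smul' := fun r K => Subtype.ext (prField_smul r K.1.1) }, fun k P => ?_, fun K L => ?_⟩
  · refine ⟨⟨⟨P.1, P.2.1⟩, fun e he y hy => ?_⟩, Subtype.ext (prField_eq_self P.2.2)⟩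
    obtain ⟨W, hW⟩ := exists_chartRep P.2.1 he
    have h := hW.contr.extDeriv
    rw [hW.tr_eq_zero he P.2.2, map_zero] at h
    exact h.eq Rep.zero ⟨y, hy⟩
  · exact Subtype.ext (prField_fnBracket K.2 L.2)

end Structures

/-! ### The bracket is a differential operator of order one -/

section OrderOne

open TopologicalSpace (Opens)

variable {E : Type*} [NormedAddCommGroup E] [NormedSpace ℝ E] [FiniteDimensional ℝ E]
  {U U' : Opens E} {k l : ℕ}

/-- Evaluation of the components at a point. -/
def evalPt (y : U) : Comp U →+* Shuffle (Fin (Module.finrank ℝ E)) ℝ where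
  toFun w := fun s => evalAt y (w s)
  map_one' := by
    ext s
    cases s with
    | nil => exact map_one (evalAt y)
    | cons a s => exact map_zero (evalAt y)
  map_mul' w w' := by
    ext s
    have := Shuffle.map_mul_apply id (evalAt y) (φ := w) (ψ := w')
      (φ' := fun s => evalAt y (w s)) (ψ' := fun s => evalAt y (w' s))
      (fun s => by rw [List.map_id]) (fun s => by rw [List.map_id]) s
    rwa [List.map_id] at this
  map_zero' := by ext s; exact map_zero (evalAt y)
  map_add' w w' := by ext s; exact map_add (evalAt y) (w s) (w' s)

theorem evalPt_apply (y : U) (w : Comp U) (s : List (Fin (Module.finrank ℝ E))) :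
    evalPt y w s = (w s).1 y := rfl

theorem evalPt_smul (y : U) (r : ℝ) (w : Comp U) : evalPt y (r • w) = r • evalPt y w := by
  ext s; exact map_smul (evalAt y) r (w s)

theorem evalPt_cut (y : U) (a : Fin (Module.finrank ℝ E)) (w : Comp U) :
    evalPt y (Shuffle.cut a w) = Shuffle.cut a (evalPt y w) := rfl

theorem evalPt_dx (y : U) (a : Fin (Module.finrank ℝ E)) :
    evalPt y (Shuffle.dx a) = Shuffle.dx a := by
  ext s
  change evalAt y (if s = [a] then 1 else 0) = if s = [a] then 1 else 0
  split_ifs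
  · exact map_one _
  · exact map_zero _

/-- `w` at `y` and `w'` at `y'` have the same value and first derivatives. -/
structure SameJet (y : U) (y' : U') (w : Comp U) (w' : Comp U') : Prop where
  val : evalPt y w = evalPt y' w'
  der : ∀ a, evalPt y (Shuffle.pd (coordD U) a w) = evalPt y' (Shuffle.pd (coordD U') a w')

namespace SameJet

variable {y : U} {y' : U'}

/-- Differentiation uses up the jet: only the values of the derivatives at the two points can be
compared. -/
theorem d {w : Comp U} {w' : Comp U'} (h : SameJet y y' w w') :
    evalPt y (Shuffle.d (coordD U) w) = evalPt y' (Shuffle.d (coordD U') w') := by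
  simp only [Shuffle.d_eq_sum, map_sum, map_mul, evalPt_dx, h.der]

theorem cut {w : Comp U} {w' : Comp U'} (h : SameJet y y' w w')
    (a : Fin (Module.finrank ℝ E)) : SameJet y y' (Shuffle.cut a w) (Shuffle.cut a w') where
  val := congrArg (Shuffle.cut a) h.val
  der b := congrArg (Shuffle.cut a) (h.der b)

theorem mul {w v : Comp U} {w' v' : Comp U'} (h : SameJet y y' w w') (h' : SameJet y y' v v') :
    SameJet y y' (w * v) (w' * v') where
  val := by rw [map_mul, map_mul, h.val, h'.val]
  der a := by simp only [Shuffle.pd_mul, map_add, map_mul, h.val, h'.val, h.der, h'.der]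

theorem sum {α : Type*} [Fintype α] {w : α → Comp U} {w' : α → Comp U'}
    (h : ∀ a, SameJet y y' (w a) (w' a)) : SameJet y y' (∑ a, w a) (∑ a, w' a) where
  val := by simp only [map_sum, (h _).val]
  der a := by simp only [map_sum, (h _).der]

theorem lie {W : Fin (Module.finrank ℝ E) → Comp U} {W' : Fin (Module.finrank ℝ E) → Comp U'}
    {w : Comp U} {w' : Comp U'} (hp : ∀ a, Shuffle.HasParity k (W a))
    (hp' : ∀ a, Shuffle.HasParity k (W' a)) (hW : ∀ a, SameJet y y' (W a) (W' a))
    (h : SameJet y y' w w') :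
    evalPt y (Shuffle.lie (coordD U) k W w) = evalPt y' (Shuffle.lie (coordD U') k W' w') := by
  simp only [Shuffle.lie_eq_sum hp, Shuffle.lie_eq_sum hp', map_sum, map_add, map_mul, evalPt_smul,
    evalPt_cut, (hW _).val, (hW _).d, h.val, h.der]

/-- `S` contains no derivative, so it inherits equality of `1`-jets and `dS` still has a determined
value; `Θ(K) L^b` is first order in both arguments. -/
theorem cb {W V : Fin (Module.finrank ℝ E) → Comp U} {W' V' : Fin (Module.finrank ℝ E) → Comp U'}
    (hp : Shuffle.IsForm k W) (hp' : Shuffle.IsForm k W') (hq : Shuffle.IsForm l V)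
    (hq' : Shuffle.IsForm l V') (hW : ∀ a, SameJet y y' (W a) (W' a))
    (hV : ∀ a, SameJet y y' (V a) (V' a)) (a : Fin (Module.finrank ℝ E)) :
    evalPt y (Shuffle.cb (coordD U) k l W V a) =
      evalPt y' (Shuffle.cb (coordD U') k l W' V' a) := by
  have hS : SameJet y y' (Shuffle.S W V) (Shuffle.S W' V') :=
    sum fun a => sum fun b => ((hW a).cut b).mul ((hV b).cut a)
  simp only [Shuffle.cb, Shuffle.fn, Pi.sub_apply, Pi.smul_apply, Shuffle.wedgeI_apply, map_sub,
    map_mul, evalPt_smul, evalPt_dx, hS.d, lie hp.parity hp'.parity hW (hV _),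
    lie hq.parity hq'.parity hV (hW _)]

end SameJet

theorem RepV.sameJet {K K' : E → E [⋀^Fin k]→L[ℝ] E} {W : Fin (Module.finrank ℝ E) → Comp U}
    {W' : Fin (Module.finrank ℝ E) → Comp U'} (h : RepV K W) (h' : RepV K' W') {y : U} {y' : U'}
    (hj : jet K y = jet K' y') (a : Fin (Module.finrank ℝ E)) : SameJet y y' (W a) (W' a) where
  val := by
    ext s
    have hv : K y = K' y' := congrArg Prod.fst hj
    rw [evalPt_apply, evalPt_apply, h a s y, h' a s y']
    change evalL (coeff (K y) a) _ = evalL (coeff (K' y') a) _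
    rw [hv]
  der b := by
    have hd : ∀ {K : E → E [⋀^Fin k]→L[ℝ] E} {y : E}, DifferentiableAt ℝ K y →
        fderiv ℝ (fun z => coeff (K z) a) y = (coeffCLM k a).comp (fderiv ℝ K y) := fun hK =>
      ((coeffCLM k a).hasFDerivAt.comp _ hK.hasFDerivAt).fderiv
    ext s
    refine ((h a).fderiv_apply b s y).trans (Eq.trans ?_ ((h' a).fderiv_apply b s y').symm)
    rw [hd (h.differentiableAt y), hd (h'.differentiableAt y'),
      show fderiv ℝ K y = fderiv ℝ K' y' from congrArg Prod.snd hj]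

/-- The bracket at a point depends only on the `1`-jets, and does not depend on the point. -/
theorem cBracket_eq_of_jet_eq {K K' : E → E [⋀^Fin k]→L[ℝ] E} {L L' : E → E [⋀^Fin l]→L[ℝ] E}
    (hK : ContDiffOn ℝ ∞ K U) (hL : ContDiffOn ℝ ∞ L U) (hK' : ContDiffOn ℝ ∞ K' U')
    (hL' : ContDiffOn ℝ ∞ L' U') {y y' : E} (hy : y ∈ U) (hy' : y' ∈ U')
    (h : jet K y = jet K' y') (h' : jet L y = jet L' y') :
    cBracket (M := E) K L y = cBracket (M := E) K' L' y' := by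
  obtain ⟨W, hW⟩ := exists_repV hK
  obtain ⟨V, hV⟩ := exists_repV hL
  obtain ⟨W', hW'⟩ := exists_repV hK'
  obtain ⟨V', hV'⟩ := exists_repV hL'
  refine coeff_injective fun a => evalL_injective (Module.finBasis ℝ E) fun s => ?_
  have h1 := RepV.cBracket hW hV a s ⟨y, hy⟩
  have h2 := RepV.cBracket hW' hV' a s ⟨y', hy'⟩
  refine h1.symm.trans (Eq.trans ?_ h2)
  exact congrFun (SameJet.cb (y := ⟨y, hy⟩) (y' := ⟨y', hy'⟩) hW.isForm hW'.isForm hV.isForm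
    hV'.isForm (hW.sameJet hW' h) (hV.sameJet hV' h') a) s

/-- The affine field with the `1`-jet `j` at the origin. -/
def affineField (j : Jet E k) : VField E E k := fun z => j.1 + j.2 z

theorem contDiff_affineField (j : Jet E k) : ContDiff ℝ ∞ (affineField j) :=
  contDiff_const.add j.2.contDiff

theorem affineField_mem (j : Jet E k) : affineField j ∈ VectorForms E E k := fun e he => by
  rw [chartedSpaceSelf_atlas] at he
  subst he
  change ContDiffOn ℝ ∞ (pullV id (affineField j)) _
  rw [pullV_id]
  exact (contDiff_affineField j).contDiffOn

theorem jet_affineField (j : Jet E k) : jet (affineField j) 0 = j := by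
  refine Prod.ext ?_ ?_
  · simp [jet, affineField]
  · exact ((hasFDerivAt_const j.1 (0 : E)).add (j.2.hasFDerivAt (x := 0))).fderiv.trans (zero_add _)

theorem affineField_add (j j' : Jet E k) :
    affineField (j + j') = affineField j + affineField j' := by
  funext z
  simp only [affineField, Pi.add_apply, Prod.fst_add, Prod.snd_add, add_apply]
  abel

theorem affineField_smul (r : ℝ) (j : Jet E k) : affineField (r • j) = r • affineField j := by
  funext z
  simp only [affineField, Pi.smul_apply, Prod.smul_fst, Prod.smul_snd,
    smul_apply, smul_add]

/-- The bracket as a bilinear map on `1`-jets. -/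
def cJet (E : Type*) [NormedAddCommGroup E] [NormedSpace ℝ E] [FiniteDimensional ℝ E] (k l : ℕ) :
    Jet E k →ₗ[ℝ] Jet E l →ₗ[ℝ] (E [⋀^Fin (k + l)]→L[ℝ] E) :=
  LinearMap.mk₂ ℝ (fun j j' => cBracket (affineField j) (affineField j') 0)
    (fun j j' i => by
      rw [affineField_add, cBracket_add_left (affineField_mem j) (affineField_mem j')
        (affineField_mem i)]; rfl)
    (fun r j i => by
      rw [affineField_smul, cBracket_smul_left r (affineField_mem j) (affineField_mem i)]; rfl)
    (fun j i i' => by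
      rw [affineField_add, cBracket_add_right (affineField_mem j) (affineField_mem i)
        (affineField_mem i')]; rfl)
    (fun r j i => by
      rw [affineField_smul, cBracket_smul_right r (affineField_mem j) (affineField_mem i)]; rfl)

variable {M : Type*} [TopologicalSpace M] [ChartedSpace E M] [IsManifold 𝓘(ℝ, E) ∞ M]

/-- In every chart the bracket has constant coefficients, so `β` does not depend on `y`: it is the
bracket at the origin of the affine fields with the given jets. -/
theorem isBilinearDiffOpOrderOne_cBracket (k l : ℕ) :
    IsBilinearDiffOpOrderOne (Traceless E M k) (Traceless E M l) cBracket := fun e he => by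
  refine ⟨fun _ => cJet E k l, fun _ _ => contDiffOn_const, fun K hK L hL y hy => ?_⟩
  rw [(isParam_chart_symm he).pullV_cBracket hK.1 hL.1 hy]
  exact cBracket_eq_of_jet_eq (U := targetOpens e) (U' := ⊤) (hK.1 e he) (hL.1 e he)
    (contDiff_affineField _).contDiffOn (contDiff_affineField _).contDiffOn hy trivial
    (jet_affineField _).symm (jet_affineField _).symm

end OrderOne

/-! ### Naturality -/

section Naturality

open TopologicalSpace (Opens)

variable {E : Type*} [NormedAddCommGroup E] [NormedSpace ℝ E] [FiniteDimensional ℝ E]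
  {M : Type*} [TopologicalSpace M] [ChartedSpace E M] [IsManifold 𝓘(ℝ, E) ∞ M]
  {N : Type*} [TopologicalSpace N] [ChartedSpace E N] [IsManifold 𝓘(ℝ, E) ∞ N]
  {f : M → N} {k l : ℕ}

theorem pullV_chart_pullV (hf : IsLocalDiffeomorph 𝓘(ℝ, E) 𝓘(ℝ, E) ∞ f)
    {e : OpenPartialHomeomorph M E} (he : e ∈ atlas E M) {y : E} (hy : y ∈ e.target)
    (K : VField E N k) : pullV e.symm (pullV f K) y = pullV (f ∘ e.symm) K y := by
  rw [pullV_apply, pullV_apply, pullV_apply, pullPt_pullPt (isInvertible_tmap_chart_symm he hy)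
    (isInvertible_tmap_of_isLocalDiffeomorphAt (hf _)),
    tmap_comp (hf.mdifferentiable (by simp) _) (mdifferentiableAt_chart_symm he hy)]
  rfl

theorem pullV_mem_vectorForms (hf : IsLocalDiffeomorph 𝓘(ℝ, E) 𝓘(ℝ, E) ∞ f) {K : VField E N k}
    (hK : K ∈ VectorForms E N k) : pullV f K ∈ VectorForms E M k := fun _ he =>
  ((isParam_comp_chart_symm hf he).contDiffOn_pullV hK).congr fun _ hy =>
    pullV_chart_pullV hf he hy K

theorem pullV_mem_traceless (hf : IsLocalDiffeomorph 𝓘(ℝ, E) 𝓘(ℝ, E) ∞ f) {K : VField E N k}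
    (hK : K ∈ Traceless E N k) : pullV f K ∈ Traceless E M k :=
  ⟨pullV_mem_vectorForms hf hK.1, fun x => by
    rw [pullV_apply, contr_pullPt (isInvertible_tmap_of_isLocalDiffeomorphAt (hf x)), hK.2]
    rfl⟩

/-- For a chart `e` of `M` the map `f ∘ e.symm` is a parametrization of `N`, so both sides, read in
`e`, are brackets in `E` of fields that agree on the target of `e`. -/
theorem pullV_cBracket (hf : IsLocalDiffeomorph 𝓘(ℝ, E) 𝓘(ℝ, E) ∞ f) {K : VField E N k}
    {L : VField E N l} (hK : K ∈ VectorForms E N k) (hL : L ∈ VectorForms E N l) :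
    pullV f (cBracket K L) = cBracket (pullV f K) (pullV f L) :=
  vfield_ext fun e he y hy => by
    have hK' := pullV_mem_vectorForms hf hK
    have hL' := pullV_mem_vectorForms hf hL
    obtain ⟨W, hW⟩ := exists_chartRep hK' he
    obtain ⟨V, hV⟩ := exists_chartRep hL' he
    rw [pullV_chart_pullV hf he hy, (isParam_comp_chart_symm hf he).pullV_cBracket hK hL hy,
      (isParam_chart_symm he).pullV_cBracket hK' hL' hy]
    exact (RepV.cBracket (RepV.congr hW fun z => (pullV_chart_pullV hf he z.2 K).symm)
      (RepV.congr hV fun z => (pullV_chart_pullV hf he z.2 L).symm)).eq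
        (RepV.cBracket hW hV) ⟨y, hy⟩

end Naturality

end

end VVForm

theorem theorem2p4 {E : Type*} [NormedAddCommGroup E] [NormedSpace ℝ E]
    [FiniteDimensional ℝ E] {M : Type*} [TopologicalSpace M] [ChartedSpace E M]
    [IsManifold 𝓘(ℝ, E) ∞ M] :
    ∃ (FN : GradedLieStructure (fun k => VectorForms E M k))
      (C : GradedLieStructure (fun k => Traceless E M k)),
      -- `FN` is the Frölicher–Nijenhuis bracket, with `Θ([K, L]) = [Θ(K), Θ(L)]`
      (∀ {k l : ℕ} (K : VectorForms E M k) (L : VectorForms E M l),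
        (FN.bracket K L : VField E M (k + l)) = fnBracket (K : VField E M k) (L : VField E M l) ∧
        ∀ {p : ℕ}, ∀ η ∈ ScalarForms E M p,
          degCast (SField E M) (Nat.add_assoc k l p) (theta (FN.bracket K L).1 η) =
            theta K.1 (theta L.1 η) - (-1 : ℝ) ^ (k * l) •
              degCast (SField E M) (Nat.add_left_comm l k p) (theta L.1 (theta K.1 η))) ∧
      -- the bracket of `C` is `[K, L]^c`
      (∀ {k l : ℕ} (K : Traceless E M k) (L : Traceless E M l),
        (C.bracket K L : VField E M (k + l)) = cBracket (K : VField E M k) (L : VField E M l)) ∧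
      -- quotient of a subalgebra
      (∃ A : GradedLieSubalgebra FN, IsQuotientOf C A) ∧
      -- differential operator of order one
      (∀ k l : ℕ, IsBilinearDiffOpOrderOne (Traceless E M k) (Traceless E M l) cBracket) ∧
      -- naturality
      (∀ {N : Type*} [TopologicalSpace N] [ChartedSpace E N] [IsManifold 𝓘(ℝ, E) ∞ N]
        (f : M → N), IsLocalDiffeomorph 𝓘(ℝ, E) 𝓘(ℝ, E) ∞ f →
        ∀ {k l : ℕ}, ∀ K ∈ Traceless E N k, ∀ L ∈ Traceless E N l,
          pullV f K ∈ Traceless E M k ∧ pullV f L ∈ Traceless E M l ∧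
          pullV f (cBracket K L) = cBracket (pullV f K) (pullV f L)) := by
  exact ⟨fnStructure E M, cStructure E M, fun K L => ⟨rfl, fun _ hη => theta_fnBracket K.2 L.2 hη⟩,
    fun _ _ => rfl, ⟨closedTraceSubalgebra E M, isQuotientOf_closedTrace E M⟩,
    isBilinearDiffOpOrderOne_cBracket, fun _ hf _ _ _ hK _ hL =>
      ⟨pullV_mem_traceless hf hK, pullV_mem_traceless hf hL, pullV_cBracket hf hK.1 hL.1⟩⟩
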